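/- Let $K$ be an arbitrary field, and let $n$ and $s$ be non-negative integers with $2s<n$. Write $A_m(K)$ for the space of all alternating $m\times m$ matrices over $K$ (skew-symmetric matrices with zero diagonal). Call two sets $V,W$ of $n\times n$ matrices congruent if $V=P\,W\,P^T$ for some invertible $n\times n$ matrix $P$ over $K$. Set $$WA_{n,2s}(K)=\left\{\begin{bmatrix}A & B\\ -B^T & 0\end{bmatrix} : A\in A_s(K),\ B\in M_{s,n-s}(K)\right\},$$ $$\widetilde{A_{2s+1}(K)}^{(n)}=\left\{\begin{bmatrix}A & 0\\ 0 & 0\end{bmatrix}\in M_n(K) : A\in A_{2s+1}(K)\right\},$$ $$U(K)=\left\{\begin{bmatrix}0&a&b&c+1\\ a&0&c&0\\ b&c&0&0\\ c+1&0&0&0\end{bmatrix} : (a,b,c)\in K^3\right\}.$$ Let $\mathcal S$ be a non-empty affine subspace of $A_n(K)$ whose upper-rank (the maximal rank of a matrix in $\mathcal S$) is at most $2s$. Then $$\dim \mathcal S\le \max\left(\binom{2s+1}{2},\ \binom{s}{2}+s(n-s)\right).$$ Moreover, if equality holds, then at least one of the following holds: (a) $\mathcal S$ is congruent to $WA_{n,2s}(K)$;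 (b) $\mathcal S$ is congruent to $\widetilde{A_{2s+1}(K)}^{(n)}$; (c) $s=1$, $n=4$, $K$ has exactly two elements, and $\mathcal S$ is congruent to $U(K)$. -/

import Mathlib

/-- The space of all alternating `n × n` matrices over `K`: the skew-symmetric matrices with zero
diagonal. -/
def alternatingMatrices (n : ℕ) (K : Type*) [Field K] :
    Submodule K (Matrix (Fin n) (Fin n) K) where
  carrier := {A | A.transpose = -A ∧ ∀ i, A i i = 0}
  add_mem' := by
    rintro A B ⟨hA, hA'⟩ ⟨hB, hB'⟩
    refine ⟨?_, fun i => ?_⟩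
    · rw [Matrix.transpose_add, hA, hB, neg_add]
    · rw [Matrix.add_apply, hA' i, hB' i, add_zero]
  zero_mem' := by
    refine ⟨?_, fun i => ?_⟩
    · rw [Matrix.transpose_zero, neg_zero]
    · rfl
  smul_mem' := by
    rintro c A ⟨hA, hA'⟩
    refine ⟨?_, fun i => ?_⟩
    · rw [Matrix.transpose_smul, hA, smul_neg]
    · rw [Matrix.smul_apply, hA' i, smul_zero]

/-- Two sets `V`, `W` of `n × n` matrices are congruent when `V = P W Pᵀ` for some invertible
matrix `P`. -/
def SetsCongruent {n : ℕ} {K : Type*} [Field K] (V W : Set (Matrix (Fin n) (Fin n) K)) : Prop :=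
  ∃ P : Matrix (Fin n) (Fin n) K, IsUnit P ∧ V = (fun M => P * M * P.transpose) '' W

/-- The upper-rank of a (non-empty) set of `n × n` matrices: the largest rank of its elements. -/
noncomputable def upperRank {n : ℕ} {K : Type*} [Field K]
    (V : Set (Matrix (Fin n) (Fin n) K)) : ℕ :=
  sSup (Matrix.rank '' V)

/-- The supremum that defines the upper-rank of a non-empty set is a maximum. -/
theorem isGreatest_upperRank {n : ℕ} {K : Type*} [Field K]
    (V : Set (Matrix (Fin n) (Fin n) K)) (hV : V.Nonempty) :
    IsGreatest (Matrix.rank '' V) (upperRank V) := by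
  have hb : BddAbove (Matrix.rank '' V) := by
    refine ⟨n, ?_⟩
    rintro _ ⟨M, -, rfl⟩
    simpa using M.rank_le_width
  exact ⟨Nat.sSup_mem (hV.image _) hb, fun _ hx => le_csSup hb hx⟩

/-- The identification of `k` first indices followed by `n - k` last indices with the `n` indices;
it is used to write `n × n` matrices in blocks. -/
def blockEquiv {k n : ℕ} (h : k ≤ n) : Fin k ⊕ Fin (n - k) ≃ Fin n :=
  finSumFinEquiv.trans (finCongr (Nat.add_sub_of_le h))

/-- The `n × n` matrix with the blocks `A`, `B` (first row) and `C`, `D` (second row), where `A` is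
a `k × k` block. -/
def blockMatrix {k n : ℕ} {K : Type*} (h : k ≤ n) (A : Matrix (Fin k) (Fin k) K)
    (B : Matrix (Fin k) (Fin (n - k)) K) (C : Matrix (Fin (n - k)) (Fin k) K)
    (D : Matrix (Fin (n - k)) (Fin (n - k)) K) : Matrix (Fin n) (Fin n) K :=
  Matrix.reindex (blockEquiv h) (blockEquiv h) (Matrix.fromBlocks A B C D)

/-- The set of all `n × n` matrices obtained from the elements of a set `V` of `k × k` matrices by
padding with `n - k` zero rows and `n - k` zero columns. -/
def zeroPadding {k n : ℕ} {K : Type*} [Field K] (h : k ≤ n)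
    (V : Set (Matrix (Fin k) (Fin k) K)) : Set (Matrix (Fin n) (Fin n) K) :=
  {M | ∃ S ∈ V, M = blockMatrix h S 0 0 0}

/-- The space `WA_{n,2s}(K)` of all matrices `[A, B; -Bᵀ, 0]` with `A` an alternating `s × s` matrix
and `B` an arbitrary `s × (n - s)` matrix. -/
def spaceWA (n s : ℕ) (h : s ≤ n) (K : Type*) [Field K] : Set (Matrix (Fin n) (Fin n) K) :=
  {M | ∃ A ∈ alternatingMatrices s K, ∃ B : Matrix (Fin s) (Fin (n - s)) K,
    M = blockMatrix h A B (-B.transpose) 0}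

/-- The exceptional affine space `U(K)` of `4 × 4` matrices (used only when `K` has two
elements). -/
def exceptionalU (K : Type*) [Field K] : Set (Matrix (Fin 4) (Fin 4) K) :=
  {M | ∃ a b c : K, M = !![0, a, b, c + 1;
                           a, 0, c, 0;
                           b, c, 0, 0;
                           c + 1, 0, 0, 0]}

/-! Alternating matrices are read as alternating bilinear forms on a space `D` of dimension `n`, and
the affine space as a translate `B₀ + V`. The bound on the rank becomes: no form of `B₀ + V` has `s
+ 1` orthogonal hyperbolic pairs.

The bound. Fix a basis and order the pairs of indices by the larger index first. The first nonzero
entries of the forms of `V` are the edges of a graph on `n` vertices with exactly `dim V` edges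
(`finrank_eq_card_leadGraph`). Forms led by `k` disjoint edges can be added to `B₀`, each or not, so
as to produce `k` hyperbolic pairs (`exists_hasHyperbolic_of_matching`). Hence the graph has no `s +
1` disjoint edges, and the Erdős–Gallai theorem, deduced from Tutte's theorem through Berge's
formula, bounds its number of edges. Equality leaves two graphs: a clique on `2s + 1` vertices, or
`s` vertices joined to everything.

Equality, by induction on `n`. For a nonzero linear form `x`, the slice of `x` consists of the `y`
with `x ∧ y ∈ V`. Its dimension minus one is the loss of dimension of `V` on restriction to `ker x`,
and also the degree of the last vertex of the graph in a basis whose last coordinate is `x`. If some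
slice has dimension above `2s + 1`, the rank on `ker x` drops to `2(s - 1)`, and a common isotropic
subspace of `ker x` given by induction has codimension `s` in `D`. If some slice has dimension `1`,
restriction to `H = ker x` is injective, and the restricted space consists of all the forms on `H`
with a given radical. The remaining row of a form is an affine function of its restriction, and the
rank condition makes it kill the radical of each restriction of rank `2s`. Such a function is a
contraction by a fixed vector, which yields one more radical vector; over the field with two
elements with `s = 1` it may have a constant term instead, and this gives `U(K)`. In the remaining
case the two graphs force every slice to have dimension `s + 1`. Restriction to `ker x ∩ ker y`,
with `x ∧ y` in `V`, yields an isotropic subspace of codimension `s + 1`. Its annihilator then has a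
basis `g i` with independent partners `X i` such that `X i ∧ g i ∈ V`, so the rank `2s + 2` is
reached: a contradiction. -/

section AffineSpacesOfAlternatingForms

open Module

set_option maxSynthPendingDepth 3

/-! ### Matchings, Berge's deficiency formula and the Erdős–Gallai theorem -/

/-- A fixed-point-free involution of a finite set with at least `2 * m` elements has `m` disjoint
two-element orbits. -/
theorem exists_disjoint_pairs_of_involution {V : Type*} [LinearOrder V] (X : Finset V) (σ : V → V)
    (hX : ∀ v ∈ X, σ v ∈ X) (hσ : ∀ v ∈ X, σ (σ v) = v) (hne : ∀ v ∈ X, σ v ≠ v) (m : ℕ)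
    (hm : 2 * m ≤ X.card) :
    ∃ a b : Fin m → V, Function.Injective (Sum.elim a b) ∧ ∀ i, a i ∈ X ∧ b i = σ (a i) := by
  classical
  set A := X.filter (fun v => v < σ v) with hA
  set B := X.filter (fun v => ¬ v < σ v) with hB
  have hAB : A.card = B.card := by
    refine Finset.card_bij' (fun v _ => σ v) (fun v _ => σ v) ?_ ?_ ?_ ?_
    · intro v hv
      rw [hA, Finset.mem_filter] at hv
      rw [hB, Finset.mem_filter, hσ v hv.1]
      exact ⟨hX v hv.1, not_lt.2 hv.2.le⟩
    · intro v hv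
      rw [hB, Finset.mem_filter] at hv
      rw [hA, Finset.mem_filter, hσ v hv.1]
      exact ⟨hX v hv.1, lt_of_le_of_ne (not_lt.1 hv.2) (hne v hv.1)⟩
    · intro v hv
      exact hσ v (Finset.mem_filter.1 hv).1
    · intro v hv
      exact hσ v (Finset.mem_filter.1 hv).1
  have hsum : A.card + B.card = X.card := Finset.card_filter_add_card_filter_not _
  have hmA : m ≤ A.card := by omega
  set a := A.orderEmbOfCardLe hmA with ha
  have haA : ∀ i, a i ∈ A := fun i => Finset.orderEmbOfCardLe_mem A hmA i
  have haX : ∀ i, a i ∈ X := fun i => (Finset.mem_filter.1 (haA i)).1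
  have halt : ∀ i, a i < σ (a i) := fun i => (Finset.mem_filter.1 (haA i)).2
  refine ⟨a, fun i => σ (a i), ?_, fun i => ⟨haX i, rfl⟩⟩
  have hdisj : ∀ i j, a i ≠ σ (a j) := by
    intro i j h
    have h1 := halt i
    rw [h, hσ _ (haX j)] at h1
    exact lt_asymm h1 (halt j)
  refine Function.Injective.sumElim a.injective ?_ hdisj
  intro i j h
  apply a.injective
  rw [← hσ _ (haX i), ← hσ _ (haX j)]
  exact congrArg σ h

/-- The graph obtained from `G` by adding `d` universal vertices. -/
def SimpleGraph.addUniversal {V : Type*} (G : SimpleGraph V) (d : ℕ) :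
    SimpleGraph (V ⊕ Fin d) where
  Adj x y := x ≠ y ∧ ∀ v w, x = Sum.inl v → y = Sum.inl w → G.Adj v w
  symm := ⟨fun _ _ h => ⟨h.1.symm, fun v w hv hw => (h.2 w v hw hv).symm⟩⟩
  loopless := ⟨fun _ h => h.1 rfl⟩

theorem SimpleGraph.addUniversal_adj_inr {V : Type*} (G : SimpleGraph V) (d : ℕ)
    (x : V ⊕ Fin d) (i : Fin d) (h : x ≠ Sum.inr i) : (G.addUniversal d).Adj x (Sum.inr i) :=
  ⟨h, fun _ _ _ hw => by simp at hw⟩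

/-- At most `d` vertices of `V` can be matched with the `d` universal vertices; the other ones, at
least `2 * m` in number, are matched with one another along edges of `G`. -/
theorem SimpleGraph.exists_pairs_of_isPerfectMatching_addUniversal {V : Type*} [Fintype V]
    [LinearOrder V] (G : SimpleGraph V) (m d : ℕ) (hd : Fintype.card V = 2 * m + d)
    (M : (G.addUniversal d).Subgraph) (hM : M.IsPerfectMatching) :
    ∃ a b : Fin m → V, Function.Injective (Sum.elim a b) ∧ ∀ i, G.Adj (a i) (b i) := by
  classical
  rw [SimpleGraph.Subgraph.isPerfectMatching_iff] at hM
  choose f hf hfu using hM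
  have hff : ∀ x, f (f x) = x := fun x => (hfu (f x) x (hf x).symm).symm
  have hadj : ∀ x, (G.addUniversal d).Adj x (f x) := fun x => (hf x).adj_sub
  set X : Finset V := Finset.univ.filter (fun v => (f (Sum.inl v)).isLeft) with hX
  set σ : V → V := fun v => Sum.elim id (fun _ => v) (f (Sum.inl v)) with hσ
  have hσX : ∀ v ∈ X, f (Sum.inl v) = Sum.inl (σ v) := by
    intro v hv
    have h1 := (Finset.mem_filter.1 hv).2
    simp only [hσ]
    cases h : f (Sum.inl v) with
    | inl w => simp
    | inr i => simp [h] at h1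
  have hmem : ∀ v w, f (Sum.inl v) = Sum.inl w → v ∈ X := by
    intro v w h
    simp [hX, h]
  have hcard : 2 * m ≤ X.card := by
    have h1 : X.card + (Finset.univ.filter (fun v => ¬ (f (Sum.inl v)).isLeft)).card
        = Fintype.card V := by
      rw [hX, Finset.card_filter_add_card_filter_not, Finset.card_univ]
    have h2 : (Finset.univ.filter (fun v => ¬ (f (Sum.inl v)).isLeft)).card ≤ d := by
      have h3 : (Finset.univ.filter (fun v : V => ¬ (f (Sum.inl v)).isLeft)).card ≤
          ((Finset.univ : Finset (Fin d)).image (fun i => (Sum.inr i : V ⊕ Fin d))).card := by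
        refine Finset.card_le_card_of_injOn (fun v => f (Sum.inl v)) ?_ ?_
        · intro v hv
          have h4 := (Finset.mem_filter.1 hv).2
          cases h : f (Sum.inl v) with
          | inl w => simp [h] at h4
          | inr i => simp [h]
        · intro v _ w _ h
          have h5 : f (f (Sum.inl v)) = f (f (Sum.inl w)) := congrArg f h
          rw [hff, hff] at h5
          exact Sum.inl_injective h5
      exact h3.trans (Finset.card_image_le.trans (by simp))
    omega
  have hσσ : ∀ v ∈ X, σ v ∈ X ∧ σ (σ v) = v := by
    intro v hv
    have h1 : f (Sum.inl (σ v)) = Sum.inl v := by rw [← hσX v hv, hff]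
    have h2 := hmem _ _ h1
    refine ⟨h2, ?_⟩
    have h3 := hσX _ h2
    rw [h1] at h3
    exact (Sum.inl_injective h3).symm
  have hadjσ : ∀ v ∈ X, G.Adj v (σ v) := fun v hv => (hadj (Sum.inl v)).2 v (σ v) rfl (hσX v hv)
  obtain ⟨a, b, hinj, hab⟩ := exists_disjoint_pairs_of_involution X σ (fun v hv => (hσσ v hv).1)
    (fun v hv => (hσσ v hv).2) (fun v hv => (hadjσ v hv).ne') m hcard
  refine ⟨a, b, hinj, fun i => ?_⟩
  rw [(hab i).2]
  exact hadjσ _ (hab i).1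

/-- Berge's deficiency formula (the non-trivial half): a graph without `m` disjoint edges has a set
`U` of vertices whose removal leaves many connected components. -/
theorem SimpleGraph.exists_deficiency.{u} {V : Type u} [Fintype V] [LinearOrder V] (G : SimpleGraph V)
    (m : ℕ) (hm : 2 * m ≤ Fintype.card V)
    (h : ¬ ∃ a b : Fin m → V, Function.Injective (Sum.elim a b) ∧ ∀ i, G.Adj (a i) (b i)) :
    ∃ (U : Finset V) (X : Type u) (_ : DecidableEq X) (r : V → X),
      (∀ v w, v ∉ U → w ∉ U → G.Adj v w → r v = r w) ∧
      Fintype.card V + U.card + 2 ≤ (Uᶜ.image r).card + 2 * m := by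
  classical
  obtain ⟨d, hd⟩ := Nat.exists_eq_add_of_le hm
  have hnot : ¬ ∃ M : (G.addUniversal d).Subgraph, M.IsPerfectMatching := by
    rintro ⟨M, hM⟩
    exact h (G.exists_pairs_of_isPerfectMatching_addUniversal m d hd M hM)
  rw [SimpleGraph.tutte] at hnot
  push Not at hnot
  obtain ⟨W, hW⟩ := hnot
  unfold SimpleGraph.IsTutteViolator at hW
  set H := ((⊤ : (G.addUniversal d).Subgraph).deleteVerts W).coe with hH
  have hcardW : Nat.card ((⊤ : (G.addUniversal d).Subgraph).deleteVerts W).verts + W.ncard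
      = Fintype.card V + d := by
    have h1 : ((⊤ : (G.addUniversal d).Subgraph).deleteVerts W).verts = Wᶜ := by
      simp [Set.compl_eq_univ_sdiff]
    rw [h1, Nat.card_coe_set_eq, add_comm, Set.ncard_add_ncard_compl]
    simp
  have hpar := SimpleGraph.odd_ncard_oddComponents (G := H)
  -- The graph with the universal vertices has `2 * m + 2 * d` vertices, so the number of odd
  -- components has the parity of `W.ncard`: an excess of one is automatically an excess of two.
  have hge : W.ncard + 2 ≤ H.oddComponents.ncard := by
    by_contra hlt
    have h2 : H.oddComponents.ncard = W.ncard + 1 := by omega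
    have h3 : Odd (W.ncard + 1) ↔ Odd (Nat.card ((⊤ : (G.addUniversal d).Subgraph).deleteVerts W).verts) := by
      rw [← h2]; exact hpar
    rw [Nat.odd_iff, Nat.odd_iff] at h3
    omega
  have hadjH : ∀ x y : ((⊤ : (G.addUniversal d).Subgraph).deleteVerts W).verts,
      (G.addUniversal d).Adj x y → H.Adj x y := by
    intro x y hxy
    simp only [hH, SimpleGraph.Subgraph.coe_adj, SimpleGraph.Subgraph.deleteVerts_adj]
    have hx := x.2
    have hy := y.2
    simp only [SimpleGraph.Subgraph.deleteVerts_verts, Set.mem_sdiff] at hx hy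
    exact ⟨hx.1, hx.2, hy.1, hy.2, by simpa using hxy⟩
  have hmemv : ∀ x : V ⊕ Fin d, x ∉ W → x ∈ ((⊤ : (G.addUniversal d).Subgraph).deleteVerts W).verts := by
    intro x hx
    simpa [SimpleGraph.Subgraph.deleteVerts_verts] using hx
  have hinr : ∀ i : Fin d, (Sum.inr i : V ⊕ Fin d) ∈ W := by
    intro i
    by_contra hi
    -- A universal vertex that survives would connect everything, while there are at least two
    -- components.
    have hsub : Subsingleton H.ConnectedComponent := by
      refine ⟨?_⟩
      have key : ∀ c : H.ConnectedComponent, c = H.connectedComponentMk ⟨_, hmemv _ hi⟩ := by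
        intro c
        refine c.ind ?_
        intro x
        by_cases hx : (x : V ⊕ Fin d) = Sum.inr i
        · have : x = ⟨_, hmemv _ hi⟩ := Subtype.ext hx
          rw [this]
        · exact SimpleGraph.ConnectedComponent.sound
            (hadjH _ _ (G.addUniversal_adj_inr d x i hx)).reachable
      intro c c'
      rw [key c, key c']
    have h5 : H.oddComponents.ncard ≤ 1 := Set.ncard_le_one_of_subsingleton _
    omega
  set U : Finset V := Finset.univ.filter (fun v => (Sum.inl v : V ⊕ Fin d) ∈ W) with hU
  have hUW : W.ncard = U.card + d := by
    have h6 : W = (((U.image Sum.inl) ∪ (Finset.univ.image Sum.inr) : Finset (V ⊕ Fin d)) : Set (V ⊕ Fin d)) := by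
      ext x
      cases x with
      | inl v => simp [hU]
      | inr i => simpa using hinr i
    rw [h6, Set.ncard_coe_finset, Finset.card_union_of_disjoint,
      Finset.card_image_of_injective _ Sum.inl_injective,
      Finset.card_image_of_injective _ Sum.inr_injective]
    · simp
    · rw [Finset.disjoint_left]
      intro x hx hx'
      simp only [Finset.mem_image] at hx hx'
      obtain ⟨_, _, rfl⟩ := hx
      obtain ⟨_, _, h7⟩ := hx'
      simp at h7
  have hnU : ∀ v, v ∉ U → (Sum.inl v : V ⊕ Fin d) ∉ W := by
    intro v hv hv'
    exact hv (by simp [hU, hv'])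
  -- The colour of a vertex is its component. The value `none` is only taken on `U`, where colours
  -- do not matter.
  refine ⟨U, Option H.ConnectedComponent, inferInstance, fun v => if hv : (Sum.inl v : V ⊕ Fin d) ∉ W then
    some (H.connectedComponentMk ⟨_, hmemv _ hv⟩) else none, ?_, ?_⟩
  · intro v w hv hw hvw
    simp only [hnU v hv, hnU w hw, not_false_eq_true, dif_pos]
    congr 1
    refine SimpleGraph.ConnectedComponent.sound (SimpleGraph.Adj.reachable (hadjH _ _ ⟨?_, ?_⟩))
    · simpa using hvw.ne
    · intro v' w' h8 h9
      rw [← Sum.inl_injective h8, ← Sum.inl_injective h9]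
      exact hvw
  · have h10 : H.oddComponents.ncard ≤ (Uᶜ.image (fun v => if hv : (Sum.inl v : V ⊕ Fin d) ∉ W then
      some (H.connectedComponentMk ⟨_, hmemv _ hv⟩) else none)).card := by
      rw [← Set.ncard_coe_finset]
      refine Set.ncard_le_ncard_of_injOn some ?_ (fun a _ b _ hab => Option.some_injective _ hab)
        (Finset.finite_toSet _)
      intro c _
      refine c.ind ?_
      rintro ⟨x, hx⟩
      have hxW : x ∉ W := by
        simpa [SimpleGraph.Subgraph.deleteVerts_verts] using hx
      cases x with
      | inl v =>
        simp only [Finset.coe_image, Set.mem_image]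
        refine ⟨v, by simpa [hU] using hxW, ?_⟩
        simp [hxW]
      | inr i => exact absurd (hinr i) hxW
    omega

/-- The number of ordered pairs of distinct elements with equal images under `r`. -/
theorem card_offDiag_filter_eq {V X : Type*} [DecidableEq V] [DecidableEq X] (N : Finset V)
    (r : V → X) :
    (N.offDiag.filter (fun p => r p.1 = r p.2)).card =
      ∑ x ∈ N.image r, ((N.filter (fun v => r v = x)).card - 1 + 1) *
        ((N.filter (fun v => r v = x)).card - 1) := by
  rw [Finset.card_eq_sum_card_fiberwise (f := fun p => r p.1) (t := N.image r)]
  · refine Finset.sum_congr rfl fun x hx => ?_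
    obtain ⟨v, hv, rfl⟩ := Finset.mem_image.1 hx
    have hpos : 0 < (N.filter (fun w => r w = r v)).card :=
      Finset.card_pos.2 ⟨v, Finset.mem_filter.2 ⟨hv, rfl⟩⟩
    have h1 : ((N.offDiag.filter (fun p => r p.1 = r p.2)).filter (fun p => r p.1 = r v)) =
        (N.filter (fun w => r w = r v)).offDiag := by
      ext ⟨p, q⟩
      simp only [Finset.mem_filter, Finset.mem_offDiag]
      grind
    rw [h1, Finset.offDiag_card, Nat.sub_add_cancel hpos, Nat.mul_sub, mul_one]
  · intro p hp
    have hp' := Finset.mem_offDiag.1 (Finset.mem_filter.1 (Finset.mem_coe.1 hp)).1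
    exact Finset.mem_coe.2 (Finset.mem_image_of_mem _ hp'.1)

theorem sum_card_fiber_sub_one {V X : Type*} [DecidableEq X] (N : Finset V)
    (r : V → X) :
    ∑ x ∈ N.image r, ((N.filter (fun v => r v = x)).card - 1) + (N.image r).card = N.card := by
  have h1 : ∑ x ∈ N.image r, (N.filter (fun v => r v = x)).card = N.card :=
    (Finset.card_eq_sum_card_fiberwise (f := r) (t := N.image r)
      (fun v hv => Finset.mem_coe.2 (Finset.mem_image_of_mem _ hv))).symm
  rw [← h1, Finset.card_eq_sum_ones, ← Finset.sum_add_distrib]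
  refine Finset.sum_congr rfl fun x hx => ?_
  obtain ⟨v, hv, rfl⟩ := Finset.mem_image.1 hx
  have hpos : 0 < (N.filter (fun w => r w = r v)).card :=
    Finset.card_pos.2 ⟨v, Finset.mem_filter.2 ⟨hv, rfl⟩⟩
  omega

/-- The edges of a graph in terms of a set `U` of vertices and a colouring that is constant along
the edges outside `U`. -/
theorem SimpleGraph.edges_subset_of_coloring {V X : Type*} [Fintype V] [DecidableEq V]
    [DecidableEq X] (G : SimpleGraph V) [DecidableRel G.Adj] (U : Finset V) (r : V → X)
    (hr : ∀ v w, v ∉ U → w ∉ U → G.Adj v w → r v = r w) :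
    (Finset.univ.filter (fun p : V × V => G.Adj p.1 p.2)) ⊆
      ((Finset.univ : Finset V).offDiag \ Uᶜ.offDiag) ∪
        (Uᶜ.offDiag.filter (fun p => r p.1 = r p.2)) := by
  rintro ⟨v, w⟩ h
  have h1 : G.Adj v w := (Finset.mem_filter.1 h).2
  have h2 := h1.ne
  have h3 := hr v w
  simp only [Finset.mem_union, Finset.mem_sdiff, Finset.mem_filter, Finset.mem_offDiag,
    Finset.mem_univ, Finset.mem_compl]
  tauto

theorem sq_sum_le_of_nonneg_eq {X : Type*} (I : Finset X) (b : X → ℕ) :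
    ∑ x ∈ I, (b x + 1) * b x ≤ (∑ x ∈ I, b x + 1) * ∑ x ∈ I, b x := by
  rw [Finset.mul_sum]
  refine Finset.sum_le_sum fun x hx => Nat.mul_le_mul_right _ ?_
  exact Nat.add_le_add_right (Finset.single_le_sum (f := b) (fun _ _ => Nat.zero_le _) hx) 1

/-- The inequality `sq_sum_le_of_nonneg_eq` holds term by term, so equality holds term by term: a
nonzero `b x` is the whole sum. -/
theorem eq_sum_of_sum_mul_eq {X : Type*} (I : Finset X) (b : X → ℕ)
    (h : ∑ x ∈ I, (b x + 1) * b x = (∑ x ∈ I, b x + 1) * ∑ x ∈ I, b x) :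
    ∀ x ∈ I, b x = 0 ∨ b x = ∑ y ∈ I, b y := by
  rw [Finset.mul_sum] at h
  have h1 := (Finset.sum_eq_sum_iff_of_le (fun x hx => Nat.mul_le_mul_right (b x)
    (Nat.add_le_add_right (Finset.single_le_sum (f := b) (fun _ _ => Nat.zero_le _) hx) 1))).1 h
  intro x hx
  rcases Nat.eq_zero_or_pos (b x) with h0 | h0
  · exact Or.inl h0
  · have h2 := Nat.eq_of_mul_eq_mul_right h0 (h1 x hx)
    exact Or.inr (by omega)

/-- The sum of the first two terms is a quadratic polynomial in `k` with leading coefficient `3`, so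
it lies below its chord between `k = 0` and `k = s` by exactly `3 * k * (s - k)`. Keeping this slack
is what confines equality to the two ends. -/
theorem deficiency_convexity (n s k : ℕ) (hk : k ≤ s) (hn : 2 * s + 2 ≤ n) :
    k * (2 * n - k - 1) + (2 * (s - k) + 1) * (2 * (s - k)) + 3 * k * (s - k) ≤
      max ((2 * s + 1) * (2 * s)) (s * (2 * n - s - 1)) := by
  obtain ⟨j, rfl⟩ := Nat.exists_eq_add_of_le hk
  obtain ⟨m, rfl⟩ := Nat.exists_eq_add_of_le hn
  rcases Nat.eq_zero_or_pos (k + j) with h0 | h0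
  · obtain rfl : k = 0 := by omega
    obtain rfl : j = 0 := by omega
    simp
  · set M := max ((2 * (k + j) + 1) * (2 * (k + j)))
      ((k + j) * (2 * (2 * (k + j) + 2 + m) - (k + j) - 1)) with hM
    have h1 : (2 * (k + j) + 1) * (2 * (k + j)) ≤ M := le_max_left _ _
    have h2 : (k + j) * (2 * (2 * (k + j) + 2 + m) - (k + j) - 1) ≤ M := le_max_right _ _
    have e1 : 2 * (2 * (k + j) + 2 + m) - (k + j) - 1 = 3 * k + 3 * j + 3 + 2 * m := by omega
    have e2 : 2 * (2 * (k + j) + 2 + m) - k - 1 = 3 * k + 4 * j + 3 + 2 * m := by omega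
    have e3 : k + j - k = j := by omega
    rw [e1] at h2
    rw [e2, e3]
    have h3 := Nat.mul_le_mul_left j h1
    have h4 := Nat.mul_le_mul_left k h2
    refine Nat.le_of_mul_le_mul_left ?_ h0
    calc _ = j * ((2 * (k + j) + 1) * (2 * (k + j))) +
          k * ((k + j) * (3 * k + 3 * j + 3 + 2 * m)) := by ring
      _ ≤ j * M + k * M := add_le_add h3 h4
      _ = (k + j) * M := by ring

/-- The Erdős–Gallai theorem on graphs without `s + 1` disjoint edges, with its equality cases.
Edges are counted as ordered pairs. -/
theorem SimpleGraph.erdos_gallai {V : Type*} [Fintype V] [LinearOrder V] (G : SimpleGraph V)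
    [DecidableRel G.Adj] (s : ℕ) (hs : 2 * s + 2 ≤ Fintype.card V)
    (h : ¬ ∃ a b : Fin (s + 1) → V, Function.Injective (Sum.elim a b) ∧ ∀ i, G.Adj (a i) (b i)) :
    (Finset.univ.filter (fun p : V × V => G.Adj p.1 p.2)).card ≤
        max ((2 * s + 1) * (2 * s)) (s * (2 * Fintype.card V - s - 1)) ∧
      ((Finset.univ.filter (fun p : V × V => G.Adj p.1 p.2)).card =
          max ((2 * s + 1) * (2 * s)) (s * (2 * Fintype.card V - s - 1)) →
        (∃ C : Finset V, C.card = 2 * s + 1 ∧ ∀ v w, v ≠ w → (G.Adj v w ↔ v ∈ C ∧ w ∈ C)) ∨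
        (∃ U : Finset V, U.card = s ∧ (Finset.univ.filter (fun p : V × V => G.Adj p.1 p.2)).card =
          s * (2 * Fintype.card V - s - 1) ∧ ∀ v w, v ≠ w → (G.Adj v w ↔ v ∈ U ∨ w ∈ U))) := by
  classical
  obtain ⟨U, X, _, r, hr, hc⟩ := G.exists_deficiency (s + 1) (by omega) h
  set n := Fintype.card V with hn
  set k := U.card with hk
  set b : X → ℕ := fun x => (Uᶜ.filter (fun v => r v = x)).card - 1 with hb
  -- `T` is the total excess of the colour classes over size one. The deficiency formula bounds it
  -- by `2 * (s - k)`, and the edges outside `U` are most numerous when one class takes it all.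
  set T := ∑ x ∈ Uᶜ.image r, b x with hT
  have hTc : T + (Uᶜ.image r).card = n - k := by
    rw [hT, hb, sum_card_fiber_sub_one, Finset.card_compl]
  have hks : k ≤ s := by omega
  have hTs : T ≤ 2 * (s - k) := by omega
  set E := Finset.univ.filter (fun p : V × V => G.Adj p.1 p.2) with hE
  have hsub := G.edges_subset_of_coloring U r hr
  set A := (Finset.univ : Finset V).offDiag \ Uᶜ.offDiag with hA
  set B := Uᶜ.offDiag.filter (fun p => r p.1 = r p.2) with hB
  have hBc : B.card = ∑ x ∈ Uᶜ.image r, (b x + 1) * b x := card_offDiag_filter_eq Uᶜ r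
  have hBT : B.card ≤ (T + 1) * T := by
    rw [hBc]; exact sq_sum_le_of_nonneg_eq _ _
  have hTT : (T + 1) * T ≤ (2 * (s - k) + 1) * (2 * (s - k)) :=
    Nat.mul_le_mul (by omega) hTs
  have hAc : A.card = k * (2 * n - k - 1) := by
    rw [hA, Finset.card_sdiff_of_subset (Finset.offDiag_mono (Finset.subset_univ _)), Finset.offDiag_card,
      Finset.offDiag_card, Finset.card_univ, Finset.card_compl, ← hn, ← hk]
    obtain ⟨m, hm⟩ := Nat.exists_eq_add_of_le (show k + 1 ≤ n by omega)
    rw [hm]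
    have e1 : k + 1 + m - k = m + 1 := by omega
    have e2 : 2 * (k + 1 + m) - k - 1 = k + 1 + 2 * m := by omega
    rw [e1, e2]
    have e3 : (m + 1) * (m + 1) - (m + 1) = (m + 1) * m := by
      rw [Nat.sub_eq_iff_eq_add (by nlinarith)]; ring
    have e4 : (k + 1 + m) * (k + 1 + m) - (k + 1 + m) = (k + 1 + m) * (k + m) := by
      rw [Nat.sub_eq_iff_eq_add (by nlinarith)]; ring
    rw [e3, e4, Nat.sub_eq_iff_eq_add (by nlinarith)]
    ring
  have hEAB : E.card ≤ A.card + B.card :=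
    (Finset.card_le_card hsub).trans (Finset.card_union_le _ _)
  have hconv := deficiency_convexity n s k hks hs
  set Mx := max ((2 * s + 1) * (2 * s)) (s * (2 * n - s - 1)) with hMx
  refine ⟨by omega, fun heq => ?_⟩
  -- The slack of the convexity inequality has to vanish.
  have h0 : k * (s - k) = 0 := by
    have : 3 * k * (s - k) = 0 := by omega
    simpa [mul_assoc] using this
  have hEeq : E = A ∪ B := by
    refine Finset.eq_of_subset_of_card_le hsub ((Finset.card_union_le _ _).trans ?_)
    omega
  have hBeq : B.card = (T + 1) * T := by omega
  have hTeq : (T + 1) * T = (2 * (s - k) + 1) * (2 * (s - k)) := by omega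
  have hT2 : T = 2 * (s - k) := by
    rcases lt_or_eq_of_le hTs with h1 | h1
    · have : (T + 1) * T < (2 * (s - k) + 1) * (2 * (s - k)) := by nlinarith
      omega
    · exact h1
  have hadj : ∀ v w, G.Adj v w ↔ (v, w) ∈ A ∪ B := by
    intro v w
    rw [← hEeq]
    simp [hE]
  have hfib : ∀ x ∈ Uᶜ.image r, b x = 0 ∨ b x = T := by
    refine eq_sum_of_sum_mul_eq _ _ ?_
    rw [← hBc, hBeq]
  rcases Nat.eq_zero_or_pos (s - k) with hsk | hsk
  · right
    have hks' : k = s := by omega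
    have hT0 : T = 0 := by omega
    have hB0 : B = ∅ := by rw [← Finset.card_eq_zero, hBeq, hT0, mul_zero]
    refine ⟨U, hks', ?_, fun v w hvw => ?_⟩
    · rw [hEeq, hB0, Finset.union_empty, hAc, hks']
    · rw [hadj, hB0, Finset.union_empty, hA]
      simp only [Finset.mem_sdiff, Finset.mem_offDiag, Finset.mem_univ, Finset.mem_compl]
      tauto
  · left
    have hk0 : k = 0 := by
      rcases Nat.mul_eq_zero.1 h0 with h1 | h1 <;> omega
    have hU : U = ∅ := Finset.card_eq_zero.1 hk0
    have hTpos : 0 < T := by omega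
    obtain ⟨x, hx, hxT⟩ : ∃ x ∈ Uᶜ.image r, b x = T := by
      by_contra hno
      push Not at hno
      have : T = 0 := Finset.sum_eq_zero fun x hx => (hfib x hx).resolve_right (hno x hx)
      omega
    have hother : ∀ y ∈ Uᶜ.image r, y ≠ x → b y = 0 := by
      intro y hy hyx
      have h2 : b x + b y ≤ T := by
        rw [← Finset.sum_pair (Ne.symm hyx)]
        exact Finset.sum_le_sum_of_subset (by
          intro z hz
          rcases Finset.mem_insert.1 hz with rfl | hz
          · exact hx
          · rwa [Finset.mem_singleton.1 hz])
      omega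
    subst hU
    refine ⟨Finset.univ.filter (fun v => r v = x), ?_, fun v w hvw => ?_⟩
    · have h3 : b x = (Finset.univ.filter (fun v => r v = x)).card - 1 := by
        simp [hb]
      omega
    · rw [hadj, hA, hB]
      simp only [Finset.compl_empty, Finset.sdiff_self, Finset.empty_union, Finset.mem_filter,
        Finset.mem_offDiag, Finset.mem_univ, true_and]
      refine ⟨fun h4 => ?_, fun h4 => ⟨hvw, h4.1.trans h4.2.symm⟩⟩
      have h5 : r v = x := by
        by_contra h6
        have h7 := hother (r v) (Finset.mem_image_of_mem _ (by simp)) h6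
        have h8 : 1 < (Finset.univ.filter (fun z => r z = r v)).card :=
          Finset.one_lt_card.2 ⟨v, by simp, w, by simp [h4.2], hvw⟩
        simp only [hb, Finset.compl_empty] at h7
        omega
      exact ⟨h5, h4.2 ▸ h5⟩

/-! ### Hyperbolic families, and their growth along a matching -/

section Hyperbolic

variable {K D : Type*} [Field K] [AddCommGroup D] [Module K D]

/-- The subspace `M` contains `k` pairwise orthogonal hyperbolic pairs for the form `B`. -/
def HasHyperbolic (B : LinearMap.BilinForm K D) (M : Submodule K D) (k : ℕ) : Prop :=
  ∃ u v : Fin k → D, (∀ i, u i ∈ M) ∧ (∀ i, v i ∈ M) ∧ (∀ i j, B (u i) (u j) = 0) ∧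
    (∀ i j, B (v i) (v j) = 0) ∧ ∀ i j, B (u i) (v j) = if i = j then 1 else 0

theorem HasHyperbolic.mono {B : LinearMap.BilinForm K D} {M N : Submodule K D} {k : ℕ}
    (h : HasHyperbolic B M k) (hMN : M ≤ N) : HasHyperbolic B N k := by
  obtain ⟨u, v, hu, hv, h'⟩ := h
  exact ⟨u, v, fun i => hMN (hu i), fun i => hMN (hv i), h'⟩

theorem LinearMap.BilinForm.IsAlt.swap {B : LinearMap.BilinForm K D} (hB : B.IsAlt) (x y : D) :
    B x y = -B y x := by rw [hB.neg_eq]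

theorem HasHyperbolic.succ_of_orthogonal {B : LinearMap.BilinForm K D} (hB : B.IsAlt)
    {M : Submodule K D} {k : ℕ} {u v : Fin k → D} (hu : ∀ i, u i ∈ M) (hv : ∀ i, v i ∈ M)
    (huu : ∀ i j, B (u i) (u j) = 0) (hvv : ∀ i j, B (v i) (v j) = 0)
    (huv : ∀ i j, B (u i) (v j) = if i = j then 1 else 0) {p q : D} (hp : p ∈ M) (hq : q ∈ M)
    (hup : ∀ i, B (u i) p = 0) (hvp : ∀ i, B (v i) p = 0) (huq : ∀ i, B (u i) q = 0)
    (hvq : ∀ i, B (v i) q = 0) (hpq : B p q ≠ 0) : HasHyperbolic B M (k + 1) := by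
  have hpu : ∀ i, B p (u i) = 0 := fun i => by rw [hB.swap, hup, neg_zero]
  have hpv : ∀ i, B p (v i) = 0 := fun i => by rw [hB.swap, hvp, neg_zero]
  have hqv : ∀ i, B q (v i) = 0 := fun i => by rw [hB.swap, hvq, neg_zero]
  refine ⟨Fin.cons ((B p q)⁻¹ • p) u, Fin.cons q v, ?_, ?_, ?_, ?_, ?_⟩
  · exact Fin.cases (M.smul_mem _ hp) hu
  · exact Fin.cases hq hv
  · refine Fin.cases (Fin.cases ?_ ?_) (fun i => Fin.cases ?_ ?_)
    · simp [hB p]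
    · intro j; simp [hpu]
    · simp [hup]
    · intro j; simp [huu]
  · refine Fin.cases (Fin.cases ?_ ?_) (fun i => Fin.cases ?_ ?_)
    · simp [hB q]
    · intro j; simp [hqv]
    · simp [hvq]
    · intro j; simp [hvv]
  · refine Fin.cases (Fin.cases ?_ ?_) (fun i => Fin.cases ?_ ?_)
    · simp [hpq]
    · intro j
      simp [hpv, (Fin.succ_ne_zero j).symm]
    · simp [huq, Fin.succ_ne_zero i]
    · intro j; simp [huv]

/-- Orthogonal projection along a hyperbolic family. -/
theorem exists_add_orthogonal {B : LinearMap.BilinForm K D} (hB : B.IsAlt)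
    {M : Submodule K D} {k : ℕ} {u v : Fin k → D} (hu : ∀ i, u i ∈ M) (hv : ∀ i, v i ∈ M)
    (huu : ∀ i j, B (u i) (u j) = 0) (hvv : ∀ i j, B (v i) (v j) = 0)
    (huv : ∀ i j, B (u i) (v j) = if i = j then 1 else 0) (p : D) :
    ∃ m ∈ M, (∀ i, B (u i) (p + m) = 0) ∧ ∀ i, B (v i) (p + m) = 0 := by
  have hvu : ∀ i j, B (v i) (u j) = if i = j then -1 else 0 := fun i j => by
    rw [hB.swap, huv]
    by_cases h : i = j
    · simp [h]
    · simp [h, Ne.symm h]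
  refine ⟨∑ j, B (v j) p • u j - ∑ j, B (u j) p • v j, ?_, ?_, ?_⟩
  · exact M.sub_mem (M.sum_mem fun j _ => M.smul_mem _ (hu j))
      (M.sum_mem fun j _ => M.smul_mem _ (hv j))
  · intro i
    simp [map_add, map_sub, map_sum, huu, huv]
  · intro i
    simp [map_add, map_sub, map_sum, hvv, hvu]

/-- Extraction: if the form `A` is trivial on `M` and pairs `p` and `q` non-trivially, then a
hyperbolic family of `B` inside `M` can be enlarged, for `B` or for `B + A`. -/
theorem HasHyperbolic.exists_succ {B A : LinearMap.BilinForm K D} (hB : B.IsAlt) (hA : A.IsAlt)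
    {M : Submodule K D} {k : ℕ} (h : HasHyperbolic B M k) {p q : D}
    (hAM : ∀ a ∈ M, ∀ b ∈ M, A a b = 0) (hAp : ∀ a ∈ M, A a p = 0) (hAq : ∀ a ∈ M, A a q = 0)
    (hpq : A p q ≠ 0) : ∃ c : K, HasHyperbolic (B + c • A) (M ⊔ Submodule.span K {p, q}) (k + 1) := by
  obtain ⟨u, v, hu, hv, huu, hvv, huv⟩ := h
  obtain ⟨m, hm, hum, hvm⟩ := exists_add_orthogonal hB hu hv huu hvv huv p
  obtain ⟨m', hm', hum', hvm'⟩ := exists_add_orthogonal hB hu hv huu hvv huv q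
  have hApq : A (p + m) (q + m') = A p q := by
    have h1 : A p m' = 0 := by rw [hA.swap, hAp m' hm', neg_zero]
    simp [map_add, h1, hAq m hm, hAM m hm m' hm']
  -- The corrected vectors are orthogonal to the family, and the correction does not change the
  -- value of `A`. If `B` does not already pair them, adding `A` once does.
  obtain ⟨c, hc⟩ : ∃ c : K, B (p + m) (q + m') + c * A p q ≠ 0 := by
    by_cases h0 : B (p + m) (q + m') = 0
    · exact ⟨1, by rw [h0, zero_add, one_mul]; exact hpq⟩
    · exact ⟨0, by rwa [zero_mul, add_zero]⟩
  have hle : M ≤ M ⊔ Submodule.span K {p, q} := le_sup_left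
  have hpM : p ∈ M ⊔ Submodule.span K {p, q} :=
    (le_sup_right : _ ≤ M ⊔ Submodule.span K {p, q}) (Submodule.subset_span (by simp))
  have hqM : q ∈ M ⊔ Submodule.span K {p, q} :=
    (le_sup_right : _ ≤ M ⊔ Submodule.span K {p, q}) (Submodule.subset_span (by simp))
  refine ⟨c, HasHyperbolic.succ_of_orthogonal (hB.add (hA.smul c)) (fun i => hle (hu i))
    (fun i => hle (hv i)) ?_ ?_ ?_ (Submodule.add_mem _ hpM (hle hm))
    (Submodule.add_mem _ hqM (hle hm')) ?_ ?_ ?_ ?_ ?_⟩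
  · intro i j; simp [huu, hAM _ (hu i) _ (hu j)]
  · intro i j; simp [hvv, hAM _ (hv i) _ (hv j)]
  · intro i j
    simp [huv, hAM _ (hu i) _ (hv j)]
  · intro i
    simp only [LinearMap.add_apply, LinearMap.smul_apply, hum]
    simp [hAp _ (hu i), hAM _ (hu i) _ hm]
  · intro i
    simp only [LinearMap.add_apply, LinearMap.smul_apply, hvm]
    simp [hAp _ (hv i), hAM _ (hv i) _ hm]
  · intro i
    simp only [LinearMap.add_apply, LinearMap.smul_apply, hum']
    simp [hAq _ (hu i), hAM _ (hu i) _ hm']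
  · intro i
    simp only [LinearMap.add_apply, LinearMap.smul_apply, hvm']
    simp [hAq _ (hv i), hAM _ (hv i) _ hm']
  · simp only [LinearMap.add_apply, LinearMap.smul_apply, hApq, smul_eq_mul]
    exact hc

theorem bilin_eq_zero_of_mem_span {A : LinearMap.BilinForm K D} {s t : Set D}
    (h : ∀ x ∈ s, ∀ y ∈ t, A x y = 0) {x y : D} (hx : x ∈ Submodule.span K s)
    (hy : y ∈ Submodule.span K t) : A x y = 0 := by
  have h1 : Submodule.span K s ≤ LinearMap.ker (A.flip y) := by
    refine Submodule.span_le.2 fun z hz => ?_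
    have h2 : Submodule.span K t ≤ LinearMap.ker (A z) :=
      Submodule.span_le.2 fun y' hy' => h z hz y' hy'
    exact h2 hy
  exact h1 hx

/-- A matching made of leading positions forces a large hyperbolic family. -/
theorem exists_hasHyperbolic_of_matching {ι : Type*} (w : ι → ℕ) (hwinj : Function.Injective w)
    (hw : ∀ p q b, p ≠ q → w p < w b → w q < w b → w p + w q < w b)
    (B₀ : LinearMap.BilinForm K D) (hB₀ : B₀.IsAlt) (V : Submodule K (LinearMap.BilinForm K D))
    (hV : ∀ v ∈ V, v.IsAlt) (k : ℕ) (a b : Fin k → ι) (hinj : Function.Injective (Sum.elim a b))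
    (hab : ∀ i, w (a i) < w (b i)) (A : Fin k → LinearMap.BilinForm K D) (hA : ∀ i, A i ∈ V)
    (d : ι → D) (hlead : ∀ i, A i (d (a i)) (d (b i)) ≠ 0)
    (hlt : ∀ i, ∀ p ∈ Set.range (Sum.elim a b), ∀ q ∈ Set.range (Sum.elim a b), p ≠ q →
      w p + w q < w (a i) + w (b i) → A i (d p) (d q) = 0) :
    ∃ v ∈ V, HasHyperbolic (B₀ + v) (Submodule.span K (d '' Set.range (Sum.elim a b))) k := by
  induction k generalizing d with
  | zero =>
    exact ⟨0, V.zero_mem, Fin.elim0, Fin.elim0, fun i => i.elim0, fun i => i.elim0,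
      fun i => i.elim0, fun i => i.elim0, fun i => i.elim0⟩
  | succ k ih =>
    -- The edge with the highest end is set aside: all positions that avoid `b m` come before its
    -- leading position, so `A m` vanishes at each of them.
    obtain ⟨m, hm⟩ : ∃ m, ∀ i, w (b i) ≤ w (b m) := Finite.exists_max fun i => w (b i)
    set R := Set.range (Sum.elim a b) with hR
    have haR : ∀ i, a i ∈ R := fun i => ⟨Sum.inl i, rfl⟩
    have hbR : ∀ i, b i ∈ R := fun i => ⟨Sum.inr i, rfl⟩
    set a' := a ∘ m.succAbove with ha'
    set b' := b ∘ m.succAbove with hb'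
    set R' := Set.range (Sum.elim a' b') with hR'
    have hinj' : Function.Injective (Sum.elim a' b') := by
      have h1 : Sum.elim a' b' = Sum.elim a b ∘ Sum.map m.succAbove m.succAbove := by
        ext x; cases x <;> rfl
      rw [h1]
      exact hinj.comp (Sum.map_injective.2
        ⟨Fin.succAbove_right_injective, Fin.succAbove_right_injective⟩)
    have hR'R : ∀ p ∈ R', p ∈ R ∧ p ≠ a m ∧ p ≠ b m := by
      rintro _ ⟨i | i, rfl⟩
      · refine ⟨haR _, fun h => ?_, fun h => ?_⟩
        · have := @hinj (Sum.inl (m.succAbove i)) (Sum.inl m) h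
          exact Fin.succAbove_ne m i (Sum.inl_injective this)
        · have := @hinj (Sum.inl (m.succAbove i)) (Sum.inr m) h
          simp at this
      · refine ⟨hbR _, fun h => ?_, fun h => ?_⟩
        · have := @hinj (Sum.inr (m.succAbove i)) (Sum.inl m) h
          simp at this
        · have := @hinj (Sum.inr (m.succAbove i)) (Sum.inr m) h
          exact Fin.succAbove_ne m i (Sum.inr_injective this)
    have hwtop : ∀ p ∈ R, p ≠ b m → w p < w (b m) := by
      rintro _ ⟨i | i, rfl⟩ hp
      · exact (hab i).trans_le (hm i)
      · exact lt_of_le_of_ne (hm i) fun h => hp (hwinj h)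
    have habm : a m ≠ b m := fun h => absurd (hab m) (by rw [h]; exact lt_irrefl _)
    have hzero : ∀ p ∈ R, p ≠ b m → ∀ q ∈ R, q ≠ b m → A m (d p) (d q) = 0 := by
      intro p hp hpb q hq hqb
      by_cases hpq : p = q
      · rw [hpq]; exact hV _ (hA m) _
      · refine hlt m p hp q hq hpq ?_
        have := hw p q (b m) hpq (hwtop p hp hpb) (hwtop q hq hqb)
        omega
    -- The multiple of `d (a m)` to be subtracted from `d j` to make it orthogonal to `d (b m)` for
    -- `A m`.
    set β : ι → K := fun j => A m (d j) (d (b m)) / A m (d (a m)) (d (b m)) with hβ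
    have hβ0 : ∀ j ∈ R, w j < w (a m) → β j = 0 := by
      intro j hj hja
      have : A m (d j) (d (b m)) = 0 := by
        refine hlt m j hj _ (hbR m) ?_ (by omega)
        intro h
        have := hab m
        rw [h] at hja
        omega
      simp [hβ, this]
    set d' : ι → D := fun j => d j - β j • d (a m) with hd'
    -- The change of vectors is triangular: `d j` only changes if `w j` exceeds `w (a m)`, and then
    -- the correcting entries sit at strictly smaller positions, where the other forms vanish. The
    -- leading conditions therefore survive.
    have hsmall : ∀ i : Fin k, ∀ p ∈ R', ∀ q ∈ R', p ≠ q →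
        w p + w q ≤ w (a' i) + w (b' i) →
        A (m.succAbove i) (d' p) (d' q) = A (m.succAbove i) (d p) (d q) := by
      intro i p hp q hq hpq hle
      have h1 : β q * A (m.succAbove i) (d p) (d (a m)) = 0 := by
        rcases lt_trichotomy (w q) (w (a m)) with h | h | h
        · rw [hβ0 q (hR'R q hq).1 h, zero_mul]
        · exact absurd (hwinj h) (hR'R q hq).2.1
        · rw [hlt (m.succAbove i) p (hR'R p hp).1 _ (haR m) (hR'R p hp).2.1, mul_zero]
          simp only [ha', hb', Function.comp_apply] at hle
          omega
      have h2 : β p * A (m.succAbove i) (d (a m)) (d q) = 0 := by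
        rcases lt_trichotomy (w p) (w (a m)) with h | h | h
        · rw [hβ0 p (hR'R p hp).1 h, zero_mul]
        · exact absurd (hwinj h) (hR'R p hp).2.1
        · rw [hlt (m.succAbove i) _ (haR m) q (hR'R q hq).1 (hR'R q hq).2.1.symm, mul_zero]
          simp only [ha', hb', Function.comp_apply] at hle
          omega
      simp only [hd', map_sub, map_smul, LinearMap.sub_apply, LinearMap.smul_apply, smul_eq_mul,
        h2, (hV _ (hA (m.succAbove i))) (d (a m))]
      linear_combination -h1
    have hab' : ∀ i, a' i ≠ b' i := fun i h => by
      have := @hinj' (Sum.inl i) (Sum.inr i) h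
      simp at this
    obtain ⟨v, hv, hyp⟩ := ih a' b' hinj' (fun i => hab _) (fun i => A (m.succAbove i))
      (fun i => hA _) d'
      (fun i => by
        rw [hsmall i (a' i) ⟨Sum.inl i, rfl⟩ (b' i) ⟨Sum.inr i, rfl⟩ (hab' i) le_rfl]
        exact hlead _)
      (fun i p hp q hq hpq hlt' => by
        rw [hsmall i p hp q hq hpq hlt'.le]
        exact hlt _ p (hR'R p hp).1 q (hR'R q hq).1 hpq hlt')
    have hAa : ∀ p ∈ R', A m (d' p) (d (a m)) = 0 := by
      intro p hp
      have := hR'R p hp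
      simp [hd', hzero p this.1 this.2.2 _ (haR m) habm, hV _ (hA m) (d (a m))]
    have hAb : ∀ p ∈ R', A m (d' p) (d (b m)) = 0 := by
      intro p hp
      simp only [hd', hβ, map_sub, map_smul, LinearMap.sub_apply, LinearMap.smul_apply, smul_eq_mul]
      rw [div_mul_cancel₀ _ (hlead m), sub_self]
    have hAp : ∀ p ∈ R', ∀ q ∈ R', A m (d' p) (d' q) = 0 := by
      intro p hp q hq
      have h1 := hAa p hp
      have h2 : A m (d' p) (d q) = 0 := by
        have hp' := hR'R p hp
        have hq' := hR'R q hq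
        simp [hd', hzero p hp'.1 hp'.2.2 q hq'.1 hq'.2.2, hzero _ (haR m) habm q hq'.1 hq'.2.2]
      have h3 : d' q = d q - β q • d (a m) := rfl
      rw [h3, map_sub, map_smul, h1, h2, smul_zero, sub_zero]
    -- On the new span `A m` is zero and is orthogonal to `d (a m)` and `d (b m)`, so its multiples
    -- leave the family already built intact.
    obtain ⟨c, hc⟩ := hyp.exists_succ (A := A m) (p := d (a m)) (q := d (b m))
      (hB₀.add (hV v hv)) (hV _ (hA m))
      (fun x hx y hy => bilin_eq_zero_of_mem_span (by
        rintro _ ⟨p, hp, rfl⟩ _ ⟨q, hq, rfl⟩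
        exact hAp p hp q hq) hx hy)
      (fun x hx => bilin_eq_zero_of_mem_span (t := {d (a m)}) (by
        rintro _ ⟨p, hp, rfl⟩ _ rfl
        exact hAa p hp) hx (Submodule.mem_span_singleton_self _))
      (fun x hx => bilin_eq_zero_of_mem_span (t := {d (b m)}) (by
        rintro _ ⟨p, hp, rfl⟩ _ rfl
        exact hAb p hp) hx (Submodule.mem_span_singleton_self _)) (hlead m)
    refine ⟨v + c • A m, V.add_mem hv (V.smul_mem c (hA m)), ?_⟩
    rw [← add_assoc]
    refine hc.mono (sup_le ?_ ?_)
    · refine Submodule.span_le.2 ?_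
      rintro _ ⟨p, hp, rfl⟩
      refine Submodule.sub_mem _ (Submodule.subset_span ⟨p, (hR'R p hp).1, rfl⟩)
        (Submodule.smul_mem _ _ (Submodule.subset_span ⟨_, haR m, rfl⟩))
    · refine Submodule.span_le.2 ?_
      rintro x (rfl | rfl)
      · exact Submodule.subset_span ⟨_, haR m, rfl⟩
      · exact Submodule.subset_span ⟨_, hbR m, rfl⟩

end Hyperbolic

/-! ### Leading positions of spaces of alternating forms -/

section Leading

variable {K : Type*} [Field K]

/-- The dimension of a space is the number of leading positions of its vectors, with respect to an
ordering of a separating family of coordinates. -/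
theorem finrank_eq_card_leading {M X : Type*} [AddCommGroup M] [Module K M] [Fintype X]
    (c : X → ℕ) (hc : Function.Injective c) (e : X → M →ₗ[K] K)
    (he : ∀ m, (∀ x, e x m = 0) → m = 0) :
    finrank K M = Nat.card {x // ∃ m, e x m ≠ 0 ∧ ∀ y, c y < c x → e y m = 0} := by
  classical
  set L := {x // ∃ m, e x m ≠ 0 ∧ ∀ y, c y < c x → e y m = 0} with hL
  have hexists : ∀ m, m ≠ 0 → ∃ x : L, e x m ≠ 0 := by
    intro m hm
    have h1 : (Finset.univ.filter (fun x => e x m ≠ 0)).Nonempty := by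
      by_contra hno
      rw [Finset.not_nonempty_iff_eq_empty, Finset.filter_eq_empty_iff] at hno
      exact hm (he m fun x => by simpa using hno (Finset.mem_univ x))
    obtain ⟨x, hx, hmin⟩ := Finset.exists_min_image _ c h1
    have hx' := (Finset.mem_filter.1 hx).2
    refine ⟨⟨x, m, hx', fun y hy => ?_⟩, hx'⟩
    by_contra hne
    have := hmin y (by simp [hne])
    omega
  have hinj : Function.Injective (LinearMap.pi fun x : L => e x) := by
    rw [← LinearMap.ker_eq_bot, LinearMap.ker_eq_bot']
    intro m hm
    by_contra hne
    obtain ⟨x, hx⟩ := hexists m hne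
    exact hx (congrFun hm x)
  have hfin : FiniteDimensional K M := FiniteDimensional.of_injective _ hinj
  have hle : finrank K M ≤ Nat.card L := by
    have h2 := LinearMap.finrank_le_finrank_of_injective hinj
    rwa [Module.finrank_fintype_fun_eq_card, ← Nat.card_eq_fintype_card] at h2
  refine le_antisymm hle ?_
  choose f hf0 hf using fun x : L => x.2
  -- In a vanishing combination, the least leading position with a nonzero coefficient sees only its
  -- own vector.
  have hli : LinearIndependent K f := by
    rw [Fintype.linearIndependent_iff]
    intro g hg
    by_contra hno
    push Not at hno
    obtain ⟨i₀, hi₀⟩ := hno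
    obtain ⟨i, hi, hmin⟩ := Finset.exists_min_image (Finset.univ.filter (fun i => g i ≠ 0))
      (fun i => c i) ⟨i₀, by simp [hi₀]⟩
    have hi' := (Finset.mem_filter.1 hi).2
    have h3 := congrArg (e i) hg
    rw [map_sum, map_zero, Finset.sum_eq_single i] at h3
    · rw [map_smul, smul_eq_mul, mul_eq_zero] at h3
      exact h3.elim hi' (hf0 i)
    · intro j _ hji
      by_cases hj : g j = 0
      · rw [hj, zero_smul, map_zero]
      · have h4 := hmin j (by simp [hj])
        have h5 : c i < c j := lt_of_le_of_ne h4 fun h => hji (Subtype.ext (hc h)).symm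
        rw [map_smul, hf j i h5, smul_zero]
    · simp
  rw [Nat.card_eq_fintype_card]
  exact hli.fintype_card_le_finrank

/-- Uniqueness of binary expansions: the weights `2 ^ p + 2 ^ q` order the pairs by the larger
index, then by the smaller one, without ties. -/
theorem two_pow_add_two_pow_inj {p q p' q' : ℕ} (h : p < q) (h' : p' < q')
    (he : 2 ^ p + 2 ^ q = 2 ^ p' + 2 ^ q') : p = p' ∧ q = q' := by
  have hlt : ∀ a b c d : ℕ, a < b → c < d → 2 ^ a + 2 ^ b = 2 ^ c + 2 ^ d → ¬ b < d := by
    intro a b c d hab hcd hh hbd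
    have h1 : 2 ^ a < 2 ^ b := Nat.pow_lt_pow_right (by norm_num) hab
    have h2 : 2 ^ (b + 1) ≤ 2 ^ d := Nat.pow_le_pow_right (by norm_num) hbd
    have h3 : 0 < 2 ^ c := by positivity
    rw [pow_succ] at h2
    omega
  have hq : q = q' :=
    le_antisymm (not_lt.1 (hlt _ _ _ _ h' h he.symm)) (not_lt.1 (hlt _ _ _ _ h h' he))
  subst hq
  exact ⟨Nat.pow_right_injective le_rfl (by simpa using he), rfl⟩

/-- This places every pair of indices below `b` before every pair that contains `b`, as required by
the extraction along a matching. -/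
theorem two_pow_add_two_pow_lt {p q b : ℕ} (hpq : p ≠ q) (hp : p < b) (hq : q < b) :
    2 ^ p + 2 ^ q < 2 ^ b := by
  wlog h : p < q generalizing p q
  · rw [add_comm]
    exact this hpq.symm hq hp (by omega)
  have h1 : 2 ^ p < 2 ^ q := Nat.pow_lt_pow_right (by norm_num) h
  have h2 : 2 ^ (q + 1) ≤ 2 ^ b := Nat.pow_le_pow_right (by norm_num) hq
  rw [pow_succ] at h2
  omega

variable {D : Type*} [AddCommGroup D] [Module K D]

/-- The graph of the leading positions of a space of alternating forms with respect to `d`: the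
positions are ordered by the larger index first. -/
def leadGraph {n : ℕ} (d : Fin n → D) (V : Submodule K (LinearMap.BilinForm K D))
    (hV : ∀ v ∈ V, v.IsAlt) : SimpleGraph (Fin n) where
  Adj p q := p ≠ q ∧ ∃ v ∈ V, v (d p) (d q) ≠ 0 ∧ ∀ p' q' : Fin n, p' ≠ q' →
    2 ^ (p' : ℕ) + 2 ^ (q' : ℕ) < 2 ^ (p : ℕ) + 2 ^ (q : ℕ) → v (d p') (d q') = 0
  symm := ⟨by
    rintro p q ⟨hpq, v, hv, hne, hlt⟩
    refine ⟨hpq.symm, v, hv, fun h => hne ?_, fun p' q' h' hlt' => hlt p' q' h' (by omega)⟩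
    rw [(hV v hv).swap, h, neg_zero]⟩
  loopless := ⟨fun _ h => h.1 rfl⟩

theorem card_filter_lt_of_symm {n : ℕ} (G : SimpleGraph (Fin n)) [DecidableRel G.Adj] :
    (Finset.univ.filter (fun p : Fin n × Fin n => G.Adj p.1 p.2)).card =
      2 * (Finset.univ.filter (fun p : Fin n × Fin n => p.1 < p.2 ∧ G.Adj p.1 p.2)).card := by
  rw [← Finset.card_filter_add_card_filter_not (s := Finset.univ.filter
    (fun p : Fin n × Fin n => G.Adj p.1 p.2)) (fun p => p.1 < p.2), two_mul]
  congr 1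
  · congr 1
    ext p
    simp [and_comm]
  · refine Finset.card_bij' (fun p _ => p.swap) (fun p _ => p.swap) ?_ ?_ ?_ ?_
    · intro p hp
      simp only [Finset.mem_filter, Finset.mem_univ, true_and, Prod.fst_swap, Prod.snd_swap] at hp ⊢
      exact ⟨lt_of_le_of_ne (not_lt.1 hp.2) hp.1.ne', hp.1.symm⟩
    · intro p hp
      simp only [Finset.mem_filter, Finset.mem_univ, true_and, Prod.fst_swap, Prod.snd_swap] at hp ⊢
      exact ⟨hp.2.symm, not_lt.2 hp.1.le⟩
    · intro p _; simp
    · intro p _; simp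

theorem ext_of_isAlt_of_lt {n : ℕ} (d : Basis (Fin n) K D) {v : LinearMap.BilinForm K D}
    (hv : v.IsAlt) (h : ∀ p q : Fin n, p < q → v (d p) (d q) = 0) : v = 0 := by
  refine d.ext fun p => d.ext fun q => ?_
  rcases lt_trichotomy p q with hpq | rfl | hpq
  · exact h p q hpq
  · exact hv _
  · rw [hv.swap, h q p hpq]; simp

/-- The dimension of a space of alternating forms is the number of edges of its graph of leading
positions. -/
theorem finrank_eq_card_leadGraph {n : ℕ} (d : Basis (Fin n) K D)
    (V : Submodule K (LinearMap.BilinForm K D)) (hV : ∀ v ∈ V, v.IsAlt)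
    [DecidableRel (leadGraph d V hV).Adj] :
    finrank K V = (Finset.univ.filter
      (fun p : Fin n × Fin n => p.1 < p.2 ∧ (leadGraph d V hV).Adj p.1 p.2)).card := by
  classical
  set X := {p : Fin n × Fin n // p.1 < p.2} with hX
  set e : X → V →ₗ[K] K := fun x =>
    { toFun := fun v => (v : LinearMap.BilinForm K D) (d x.1.1) (d x.1.2)
      map_add' := fun v v' => by simp
      map_smul' := fun c v => by simp } with he
  set c : X → ℕ := fun x => 2 ^ (x.1.1 : ℕ) + 2 ^ (x.1.2 : ℕ) with hc
  have hcinj : Function.Injective c := by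
    rintro ⟨⟨p, q⟩, h⟩ ⟨⟨p', q'⟩, h'⟩ heq
    obtain ⟨h1, h2⟩ := two_pow_add_two_pow_inj (show (p : ℕ) < q from h)
      (show (p' : ℕ) < q' from h') heq
    exact Subtype.ext (Prod.ext (Fin.ext h1) (Fin.ext h2))
  rw [finrank_eq_card_leading (K := K) (M := V) c hcinj e]
  · rw [← Fintype.card_coe, ← Nat.card_eq_fintype_card]
    refine Nat.card_congr ⟨fun x => ⟨x.1.1, ?_⟩, fun x => ⟨⟨x.1, ?_⟩, ?_⟩, fun x => rfl, fun x => rfl⟩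
    · simp only [Finset.mem_filter, Finset.mem_univ, true_and]
      obtain ⟨⟨⟨p, q⟩, hpq⟩, m, hm, hlt⟩ := x
      refine ⟨hpq, hpq.ne, m, m.2, hm, fun p' q' hne hlt' => ?_⟩
      rcases lt_or_gt_of_ne hne with h | h
      · exact hlt ⟨(p', q'), h⟩ hlt'
      · rw [(hV m m.2).swap]
        have : (m : LinearMap.BilinForm K D) (d q') (d p') = 0 :=
          hlt ⟨(q', p'), h⟩ (by simp only [hc]; dsimp only at hlt' ⊢; omega)
        rw [this, neg_zero]
    · have h1 := x.2
      simp only [Finset.mem_filter, Finset.mem_univ, true_and] at h1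
      exact h1.1
    · have h1 := x.2
      simp only [Finset.mem_filter, Finset.mem_univ, true_and] at h1
      obtain ⟨hpq, -, v, hv, hne, hlt⟩ := h1
      exact ⟨⟨v, hv⟩, hne, fun y hy => hlt _ _ y.2.ne hy⟩
  · intro m hm
    refine Subtype.ext (ext_of_isAlt_of_lt d (hV m m.2) fun p q hpq => ?_)
    exact hm ⟨(p, q), hpq⟩

/-- The graph of leading positions has no large matching if the rank is bounded on a translate. -/
theorem leadGraph_no_matching {n : ℕ} (d : Fin n → D) (B₀ : LinearMap.BilinForm K D)
    (hB₀ : B₀.IsAlt) (V : Submodule K (LinearMap.BilinForm K D)) (hV : ∀ v ∈ V, v.IsAlt) (k : ℕ)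
    (h : ∀ v ∈ V, ¬ HasHyperbolic (B₀ + v) ⊤ k) :
    ¬ ∃ a b : Fin k → Fin n, Function.Injective (Sum.elim a b) ∧
      ∀ i, (leadGraph d V hV).Adj (a i) (b i) := by
  rintro ⟨a, b, hinj, hadj⟩
  wlog hab : ∀ i, a i < b i generalizing a b
  · refine this (fun i => min (a i) (b i)) (fun i => max (a i) (b i)) ?_ ?_ ?_
    · have ha : ∀ i j, a i ≠ b j := fun i j h => by simpa using @hinj (Sum.inl i) (Sum.inr j) h
      have haa : ∀ i j, a i = a j → i = j := fun i j h => by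
        simpa using @hinj (Sum.inl i) (Sum.inl j) h
      have hbb : ∀ i j, b i = b j → i = j := fun i j h => by
        simpa using @hinj (Sum.inr i) (Sum.inr j) h
      have key : ∀ i j, (a i = a j ∨ a i = b j ∨ b i = a j ∨ b i = b j) → i = j := by
        rintro i j (h | h | h | h)
        · exact haa i j h
        · exact absurd h (ha i j)
        · exact absurd h.symm (ha j i)
        · exact hbb i j h
      refine Function.Injective.sumElim ?_ ?_ ?_
      · intro i j hij
        refine key i j ?_
        rcases min_choice (a i) (b i) with h1 | h1 <;> rcases min_choice (a j) (b j) with h2 | h2 <;>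
          simp only [h1, h2] at hij <;> tauto
      · intro i j hij
        refine key i j ?_
        rcases max_choice (a i) (b i) with h1 | h1 <;> rcases max_choice (a j) (b j) with h2 | h2 <;>
          simp only [h1, h2] at hij <;> tauto
      · intro i j hij
        have hij' : i = j := by
          refine key i j ?_
          rcases min_choice (a i) (b i) with h1 | h1 <;>
            rcases max_choice (a j) (b j) with h2 | h2 <;>
            simp only [h1, h2] at hij <;> tauto
        subst hij'
        have h3 := ha i i
        exact absurd hij (min_lt_max.2 h3).ne
    · intro i
      rcases le_total (a i) (b i) with h1 | h1
      · simpa [h1] using hadj i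
      · simpa [h1] using (hadj i).symm
    · intro i
      exact min_lt_max.2 (hadj i).ne
  choose A hA hne hlt using fun i => (hadj i).2
  obtain ⟨v, hv, hyp⟩ := exists_hasHyperbolic_of_matching (fun p : Fin n => 2 ^ (p : ℕ))
    (fun p q hpq => Fin.ext (Nat.pow_right_injective le_rfl hpq))
    (fun p q b hpq hp hq => two_pow_add_two_pow_lt (fun h => hpq (Fin.ext h))
      ((Nat.pow_lt_pow_iff_right (by norm_num)).1 hp) ((Nat.pow_lt_pow_iff_right (by norm_num)).1 hq))
    B₀ hB₀ V hV k a b hinj (fun i => Nat.pow_lt_pow_right (by norm_num) (hab i)) A hA d hne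
    (fun i p _ q _ hpq hlt' => hlt i p q hpq hlt')
  exact h v hv (hyp.mono le_top)

end Leading

/-! ### Decomposable forms, restriction to hyperplanes, slices -/

section Wedge

variable {K D : Type*} [Field K] [AddCommGroup D] [Module K D]

theorem finrank_map_add_finrank_inf_ker {M N : Type*} [AddCommGroup M] [Module K M]
    [AddCommGroup N] [Module K N] (f : M →ₗ[K] N) (W : Submodule K M) [FiniteDimensional K W] :
    finrank K (W.map f) + finrank K (W ⊓ LinearMap.ker f : Submodule K M) = finrank K W := by
  rw [← LinearMap.finrank_range_add_finrank_ker (f.domRestrict W), LinearMap.range_domRestrict]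
  congr 1
  have h : (LinearMap.ker (f.domRestrict W)).map W.subtype = W ⊓ LinearMap.ker f := by
    ext x
    simp [LinearMap.mem_ker, and_comm]
  rw [← h, LinearEquiv.finrank_eq (Submodule.equivMapOfInjective _ W.injective_subtype _)]

/-- The alternating form `x ∧ y`, as a linear function of `y`. -/
def wedge (x : Dual K D) : Dual K D →ₗ[K] LinearMap.BilinForm K D where
  toFun y := x.smulRight y - y.smulRight x
  map_add' y z := by ext a b; simp; ring
  map_smul' c y := by ext a b; simp; ring

@[simp]
theorem wedge_apply (x y : Dual K D) (a b : D) : wedge x y a b = x a * y b - y a * x b := rfl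

theorem isAlt_wedge (x y : Dual K D) : (wedge x y).IsAlt := fun a => by
  simp [mul_comm]

theorem wedge_swap (x y : Dual K D) : wedge x y = -wedge y x := by
  ext a b; simp

theorem wedge_self (x : Dual K D) : wedge x x = 0 := by
  ext a b; simp

/-- The restriction of bilinear forms to a subspace. -/
def restrictForm (H : Submodule K D) :
    LinearMap.BilinForm K D →ₗ[K] LinearMap.BilinForm K H where
  toFun B := B.compl₁₂ H.subtype H.subtype
  map_add' _ _ := rfl
  map_smul' _ _ := rfl

@[simp]
theorem restrictForm_apply (H : Submodule K D) (B : LinearMap.BilinForm K D) (a b : H) :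
    restrictForm H B a b = B a b := rfl

theorem LinearMap.BilinForm.IsAlt.restrictForm {B : LinearMap.BilinForm K D} (hB : B.IsAlt)
    (H : Submodule K D) : (restrictForm H B).IsAlt := fun a => hB (a : D)

theorem isAlt_of_mem_map_restrictForm {V : Submodule K (LinearMap.BilinForm K D)}
    (hV : ∀ v ∈ V, v.IsAlt) (H : Submodule K D) : ∀ v ∈ V.map (restrictForm H), v.IsAlt := by
  rintro _ ⟨v, hv, rfl⟩
  exact (hV v hv).restrictForm H

theorem HasHyperbolic.of_restrictForm {H : Submodule K D} {B : LinearMap.BilinForm K D} {k : ℕ}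
    (h : HasHyperbolic (restrictForm H B) ⊤ k) : HasHyperbolic B H k := by
  obtain ⟨u, v, -, -, huu, hvv, huv⟩ := h
  exact ⟨fun i => u i, fun i => v i, fun i => (u i).2, fun i => (v i).2, huu, hvv, huv⟩

theorem restrictForm_eq_zero_iff (H : Submodule K D) (B : LinearMap.BilinForm K D) :
    restrictForm H B = 0 ↔ ∀ a ∈ H, ∀ b ∈ H, B a b = 0 := by
  constructor
  · intro h a ha b hb
    have := congrArg (fun C : LinearMap.BilinForm K H => C ⟨a, ha⟩ ⟨b, hb⟩) h
    simpa using this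
  · intro h
    ext a b
    exact h a a.2 b b.2

theorem exists_apply_eq_one {x : Dual K D} (hx : x ≠ 0) : ∃ e, x e = 1 := by
  obtain ⟨a, ha⟩ : ∃ a, x a ≠ 0 := by
    by_contra h
    push Not at h
    exact hx (LinearMap.ext h)
  exact ⟨(x a)⁻¹ • a, by simp [ha]⟩

/-- With `x e = 1`, the vectors `a - x a • e` lie in `ker x`; expanding `B` on them shows that `y =
B e` works. -/
theorem exists_eq_wedge {x : Dual K D} (hx : x ≠ 0) {B : LinearMap.BilinForm K D} (hB : B.IsAlt)
    (h : restrictForm (LinearMap.ker x) B = 0) : ∃ y, B = wedge x y := by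
  obtain ⟨e, he⟩ := exists_apply_eq_one hx
  rw [restrictForm_eq_zero_iff] at h
  refine ⟨B e, ?_⟩
  ext a b
  have h1 := h (a - x a • e) (by simp [he]) (b - x b • e) (by simp [he])
  simp only [map_sub, map_smul, LinearMap.sub_apply, LinearMap.smul_apply, smul_eq_mul, hB e,
    mul_zero, sub_zero] at h1
  rw [wedge_apply, hB.swap e a]
  linear_combination h1

theorem restrictForm_ker_wedge (x y : Dual K D) :
    restrictForm (LinearMap.ker x) (wedge x y) = 0 := by
  rw [restrictForm_eq_zero_iff]
  intro a ha b hb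
  rw [LinearMap.mem_ker] at ha hb
  simp [ha, hb]

theorem ker_wedge {x : Dual K D} (hx : x ≠ 0) : LinearMap.ker (wedge x) = Submodule.span K {x} := by
  obtain ⟨e, he⟩ := exists_apply_eq_one hx
  ext y
  rw [LinearMap.mem_ker, Submodule.mem_span_singleton]
  constructor
  · intro h
    refine ⟨y e, ?_⟩
    ext a
    have := congrArg (fun C : LinearMap.BilinForm K D => C e a) h
    simp only [wedge_apply, LinearMap.zero_apply, he] at this
    rw [LinearMap.smul_apply, smul_eq_mul]
    linear_combination -this
  · rintro ⟨c, rfl⟩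
    rw [map_smul, wedge_self, smul_zero]

/-- The linear forms `y` such that `x ∧ y` belongs to `V`. -/
def slice (V : Submodule K (LinearMap.BilinForm K D)) (x : Dual K D) : Submodule K (Dual K D) :=
  V.comap (wedge x)

theorem mem_slice {V : Submodule K (LinearMap.BilinForm K D)} {x y : Dual K D} :
    y ∈ slice V x ↔ wedge x y ∈ V := Iff.rfl

theorem self_mem_slice (V : Submodule K (LinearMap.BilinForm K D)) (x : Dual K D) :
    x ∈ slice V x := by
  rw [mem_slice, wedge_self]
  exact V.zero_mem

theorem mem_slice_comm {V : Submodule K (LinearMap.BilinForm K D)} {x y : Dual K D} :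
    y ∈ slice V x ↔ x ∈ slice V y := by
  rw [mem_slice, mem_slice, wedge_swap, Submodule.neg_mem_iff]

variable [FiniteDimensional K D]

/-- The map `wedge x` sends the slice onto the forms of `V` that vanish on `ker x`. Its kernel is
the line of `x`, which accounts for the `+ 1`. -/
theorem finrank_slice (V : Submodule K (LinearMap.BilinForm K D)) (hV : ∀ v ∈ V, v.IsAlt)
    {x : Dual K D} (hx : x ≠ 0) :
    finrank K (slice V x) = finrank K (V ⊓ LinearMap.ker (restrictForm (LinearMap.ker x)) :
      Submodule K (LinearMap.BilinForm K D)) + 1 := by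
  rw [← finrank_map_add_finrank_inf_ker (wedge x)]
  have hmap : (slice V x).map (wedge x) =
      V ⊓ LinearMap.ker (restrictForm (LinearMap.ker x)) := by
    ext B
    simp only [Submodule.mem_map, Submodule.mem_inf, LinearMap.mem_ker]
    constructor
    · rintro ⟨y, hy, rfl⟩
      exact ⟨hy, restrictForm_ker_wedge x y⟩
    · rintro ⟨hB, h0⟩
      obtain ⟨y, rfl⟩ := exists_eq_wedge hx (hV _ hB) h0
      exact ⟨y, hB, rfl⟩
  rw [hmap, ker_wedge hx, inf_eq_right (a := slice V x).2
    ((Submodule.span_singleton_le_iff_mem _ _).2 (self_mem_slice V x)), finrank_span_singleton hx]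

theorem finrank_map_restrictForm_ker (V : Submodule K (LinearMap.BilinForm K D))
    (hV : ∀ v ∈ V, v.IsAlt) {x : Dual K D} (hx : x ≠ 0) :
    finrank K (V.map (restrictForm (LinearMap.ker x))) + finrank K (slice V x) =
      finrank K V + 1 := by
  rw [finrank_slice V hV hx, ← finrank_map_add_finrank_inf_ker (restrictForm (LinearMap.ker x)) V,
    add_assoc]

theorem finrank_ker_of_ne_zero {x : Dual K D} (hx : x ≠ 0) :
    finrank K (LinearMap.ker x) + 1 = finrank K D := by
  exact Module.Dual.finrank_ker_add_one_of_ne_zero hx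

end Wedge

/-! ### The dimension bound, and slices as degrees -/

section Bound

variable {K D : Type*} [Field K] [AddCommGroup D] [Module K D]

/-- Twice the maximal dimension of an affine space of alternating forms of rank at most `2 * s` on a
space of dimension `n`. -/
def twiceBound (n s : ℕ) : ℕ := max ((2 * s + 1) * (2 * s)) (s * (2 * n - s - 1))

theorem two_mul_finrank_le_of_isAlt {n : ℕ} (d : Basis (Fin n) K D)
    (V : Submodule K (LinearMap.BilinForm K D)) (hV : ∀ v ∈ V, v.IsAlt) :
    2 * finrank K V ≤ n * n - n := by
  classical
  rw [finrank_eq_card_leadGraph d V hV, ← card_filter_lt_of_symm]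
  refine (Finset.card_le_card (t := (Finset.univ : Finset (Fin n)).offDiag) ?_).trans ?_
  · intro p hp
    have := (Finset.mem_filter.1 hp).2
    simpa using this.ne
  · rw [Finset.offDiag_card, Finset.card_univ, Fintype.card_fin]

/-- For `n = 2 * s + 1` the bound is the dimension of the space of all alternating forms. From `n =
2 * s + 2` on, the graph of leading positions has no `s + 1` disjoint edges, and the Erdős–Gallai
theorem applies. -/
theorem two_mul_finrank_le {n s : ℕ} (hs : 2 * s < n) (d : Basis (Fin n) K D)
    (B₀ : LinearMap.BilinForm K D) (hB₀ : B₀.IsAlt) (V : Submodule K (LinearMap.BilinForm K D))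
    (hV : ∀ v ∈ V, v.IsAlt) (h : ∀ v ∈ V, ¬ HasHyperbolic (B₀ + v) ⊤ (s + 1)) :
    2 * finrank K V ≤ twiceBound n s := by
  classical
  rcases Nat.lt_or_ge n (2 * s + 2) with hn | hn
  · obtain rfl : n = 2 * s + 1 := by omega
    refine (two_mul_finrank_le_of_isAlt d V hV).trans (le_trans ?_ (le_max_left _ _))
    rw [Nat.sub_le_iff_le_add]
    exact le_of_eq (by ring)
  · rw [finrank_eq_card_leadGraph d V hV, ← card_filter_lt_of_symm]
    have := ((leadGraph d V hV).erdos_gallai s (by simpa using hn)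
      (leadGraph_no_matching d B₀ hB₀ V hV (s + 1) h)).1
    simpa [twiceBound] using this

theorem leadGraph_mono {n : ℕ} (d : Fin n → D) {W V : Submodule K (LinearMap.BilinForm K D)}
    (hV : ∀ v ∈ V, v.IsAlt) (hWV : W ≤ V) :
    leadGraph d W (fun v hv => hV v (hWV hv)) ≤ leadGraph d V hV := by
  rintro p q ⟨hpq, v, hv, h⟩
  exact ⟨hpq, v, hWV hv, h⟩

theorem ker_coord_le_span {ι : Type*} (d : Basis ι K D) (l : ι) :
    LinearMap.ker (d.coord l) ≤ Submodule.span K (d '' {i | i ≠ l}) := by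
  intro a ha
  rw [Basis.mem_span_image]
  intro i hi hil
  rw [Finset.mem_coe, Finsupp.mem_support_iff, hil] at hi
  exact hi (by simpa using ha)

theorem apply_basis_mem_ker_coord {ι : Type*} (d : Basis ι K D) {i l : ι} (h : i ≠ l) :
    d i ∈ LinearMap.ker (d.coord l) := by
  simp [h]

/-- All pairs that avoid the last index `l` precede those that contain it. A form led at `(p, l)`
thus vanishes on the span of the other basis vectors, which is the kernel of the last coordinate. -/
theorem leadGraph_inf_ker_adj_iff {n : ℕ} (d : Basis (Fin n) K D)
    (V : Submodule K (LinearMap.BilinForm K D)) (hV : ∀ v ∈ V, v.IsAlt) (l : Fin n)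
    (hl : ∀ i, i ≤ l) (p q : Fin n) (hpq : p < q) :
    (leadGraph d (V ⊓ LinearMap.ker (restrictForm (LinearMap.ker (d.coord l))))
      (fun v hv => hV v hv.1)).Adj p q ↔ q = l ∧ (leadGraph d V hV).Adj p l := by
  constructor
  · rintro ⟨hne, v, ⟨hv, hv0⟩, hlead, hlt⟩
    have hq : q = l := by
      by_contra hql
      have hpl : p ≠ l := fun h => by
        have := hl q
        rw [← h] at this
        exact absurd hpq (not_lt.2 this)
      exact hlead ((restrictForm_eq_zero_iff _ _).1 hv0 _ (apply_basis_mem_ker_coord d hpl) _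
        (apply_basis_mem_ker_coord d hql))
    subst hq
    exact ⟨rfl, hne, v, hv, hlead, hlt⟩
  · rintro ⟨rfl, hne, v, hv, hlead, hlt⟩
    refine ⟨hne, v, ⟨hv, ?_⟩, hlead, hlt⟩
    rw [SetLike.mem_coe, LinearMap.mem_ker, restrictForm_eq_zero_iff]
    intro a ha b hb
    refine bilin_eq_zero_of_mem_span ?_ (ker_coord_le_span d _ ha) (ker_coord_le_span d _ hb)
    rintro _ ⟨i, hi, rfl⟩ _ ⟨j, hj, rfl⟩
    by_cases hij : i = j
    · rw [hij]; exact hV v hv _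
    · refine hlt i j hij ?_
      have h1 := two_pow_add_two_pow_lt (p := i) (q := j) (b := q) (fun h => hij (Fin.ext h))
        (lt_of_le_of_ne (hl i) (fun h => hi (Fin.ext h)))
        (lt_of_le_of_ne (hl j) (fun h => hj (Fin.ext h)))
      have h2 : 0 < 2 ^ (p : ℕ) := by positivity
      omega

/-- The degree of the last vertex in the graph of leading positions. -/
theorem finrank_slice_eq_degree [FiniteDimensional K D] {n : ℕ} (d : Basis (Fin n) K D)
    (V : Submodule K (LinearMap.BilinForm K D)) (hV : ∀ v ∈ V, v.IsAlt) (l : Fin n)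
    (hl : ∀ i, i ≤ l) [DecidableRel (leadGraph d V hV).Adj] :
    finrank K (slice V (d.coord l)) =
      (Finset.univ.filter (fun p => (leadGraph d V hV).Adj p l)).card + 1 := by
  classical
  have hx : d.coord l ≠ 0 := fun h => by
    have := congrArg (fun f : Dual K D => f (d l)) h
    simp at this
  rw [finrank_slice V hV hx, finrank_eq_card_leadGraph d
    (V ⊓ LinearMap.ker (restrictForm (LinearMap.ker (d.coord l)))) (fun v hv => hV v hv.1)]
  congr 1
  refine Finset.card_bij' (fun p _ => p.1) (fun p _ => (p, l)) ?_ ?_ ?_ ?_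
  · rintro ⟨p, q⟩ h
    have h1 := (Finset.mem_filter.1 h).2
    have h2 := ((leadGraph_inf_ker_adj_iff d V hV l hl p q h1.1).1 h1.2).2
    simpa using h2
  · intro p h
    have h1 := (Finset.mem_filter.1 h).2
    have hpl : p < l := lt_of_le_of_ne (hl p) h1.ne
    exact Finset.mem_filter.2 ⟨Finset.mem_univ _, hpl,
      (leadGraph_inf_ker_adj_iff d V hV l hl p l hpl).2 ⟨rfl, h1⟩⟩
  · rintro ⟨p, q⟩ h
    have h1 := (Finset.mem_filter.1 h).2
    have h2 := ((leadGraph_inf_ker_adj_iff d V hV l hl p q h1.1).1 h1.2).1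
    simp [h2]
  · intro p _; rfl

theorem exists_basis_fin_of_linearIndependent_pair [FiniteDimensional K D] {n : ℕ}
    (hn : finrank K D = n) {x y : D} (h : LinearIndependent K ![x, y]) :
    ∃ (e : Basis (Fin n) K D) (l m : Fin n), (∀ i, i ≤ l) ∧ (∀ i, i ≠ l → i ≤ m) ∧ m ≠ l ∧
      e l = x ∧ e m = y := by
  classical
  obtain ⟨k, rfl⟩ : ∃ k, n = k + 2 := by
    have := h.fintype_card_le_finrank
    rw [Fintype.card_fin] at this
    exact ⟨n - 2, by omega⟩
  have hxy : x ≠ y := fun hxy => by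
    have := h.injective (show ![x, y] 0 = ![x, y] 1 from hxy)
    simp at this
  have h2 : LinearIndepOn K id ({x, y} : Set D) := by
    have := h.linearIndepOn_id
    rwa [Matrix.range_cons, Matrix.range_cons, Matrix.range_empty, Set.union_empty,
      Set.singleton_union] at this
  set b := Basis.extend h2 with hb
  have hxs := Basis.subset_extend h2 (show x ∈ ({x, y} : Set D) by simp)
  have hys := Basis.subset_extend h2 (show y ∈ ({x, y} : Set D) by simp)
  have hfin : Fintype (h2.extend (Set.subset_univ _)) := FiniteDimensional.fintypeBasisIndex b
  have hcard : Fintype.card (h2.extend (Set.subset_univ _)) = k + 2 := by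
    rw [← hn, Module.finrank_eq_card_basis b]
  set f := Fintype.equivFinOfCardEq hcard with hf
  set l : Fin (k + 2) := Fin.last (k + 1) with hl
  set m : Fin (k + 2) := ⟨k, by omega⟩ with hm
  have hml : m ≠ l := fun h => by simp [hm, hl, Fin.ext_iff] at h
  -- Two transpositions bring `x` to the last index and then `y` to the one before it, without
  -- moving `x` again.
  set f₁ := f.trans (Equiv.swap (f ⟨x, hxs⟩) l) with hf₁
  set f₂ := f₁.trans (Equiv.swap (f₁ ⟨y, hys⟩) m) with hf₂
  have hfx₁ : f₁ ⟨x, hxs⟩ = l := by simp [hf₁]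
  have hfy₁ : f₁ ⟨y, hys⟩ ≠ l := fun h => by
    rw [← hfx₁] at h
    exact hxy (congrArg Subtype.val (f₁.injective h)).symm
  have hfx : f₂ ⟨x, hxs⟩ = l := by
    rw [hf₂, Equiv.trans_apply, hfx₁, Equiv.swap_apply_of_ne_of_ne hfy₁.symm hml.symm]
  have hfy : f₂ ⟨y, hys⟩ = m := by simp [hf₂]
  refine ⟨b.reindex f₂, l, m, fun i => Fin.le_last i, fun i hi => ?_, hml, ?_, ?_⟩
  · have h1 : (i : ℕ) ≠ k + 1 := fun h => hi (Fin.ext h)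
    rw [Fin.le_def]
    have := i.2
    simp only [hm]
    omega
  · rw [← hfx, Basis.reindex_apply, Equiv.symm_apply_apply, hb, Basis.extend_apply_self]
  · rw [← hfy, Basis.reindex_apply, Equiv.symm_apply_apply, hb, Basis.extend_apply_self]

/-- Every basis of the dual space consists of the coordinate forms of a basis. -/
theorem exists_basis_coord_eq [FiniteDimensional K D] {ι : Type*} [Finite ι]
    (e : Basis ι K (Dual K D)) : ∃ d : Basis ι K D, ∀ i, d.coord i = e i := by
  classical
  have := Fintype.ofFinite ι
  refine ⟨e.dualBasis.map (evalEquiv K D).symm, fun i => ?_⟩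
  refine (e.dualBasis.map (evalEquiv K D).symm).ext fun j => ?_
  have h1 : e i ((e.dualBasis.map (evalEquiv K D).symm) j) = e.dualBasis j (e i) := by
    rw [Basis.map_apply]
    exact apply_evalEquiv_symm_apply (R := K) (M := D) (e i) (e.dualBasis j)
  rw [h1, Basis.coord_apply, Basis.repr_self, Basis.dualBasis_apply_self, Finsupp.single_apply]
  simp only [eq_comm]

end Bound

/-! ### The three extremal cases, and reduction when a slice is large -/

section Cases

variable {K D : Type*} [Field K] [AddCommGroup D] [Module K D]

/-- All the forms in `B₀ + V` vanish on a common subspace of codimension `s`, and `V` has the largest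
dimension that this allows. -/
def IsotropicCase (s : ℕ) (B₀ : LinearMap.BilinForm K D)
    (V : Submodule K (LinearMap.BilinForm K D)) : Prop :=
  2 * finrank K V = s * (2 * finrank K D - s - 1) ∧ ∃ L : Submodule K D,
    finrank K L + s = finrank K D ∧ ∀ v ∈ V, ∀ a ∈ L, ∀ b ∈ L, (B₀ + v) a b = 0

/-- All the forms in `B₀ + V` have a common subspace of codimension `2 * s + 1` in their radicals, and
`V` has the largest dimension that this allows. -/
def RadicalCase (s : ℕ) (B₀ : LinearMap.BilinForm K D)
    (V : Submodule K (LinearMap.BilinForm K D)) : Prop :=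
  2 * finrank K V = (2 * s + 1) * (2 * s) ∧ ∃ R : Submodule K D,
    finrank K R + (2 * s + 1) = finrank K D ∧ ∀ v ∈ V, ∀ a ∈ R, ∀ b, (B₀ + v) a b = 0

/-- The exceptional affine space over the field with two elements. -/
def ExceptionalCase (s : ℕ) (B₀ : LinearMap.BilinForm K D)
    (V : Submodule K (LinearMap.BilinForm K D)) : Prop :=
  s = 1 ∧ finrank K D = 4 ∧ Nat.card K = 2 ∧ finrank K V = 3 ∧ ∃ e : Basis (Fin 4) K D,
    ∀ v ∈ V, LinearMap.BilinForm.toMatrix e (B₀ + v) ∈ exceptionalU K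

/-- The classification of the affine spaces of maximal dimension, for forms on spaces of dimension
`n`. -/
def Classified.{u, v} (K : Type u) [Field K] (n s : ℕ) : Prop :=
  ∀ (D : Type v) [AddCommGroup D] [Module K D] [FiniteDimensional K D], finrank K D = n →
    ∀ (B₀ : LinearMap.BilinForm K D) (V : Submodule K (LinearMap.BilinForm K D)), B₀.IsAlt →
      (∀ v ∈ V, v.IsAlt) → (∀ v ∈ V, ¬ HasHyperbolic (B₀ + v) ⊤ (s + 1)) →
      2 * finrank K V = twiceBound n s →
      IsotropicCase s B₀ V ∨ RadicalCase s B₀ V ∨ ExceptionalCase s B₀ V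

theorem hasHyperbolic_one {B : LinearMap.BilinForm K D} (hB : B.IsAlt) (h : B ≠ 0) :
    HasHyperbolic B ⊤ 1 := by
  obtain ⟨p, q, hpq⟩ : ∃ p q, B p q ≠ 0 := by
    by_contra hno
    push Not at hno
    exact h (LinearMap.ext fun p => LinearMap.ext fun q => hno p q)
  exact HasHyperbolic.succ_of_orthogonal (k := 0) (u := Fin.elim0) (v := Fin.elim0) hB
    (fun i => i.elim0) (fun i => i.elim0) (fun i => i.elim0) (fun i => i.elim0) (fun i => i.elim0)
    (Submodule.mem_top (x := p)) (Submodule.mem_top (x := q)) (fun i => i.elim0) (fun i => i.elim0)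
    (fun i => i.elim0) (fun i => i.elim0) hpq

/-- The form `x ∧ y` has `ker x ⊓ ker y` in its radical, so a multiple of it can add a pair without
disturbing a family located there. -/
theorem exists_hasHyperbolic_succ_of_wedge_mem {B₀ : LinearMap.BilinForm K D} (hB₀ : B₀.IsAlt)
    {V : Submodule K (LinearMap.BilinForm K D)} (hV : ∀ v ∈ V, v.IsAlt) {x y : Dual K D}
    (hxy : wedge x y ∈ V) (hne : wedge x y ≠ 0) {v : LinearMap.BilinForm K D} (hv : v ∈ V) {k : ℕ}
    (h : HasHyperbolic (B₀ + v) (LinearMap.ker x ⊓ LinearMap.ker y) k) :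
    ∃ v' ∈ V, HasHyperbolic (B₀ + v') ⊤ (k + 1) := by
  obtain ⟨p, q, hpq⟩ : ∃ p q, wedge x y p q ≠ 0 := by
    by_contra hno
    push Not at hno
    exact hne (LinearMap.ext fun p => LinearMap.ext fun q => hno p q)
  have hker : ∀ a ∈ LinearMap.ker x ⊓ LinearMap.ker y, ∀ b, wedge x y a b = 0 := by
    rintro a ⟨ha, ha'⟩ b
    rw [SetLike.mem_coe, LinearMap.mem_ker] at ha ha'
    rw [wedge_apply, ha, ha']
    ring
  obtain ⟨c, hc⟩ := h.exists_succ (hB₀.add (hV v hv)) (isAlt_wedge x y) (p := p) (q := q)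
    (fun a ha b _ => hker a ha b) (fun a ha => hker a ha p) (fun a ha => hker a ha q) hpq
  refine ⟨v + c • wedge x y, V.add_mem hv (V.smul_mem c hxy), ?_⟩
  rw [← add_assoc]
  exact hc.mono le_top

theorem not_hasHyperbolic_restrictForm {B₀ : LinearMap.BilinForm K D}
    {V : Submodule K (LinearMap.BilinForm K D)} (H : Submodule K D) {k : ℕ}
    (h : ∀ v ∈ V, ¬ HasHyperbolic (B₀ + v) H k) :
    ∀ v ∈ V.map (restrictForm H), ¬ HasHyperbolic (restrictForm H B₀ + v) ⊤ k := by
  rintro _ ⟨v, hv, rfl⟩ hyp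
  rw [← map_add] at hyp
  exact h v hv hyp.of_restrictForm

variable [FiniteDimensional K D]

theorem exists_mem_notMem_of_finrank_lt {E : Type*} [AddCommGroup E] [Module K E]
    [FiniteDimensional K E] {A B : Submodule K E} (h : finrank K B < finrank K A) :
    ∃ y ∈ A, y ∉ B := by
  by_contra hno
  push Not at hno
  exact absurd (Submodule.finrank_mono (show A ≤ B from hno)) (not_le.2 h)

/-- Vanishing on the `2 * s` vectors of a family costs at most `2 * s` dimensions of the slice. At
least two remain, so there is such a `y` off the line of `x`, and `x ∧ y` would bring one more pair.
-/
theorem not_hasHyperbolic_ker_of_lt_finrank_slice {B₀ : LinearMap.BilinForm K D} (hB₀ : B₀.IsAlt)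
    {V : Submodule K (LinearMap.BilinForm K D)} (hV : ∀ v ∈ V, v.IsAlt) {s : ℕ}
    (h : ∀ v ∈ V, ¬ HasHyperbolic (B₀ + v) ⊤ (s + 1)) {x : Dual K D} (hx : x ≠ 0)
    (hslice : 2 * s + 1 < finrank K (slice V x)) :
    ∀ v ∈ V, ¬ HasHyperbolic (B₀ + v) (LinearMap.ker x) s := by
  rintro v hv ⟨u, w, hu, hw, huw⟩
  set ev : Dual K D →ₗ[K] (Fin s ⊕ Fin s → K) :=
    LinearMap.pi fun i => Dual.eval K D (Sum.elim u w i) with hev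
  have h1 := finrank_map_add_finrank_inf_ker ev (slice V x)
  have h2 : finrank K ((slice V x).map ev) ≤ 2 * s := by
    refine (Submodule.finrank_le _).trans ?_
    rw [Module.finrank_fintype_fun_eq_card]
    simp [two_mul]
  obtain ⟨y, ⟨hyV, hy0⟩, hyx⟩ := exists_mem_notMem_of_finrank_lt
    (A := slice V x ⊓ LinearMap.ker ev) (B := Submodule.span K {x}) (by
      rw [finrank_span_singleton hx]; omega)
  rw [SetLike.mem_coe, LinearMap.mem_ker] at hy0
  have hyu : ∀ i, y (u i) = 0 := fun i => congrFun hy0 (Sum.inl i)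
  have hyw : ∀ i, y (w i) = 0 := fun i => congrFun hy0 (Sum.inr i)
  obtain ⟨v', hv', hyp⟩ := exists_hasHyperbolic_succ_of_wedge_mem hB₀ hV (x := x) (y := y) hyV
    (fun h0 => hyx (by rwa [← ker_wedge hx])) hv
    ⟨u, w, fun i => ⟨hu i, hyu i⟩, fun i => ⟨hw i, hyw i⟩, huw⟩
  exact h v' hv' hyp

/-- The isotropic value `s * (2 * n - s - 1) / 2` drops by exactly `n - 1`, the largest possible
loss, when `(n, s)` becomes `(n - 1, s - 1)`; this forces equality. The last clause discards the
radical case of the induction unless `s = 1`. -/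
theorem hub_numeric {n s r N : ℕ} (hs : 1 ≤ s) (hn : 2 * s + 2 ≤ n) (hN : 2 * N = twiceBound n s)
    (hr : 2 * r ≤ twiceBound (n - 1) (s - 1)) (hNr : N + 1 ≤ r + n) :
    2 * r = twiceBound (n - 1) (s - 1) ∧ 2 * N = s * (2 * n - s - 1) ∧
      (2 * r = (2 * (s - 1) + 1) * (2 * (s - 1)) → s = 1) := by
  obtain ⟨s, rfl⟩ := Nat.exists_eq_add_of_le' hs
  obtain ⟨m, rfl⟩ := Nat.exists_eq_add_of_le hn
  simp only [Nat.add_sub_cancel] at *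
  have e1 : 2 * (2 * (s + 1) + 2 + m) - (s + 1) - 1 = 3 * s + 6 + 2 * m := by omega
  have e2 : 2 * (2 * (s + 1) + 2 + m - 1) - s - 1 = 3 * s + 5 + 2 * m := by omega
  unfold twiceBound at *
  rw [e1] at hN ⊢
  rw [e2] at hr ⊢
  have h1 : (2 * (s + 1) + 1) * (2 * (s + 1)) ≤ 2 * N := hN ▸ le_max_left _ _
  have h2 : (s + 1) * (3 * s + 6 + 2 * m) ≤ 2 * N := hN ▸ le_max_right _ _
  have key : 2 * r ≤ (2 * s + 1) * (2 * s) → s = 0 := by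
    intro h3
    by_contra h0
    obtain ⟨t, rfl⟩ := Nat.exists_eq_add_of_le' (Nat.one_le_iff_ne_zero.2 h0)
    nlinarith
  rcases le_total ((2 * s + 1) * (2 * s)) (s * (3 * s + 5 + 2 * m)) with h4 | h4
  · rw [max_eq_right h4] at hr ⊢
    refine ⟨by nlinarith, by nlinarith, fun h5 => ?_⟩
    rw [key h5.le]
  · rw [max_eq_left h4] at hr ⊢
    obtain rfl := key hr
    refine ⟨by nlinarith, by nlinarith, fun _ => rfl⟩

/-- If some hyperplane supports too many forms of `V`, one reduces to that hyperplane. -/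
theorem isotropicCase_of_lt_finrank_slice.{u, v} {K : Type u} {D : Type v} [Field K]
    [AddCommGroup D] [Module K D] [FiniteDimensional K D] {n s : ℕ} (hs : 1 ≤ s)
    (hn : 2 * s + 2 ≤ n) (hD : finrank K D = n) (ih : Classified.{u, v} K (n - 1) (s - 1))
    {B₀ : LinearMap.BilinForm K D} (hB₀ : B₀.IsAlt)
    {V : Submodule K (LinearMap.BilinForm K D)} (hV : ∀ v ∈ V, v.IsAlt)
    (h : ∀ v ∈ V, ¬ HasHyperbolic (B₀ + v) ⊤ (s + 1)) (hdim : 2 * finrank K V = twiceBound n s)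
    {x : Dual K D} (hx : x ≠ 0) (hslice : 2 * s + 1 < finrank K (slice V x)) :
    IsotropicCase s B₀ V := by
  set H := LinearMap.ker x with hH
  have hHn : finrank K H = n - 1 := by
    have := finrank_ker_of_ne_zero hx
    rw [← hH, hD] at this
    omega
  have hno := not_hasHyperbolic_ker_of_lt_finrank_slice hB₀ hV h hx hslice
  have hno' := not_hasHyperbolic_restrictForm H hno
  have hVH := isAlt_of_mem_map_restrictForm hV H
  have hr : 2 * finrank K (V.map (restrictForm H)) ≤ twiceBound (n - 1) (s - 1) :=
    two_mul_finrank_le (by omega) (finBasisOfFinrankEq K H hHn) (restrictForm H B₀)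
      (hB₀.restrictForm H) _ hVH (by rwa [Nat.sub_add_cancel hs])
  have hsum := finrank_map_restrictForm_ker V hV hx
  rw [← hH] at hsum
  have hsl : finrank K (slice V x) ≤ n := by
    refine (Submodule.finrank_le _).trans ?_
    rw [Subspace.dual_finrank_eq, hD]
  obtain ⟨hr', hN, hs1⟩ := hub_numeric hs hn hdim hr (by omega)
  refine ⟨by rw [hD]; exact hN, ?_⟩
  by_cases hs2 : s = 1
  · subst hs2
    refine ⟨H, by omega, fun v hv a ha b hb => ?_⟩
    have h0 : restrictForm H (B₀ + v) = 0 := by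
      by_contra hne
      exact hno v hv (hasHyperbolic_one ((hB₀.add (hV v hv)).restrictForm H) hne).of_restrictForm
    exact (restrictForm_eq_zero_iff H _).1 h0 a ha b hb
  · rcases ih H hHn (restrictForm H B₀) (V.map (restrictForm H)) (hB₀.restrictForm H) hVH
      (by rwa [Nat.sub_add_cancel hs]) hr' with hc | hc | hc
    · obtain ⟨-, L, hL, hL0⟩ := hc
      refine ⟨L.map H.subtype, ?_, ?_⟩
      · rw [LinearEquiv.finrank_eq (Submodule.equivMapOfInjective _ H.injective_subtype L).symm]
        omega
      · rintro v hv _ ⟨a, ha, rfl⟩ _ ⟨b, hb, rfl⟩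
        exact hL0 _ ⟨v, hv, rfl⟩ a ha b hb
    · exact absurd (hs1 hc.1) hs2
    -- The exceptional case would require `s = 2` and `n = 5`, against `2 * s + 2 ≤ n`.
    · have h1 := hc.1
      have h2 := hc.2.1
      omega

end Cases

/-! ### Affine maps from forms to linear forms whose values kill radicals -/

section Biorthogonal

variable {K H : Type*} [Field K] [AddCommGroup H] [Module K H]

/-- The alternating forms whose radical contains `R`. -/
def radicalForms (R : Submodule K H) : Submodule K (LinearMap.BilinForm K H) where
  carrier := {u | u.IsAlt ∧ ∀ r ∈ R, ∀ b, u r b = 0}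
  add_mem' := by
    rintro u v ⟨hu, hu'⟩ ⟨hv, hv'⟩
    exact ⟨hu.add hv, fun r hr b => by simp [hu' r hr b, hv' r hr b]⟩
  zero_mem' := ⟨LinearMap.BilinForm.isAlt_zero, fun _ _ _ => rfl⟩
  smul_mem' := by
    rintro c u ⟨hu, hu'⟩
    exact ⟨hu.smul c, fun r hr b => by simp [hu' r hr b]⟩

theorem wedge_mem_radicalForms {R : Submodule K H} {α β : Dual K H}
    (hα : α ∈ R.dualAnnihilator) (hβ : β ∈ R.dualAnnihilator) : wedge α β ∈ radicalForms R := by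
  rw [Submodule.mem_dualAnnihilator] at hα hβ
  exact ⟨isAlt_wedge α β, fun r hr b => by simp [hα r hr, hβ r hr]⟩

theorem hasHyperbolic_sum_wedge {s : ℕ} (f : Fin s ⊕ Fin s → Dual K H) (ψ : Fin s ⊕ Fin s → H)
    (hψ : ∀ i j, f i (ψ j) = if i = j then 1 else 0) :
    HasHyperbolic (∑ i, wedge (f (Sum.inl i)) (f (Sum.inr i))) ⊤ s := by
  refine ⟨fun i => ψ (Sum.inl i), fun i => ψ (Sum.inr i), fun _ => Submodule.mem_top,
    fun _ => Submodule.mem_top, fun i j => ?_, fun i j => ?_, fun i j => ?_⟩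
  · simp [LinearMap.sum_apply, hψ]
  · simp [LinearMap.sum_apply, hψ]
  · simp only [LinearMap.sum_apply, wedge_apply, hψ]
    simp [eq_comm]

/-- The coordinate functions of the family extend to linear functions on the whole dual space; by
finite dimension these are evaluations at vectors. -/
theorem exists_biorthogonal [FiniteDimensional K H] {ι : Type*} [Finite ι] [DecidableEq ι]
    {f : ι → Dual K H} (hf : LinearIndependent K f) :
    ∃ ψ : ι → H, ∀ i j, f i (ψ j) = if i = j then 1 else 0 := by
  obtain ⟨g, hg⟩ := LinearMap.exists_extend hf.repr
  refine ⟨fun j => (evalEquiv K H).symm ((Finsupp.lapply j).comp g), fun i j => ?_⟩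
  rw [apply_evalEquiv_symm_apply]
  have h1 : g (f i) = Finsupp.single i 1 := by
    have h2 := congrArg (fun F => F ⟨f i, Submodule.subset_span ⟨i, rfl⟩⟩) hg
    simp only [LinearMap.comp_apply, Submodule.subtype_apply] at h2
    rw [h2]
    exact hf.repr_eq_single i _ rfl
  rw [LinearMap.comp_apply, h1, Finsupp.lapply_apply, Finsupp.single_apply]

theorem sub_sum_mem_of_biorthogonal [FiniteDimensional K H] {R : Submodule K H} {m : ℕ}
    (hR : finrank K R + m = finrank K H) {x : Fin m → Dual K H} (hx : LinearIndependent K x)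
    (hxR : ∀ i, x i ∈ R.dualAnnihilator) {h : Fin m → H}
    (hxh : ∀ i j, x i (h j) = if i = j then 1 else 0) (t : H) : t - ∑ i, x i t • h i ∈ R := by
  rw [← Subspace.forall_mem_dualAnnihilator_apply_eq_zero_iff]
  intro φ hφ
  have hspan : Submodule.span K (Set.range x) = R.dualAnnihilator := by
    refine Submodule.eq_of_le_of_finrank_eq (Submodule.span_le.2 ?_) ?_
    · rintro _ ⟨i, rfl⟩
      exact hxR i
    · rw [finrank_span_eq_card hx, Fintype.card_fin]
      have := Subspace.finrank_add_finrank_dualAnnihilator_eq R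
      omega
  rw [← hspan] at hφ
  have hle : Submodule.span K (Set.range x) ≤
      LinearMap.ker (Dual.eval K H (t - ∑ i, x i t • h i)) := by
    refine Submodule.span_le.2 ?_
    rintro _ ⟨j, rfl⟩
    simp [hxh]
  exact hle hφ

theorem eq_zero_of_mem_radicalForms {R : Submodule K H} {m : ℕ} {x : Fin m → Dual K H}
    {h : Fin m → H} (hdec : ∀ t, t - ∑ i, x i t • h i ∈ R) {u : LinearMap.BilinForm K H}
    (hu : u ∈ radicalForms R) (h0 : ∀ i j, i < j → u (h i) (h j) = 0) : u = 0 := by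
  have h1 : ∀ i j, u (h i) (h j) = 0 := by
    intro i j
    rcases lt_trichotomy i j with hij | rfl | hij
    · exact h0 i j hij
    · exact hu.1 _
    · rw [hu.1.swap, h0 j i hij, neg_zero]
  have h2 : ∀ a b, u a b = u (∑ i, x i a • h i) b := by
    intro a b
    have := hu.2 _ (hdec a) b
    rw [map_sub, LinearMap.sub_apply, sub_eq_zero] at this
    exact this
  ext a b
  rw [h2, hu.1.swap, h2]
  simp [LinearMap.sum_apply, map_sum, h1]

theorem eq_sum_wedge_of_mem_radicalForms {R : Submodule K H} {m : ℕ} {x : Fin m → Dual K H}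
    (hxR : ∀ i, x i ∈ R.dualAnnihilator) {h : Fin m → H}
    (hxh : ∀ i j, x i (h j) = if i = j then 1 else 0) (hdec : ∀ t, t - ∑ i, x i t • h i ∈ R)
    {u : LinearMap.BilinForm K H} (hu : u ∈ radicalForms R) :
    u = ∑ p ∈ Finset.univ.filter (fun p : Fin m × Fin m => p.1 < p.2),
      u (h p.1) (h p.2) • wedge (x p.1) (x p.2) := by
  rw [← sub_eq_zero]
  refine eq_zero_of_mem_radicalForms hdec (Submodule.sub_mem _ hu (Submodule.sum_mem _ fun p _ =>
    Submodule.smul_mem _ _ (wedge_mem_radicalForms (hxR _) (hxR _)))) fun i j hij => ?_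
  rw [LinearMap.sub_apply, LinearMap.sub_apply, LinearMap.sum_apply, LinearMap.sum_apply,
    Finset.sum_eq_single (i, j)]
  · simp [hxh, hij.ne, hij.ne']
  · rintro ⟨p, q⟩ hpq hne
    have hpq' : p < q := (Finset.mem_filter.1 hpq).2
    simp only [LinearMap.smul_apply, wedge_apply, hxh, smul_eq_mul]
    by_cases h1 : p = i
    · have h2 : q ≠ j := fun h2 => hne (by rw [h1, h2])
      have h3 : q ≠ i := by rw [← h1]; exact hpq'.ne'
      simp [h2, h3]
    · by_cases h4 : q = i
      · have h5 : p ≠ j := by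
          rintro rfl
          exact absurd (h4 ▸ hpq') (not_lt.2 hij.le)
        simp [h1, h5]
      · simp [h1, h4]
  · intro hno
    exact absurd (by simpa using hij) hno

/-- A form whose radical contains `R` is determined by its restriction to a complement of `R`, a
space of dimension `m`. -/
theorem two_mul_finrank_radicalForms_le [FiniteDimensional K H] {R : Submodule K H} {m : ℕ}
    (hR : finrank K R + m = finrank K H) : 2 * finrank K (radicalForms R) ≤ m * m - m := by
  obtain ⟨C, hC⟩ := R.exists_isCompl
  have hCm : finrank K C = m := by
    have := Submodule.finrank_add_eq_of_isCompl hC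
    omega
  have hdisj : radicalForms R ⊓ LinearMap.ker (restrictForm C) = ⊥ := by
    rw [eq_bot_iff]
    rintro u ⟨hu, hu0⟩
    rw [SetLike.mem_coe, LinearMap.mem_ker, restrictForm_eq_zero_iff] at hu0
    rw [Submodule.mem_bot]
    have hdec : ∀ a : H, ∃ r ∈ R, ∃ c ∈ C, r + c = a := fun a => by
      have : a ∈ R ⊔ C := by rw [hC.sup_eq_top]; exact Submodule.mem_top
      obtain ⟨r, hr, c, hc, h⟩ := Submodule.mem_sup.1 this
      exact ⟨r, hr, c, hc, h⟩
    ext a b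
    obtain ⟨r, hr, c, hc, rfl⟩ := hdec a
    obtain ⟨r', hr', c', hc', rfl⟩ := hdec b
    have h1 : u c r' = 0 := by rw [hu.1.swap, hu.2 r' hr', neg_zero]
    simp [hu.2 r hr, h1, hu0 c hc c' hc']
  have h2 := finrank_map_add_finrank_inf_ker (restrictForm C) (radicalForms R)
  rw [hdisj, finrank_bot, add_zero] at h2
  rw [← h2]
  exact two_mul_finrank_le_of_isAlt (finBasisOfFinrankEq K C hCm) _
    (isAlt_of_mem_map_restrictForm (fun v (hv : v ∈ radicalForms R) => hv.1) C)

theorem exists_linearIndependent_family_of_pair {E ι : Type*} [AddCommGroup E] [Module K E]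
    [FiniteDimensional K E] [Fintype ι] [DecidableEq ι] {W : Submodule K E} {α β : E} (hα : α ∈ W)
    (hβ : β ∈ W) (hαβ : LinearIndependent K ![α, β]) {i j : ι} (hij : i ≠ j)
    (hcard : Fintype.card ι ≤ finrank K W) :
    ∃ f : ι → E, LinearIndependent K f ∧ f i = α ∧ f j = β ∧ ∀ k, f k ∈ W := by
  have h1 : LinearIndependent K ![(⟨α, hα⟩ : W), ⟨β, hβ⟩] := by
    rw [LinearIndependent.pair_iff] at hαβ ⊢
    intro a b hab
    exact hαβ a b (congrArg Subtype.val hab)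
  obtain ⟨e, l, m, -, -, hml, hel, hem⟩ := exists_basis_fin_of_linearIndependent_pair rfl h1
  obtain ⟨g⟩ := Function.Embedding.nonempty_of_card_le (α := ι) (β := Fin (finrank K W))
    (by simpa using hcard)
  set g₁ := g.trans (Equiv.swap (g i) l).toEmbedding with hg₁
  set g₂ := g₁.trans (Equiv.swap (g₁ j) m).toEmbedding with hg₂
  have hi₁ : g₁ i = l := by simp [hg₁]
  have hj₁ : g₁ j ≠ l := fun h => hij (g₁.injective (hi₁.trans h.symm))
  have hi : g₂ i = l := by
    rw [hg₂, Function.Embedding.trans_apply, hi₁, Equiv.coe_toEmbedding,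
      Equiv.swap_apply_of_ne_of_ne hj₁.symm hml.symm]
  have hj : g₂ j = m := by simp [hg₂]
  refine ⟨fun k => (e (g₂ k) : E), ?_, ?_, ?_, fun k => (e (g₂ k)).2⟩
  · exact (e.linearIndependent.comp g₂ g₂.injective).map' W.subtype W.ker_subtype
  · simp only [hi, hel]
  · simp only [hj, hem]

theorem wedge_eq_zero_of_not_linearIndependent {α β : Dual K H}
    (h : ¬ LinearIndependent K ![α, β]) : wedge α β = 0 := by
  by_cases hα : α = 0
  · rw [hα, wedge_swap, map_zero, neg_zero]
  · rw [LinearIndependent.pair_iff' hα] at h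
    push Not at h
    obtain ⟨a, rfl⟩ := h
    rw [map_smul, wedge_self, smul_zero]

theorem sum_wedge_mem_radicalForms {s : ℕ} {R : Submodule K H} {f : Fin s ⊕ Fin s → Dual K H}
    (hf : ∀ i, f i ∈ R.dualAnnihilator) :
    ∑ i, wedge (f (Sum.inl i)) (f (Sum.inr i)) ∈ radicalForms R :=
  Submodule.sum_mem _ fun _ _ => wedge_mem_radicalForms (hf _) (hf _)

theorem wedge_apply_eq_zero {α β : Dual K H} {t : H} (hα : α t = 0) (hβ : β t = 0) :
    wedge α β t = 0 := by
  ext b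
  simp [hα, hβ]

theorem le_finrank_dualAnnihilator_inf [FiniteDimensional K H] {R : Submodule K H} {s : ℕ}
    (hR : finrank K R + (2 * s + 1) = finrank K H) (t : H) :
    2 * s ≤ finrank K (R.dualAnnihilator ⊓ LinearMap.ker (Dual.eval K H t) :
      Submodule K (Dual K H)) := by
  have h1 := finrank_map_add_finrank_inf_ker (Dual.eval K H t) R.dualAnnihilator
  have h2 := Subspace.finrank_add_finrank_dualAnnihilator_eq R
  have h3 : finrank K (R.dualAnnihilator.map (Dual.eval K H t)) ≤ 1 :=
    (Submodule.finrank_le _).trans (finrank_self K).le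
  omega

/-- The values of an affine map on decomposable forms, when its values on forms of rank `2 * s` kill
the radical: the generic case. -/
theorem apply_wedge_eq_zero_of_two_le [FiniteDimensional K H] {R : Submodule K H} {s : ℕ}
    (hs : 2 ≤ s) (hR : finrank K R + (2 * s + 1) = finrank K H) (c : Dual K H)
    (Λ : LinearMap.BilinForm K H →ₗ[K] Dual K H)
    (hP : ∀ u ∈ radicalForms R, HasHyperbolic u ⊤ s → ∀ t, u t = 0 → c t + Λ u t = 0)
    {α β : Dual K H} (hα : α ∈ R.dualAnnihilator) (hβ : β ∈ R.dualAnnihilator) {t : H}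
    (hαt : α t = 0) (hβt : β t = 0) : Λ (wedge α β) t = 0 := by
  by_cases hli : LinearIndependent K ![α, β]
  swap
  · rw [wedge_eq_zero_of_not_linearIndependent hli, map_zero, LinearMap.zero_apply]
  obtain ⟨s, rfl⟩ := Nat.exists_eq_add_of_le' hs
  obtain ⟨f, hf, hf0, hf1, hfW⟩ := exists_linearIndependent_family_of_pair
    (W := R.dualAnnihilator ⊓ LinearMap.ker (Dual.eval K H t)) ⟨hα, hαt⟩ ⟨hβ, hβt⟩ hli
    (i := (Sum.inl 0 : Fin (s + 2) ⊕ Fin (s + 2))) (j := Sum.inl 1) (by simp)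
    (by simpa [two_mul] using le_finrank_dualAnnihilator_inf hR t)
  obtain ⟨ψ, hψ⟩ := exists_biorthogonal hf
  have hfR : ∀ i, f i ∈ R.dualAnnihilator := fun i => (hfW i).1
  have hft : ∀ i, f i t = 0 := fun i => (hfW i).2
  -- With `f (inl 0) = α` and `f (inl 1) = β`, replacing `f (inr 0)` by its sum with `β` adds `α ∧
  -- β` to the form and keeps the rank `2 * s`. As both forms kill `t`, the constant `c t` cancels
  -- in the difference. The shear needs two pairs, hence `2 ≤ s`; `ψ'` is the dual family.
  set f' : Fin (s + 2) ⊕ Fin (s + 2) → Dual K H :=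
    fun k => f k + if k = Sum.inr 0 then f (Sum.inl 1) else 0 with hf'
  set ψ' : Fin (s + 2) ⊕ Fin (s + 2) → H :=
    fun k => ψ k - if k = Sum.inl 1 then ψ (Sum.inr 0) else 0 with hψ'
  have hfψ' : ∀ i j, f' i (ψ' j) = if i = j then 1 else 0 := by
    intro i j
    have h10 : (Sum.inl 1 : Fin (s + 2) ⊕ Fin (s + 2)) ≠ Sum.inr 0 := by simp
    by_cases hi : i = Sum.inr 0 <;> by_cases hj : j = Sum.inl 1
    · subst hi; subst hj
      simp [hf', hψ', hψ]
    · subst hi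
      simp [hf', hψ', hψ, hj, Ne.symm hj]
    · subst hj
      simp [hf', hψ', hψ, hi]
    · simp [hf', hψ', hψ, hi, hj]
  have hf'R : ∀ i, f' i ∈ R.dualAnnihilator := fun i => by
    refine Submodule.add_mem _ (hfR i) ?_
    split_ifs
    · exact hfR _
    · exact Submodule.zero_mem _
  have hf't : ∀ i, f' i t = 0 := fun i => by
    simp only [hf', LinearMap.add_apply, hft, zero_add]
    split_ifs
    · exact hft _
    · rfl
  have hzero : ∀ g : Fin (s + 2) ⊕ Fin (s + 2) → Dual K H, (∀ i, g i t = 0) →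
      (∑ i, wedge (g (Sum.inl i)) (g (Sum.inr i))) t = 0 := fun g hg => by
    rw [LinearMap.sum_apply]
    exact Finset.sum_eq_zero fun i _ => wedge_apply_eq_zero (hg _) (hg _)
  have h1 := hP _ (sum_wedge_mem_radicalForms hfR) (hasHyperbolic_sum_wedge f ψ hψ) t (hzero f hft)
  have h2 := hP _ (sum_wedge_mem_radicalForms hf'R) (hasHyperbolic_sum_wedge f' ψ' hfψ') t
    (hzero f' hf't)
  have h3 : ∑ i, wedge (f' (Sum.inl i)) (f' (Sum.inr i)) =
      ∑ i, wedge (f (Sum.inl i)) (f (Sum.inr i)) + wedge α β := by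
    have h4 : ∀ i, wedge (f' (Sum.inl i)) (f' (Sum.inr i)) =
        wedge (f (Sum.inl i)) (f (Sum.inr i)) + if i = 0 then wedge α β else 0 := by
      intro i
      by_cases hi : i = 0
      · subst hi
        simp [hf', hf0, hf1]
      · simp [hf', hi]
    rw [Finset.sum_congr rfl fun i _ => h4 i, Finset.sum_add_distrib, Finset.sum_ite_eq']
    simp
  rw [h3, map_add, LinearMap.add_apply] at h2
  linear_combination h2 - h1

/-- The substitute when `s = 1`: every nonzero multiple of `α ∧ β` has rank `2`. Two distinct
nonzero scalars separate `c t` from `Λ (α ∧ β) t`; only the field with two elements lacks them. -/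
theorem add_mul_apply_wedge_eq_zero [FiniteDimensional K H] {R : Submodule K H}
    {c : Dual K H} {Λ : LinearMap.BilinForm K H →ₗ[K] Dual K H}
    (hP : ∀ u ∈ radicalForms R, HasHyperbolic u ⊤ 1 → ∀ t, u t = 0 → c t + Λ u t = 0)
    {α β : Dual K H} (hα : α ∈ R.dualAnnihilator) (hβ : β ∈ R.dualAnnihilator)
    (hli : LinearIndependent K ![α, β]) {t : H} (hαt : α t = 0) (hβt : β t = 0) {k : K}
    (hk : k ≠ 0) : c t + k * Λ (wedge α β) t = 0 := by
  have hα0 : α ≠ 0 := hli.ne_zero 0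
  have hne : wedge α β ≠ 0 := by
    intro h0
    have : β ∈ LinearMap.ker (wedge α) := h0
    rw [ker_wedge hα0, Submodule.mem_span_singleton] at this
    obtain ⟨a, ha⟩ := this
    exact (LinearIndependent.pair_iff' hα0).1 hli a ha
  have h1 := hP (k • wedge α β) (Submodule.smul_mem _ _ (wedge_mem_radicalForms hα hβ))
    (hasHyperbolic_one ((isAlt_wedge α β).smul k) (smul_ne_zero hk hne)) t
    (by rw [LinearMap.smul_apply, wedge_apply_eq_zero hαt hβt, smul_zero])
  rwa [map_smul, LinearMap.smul_apply, smul_eq_mul] at h1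

/-- Some form of rank `2 * s` that kills `t` is a sum of products `α ∧ β` of forms killing `t`. The
map `Λ` contributes nothing there, so `c t` is left alone. -/
theorem constant_eq_zero_of_apply_wedge_eq_zero [FiniteDimensional K H] {R : Submodule K H} {s : ℕ}
    (hR : finrank K R + (2 * s + 1) = finrank K H) (c : Dual K H)
    (Λ : LinearMap.BilinForm K H →ₗ[K] Dual K H)
    (hP : ∀ u ∈ radicalForms R, HasHyperbolic u ⊤ s → ∀ t, u t = 0 → c t + Λ u t = 0)
    (hΛ : ∀ α ∈ R.dualAnnihilator, ∀ β ∈ R.dualAnnihilator, ∀ t, α t = 0 → β t = 0 →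
      Λ (wedge α β) t = 0) : c = 0 := by
  ext t
  set W := R.dualAnnihilator ⊓ LinearMap.ker (Dual.eval K H t) with hW
  obtain ⟨g⟩ := Function.Embedding.nonempty_of_card_le (α := Fin s ⊕ Fin s)
    (β := Fin (finrank K W)) (by simpa [two_mul] using le_finrank_dualAnnihilator_inf hR t)
  set f : Fin s ⊕ Fin s → Dual K H := fun i => (finBasis K W (g i) : Dual K H) with hf
  have hli : LinearIndependent K f :=
    ((finBasis K W).linearIndependent.comp g g.injective).map' W.subtype W.ker_subtype
  have hfW : ∀ i, f i ∈ W := fun i => (finBasis K W (g i)).2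
  obtain ⟨ψ, hψ⟩ := exists_biorthogonal hli
  have h1 := hP _ (sum_wedge_mem_radicalForms fun i => (hfW i).1) (hasHyperbolic_sum_wedge f ψ hψ) t
    (by
      rw [LinearMap.sum_apply]
      exact Finset.sum_eq_zero fun i _ => wedge_apply_eq_zero (hfW _).2 (hfW _).2)
  rw [map_sum, LinearMap.sum_apply, Finset.sum_eq_zero, add_zero] at h1
  · exact h1
  · intro i _
    exact hΛ _ (hfW _).1 _ (hfW _).1 t (hfW _).2 (hfW _).2

theorem exists_linearIndependent_mem {E : Type*} [AddCommGroup E] [Module K E]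
    [FiniteDimensional K E] {W : Submodule K E} {m : ℕ} (hW : finrank K W = m) :
    ∃ x : Fin m → E, LinearIndependent K x ∧ ∀ i, x i ∈ W :=
  ⟨fun i => (finBasisOfFinrankEq K W hW i : E),
    (finBasisOfFinrankEq K W hW).linearIndependent.map' W.subtype W.ker_subtype,
    fun i => (finBasisOfFinrankEq K W hW i).2⟩

/-- A linear map sending each `α ∧ β` to a combination of `α` and `β` is a contraction. -/
theorem exists_contraction [FiniteDimensional K H] {R : Submodule K H} {m : ℕ} (hm : 3 ≤ m)
    (hR : finrank K R + m = finrank K H) (Λ : LinearMap.BilinForm K H →ₗ[K] Dual K H)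
    (hΛ : ∀ α ∈ R.dualAnnihilator, ∀ β ∈ R.dualAnnihilator, ∀ t, α t = 0 → β t = 0 →
      Λ (wedge α β) t = 0) : ∃ h : H, ∀ u ∈ radicalForms R, Λ u = u h := by
  have hRm : finrank K R.dualAnnihilator = m := by
    have := Subspace.finrank_add_finrank_dualAnnihilator_eq R
    omega
  obtain ⟨x, hxli, hxR⟩ : ∃ x : Fin m → Dual K H, LinearIndependent K x ∧
      ∀ i, x i ∈ R.dualAnnihilator := exists_linearIndependent_mem hRm
  obtain ⟨h, hxh⟩ := exists_biorthogonal hxli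
  have hdec := sub_sum_mem_of_biorthogonal hR hxli hxR hxh
  have hval : ∀ i j, i ≠ j → ∀ k, k ≠ i → k ≠ j → Λ (wedge (x i) (x j)) (h k) = 0 := by
    intro i j _ k hki hkj
    exact hΛ _ (hxR i) _ (hxR j) _ (by rw [hxh, if_neg hki.symm]) (by rw [hxh, if_neg hkj.symm])
  -- The forms `x i` and `x j + x k` both vanish at `h j - h k`. This makes the coefficient of `x j`
  -- in `Λ (x i ∧ x j)` independent of `j`; it is the `i`-th coordinate of the contracting vector.
  have heq : ∀ i j k, i ≠ j → i ≠ k → j ≠ k →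
      Λ (wedge (x i) (x j)) (h j) = Λ (wedge (x i) (x k)) (h k) := by
    intro i j k hij hik hjk
    have h1 := hΛ _ (hxR i) _ (Submodule.add_mem _ (hxR j) (hxR k)) (h j - h k)
      (by simp [hxh, hij, hik]) (by simp [hxh, hjk, hjk.symm])
    rw [map_add, map_add, LinearMap.add_apply, map_sub, map_sub, hval i j hij k hik.symm hjk.symm,
      hval i k hik j hij.symm hjk] at h1
    linear_combination h1
  have hex : ∀ i : Fin m, ∃ j, j ≠ i := fun i => by
    have : Nontrivial (Fin m) := Fin.nontrivial_iff_two_le.2 (by omega)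
    exact exists_ne i
  choose j₀ hj₀ using hex
  set a : Fin m → K := fun i => Λ (wedge (x i) (x (j₀ i))) (h (j₀ i)) with ha
  have ha' : ∀ i j, i ≠ j → Λ (wedge (x i) (x j)) (h j) = a i := by
    intro i j hij
    by_cases hj : j = j₀ i
    · rw [hj]
    · exact heq i j (j₀ i) hij (hj₀ i).symm hj
  set k : H := ∑ i, a i • h i with hk
  have hxk : ∀ i, x i k = a i := by
    intro i
    simp [hk, hxh]
  have hw : ∀ i j, i ≠ j → Λ (wedge (x i) (x j)) = wedge (x i) (x j) k := by
    intro i j hij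
    ext t
    set t' := t - x i t • h i - x j t • h j with ht'
    have h1 : Λ (wedge (x i) (x j)) t' = 0 :=
      hΛ _ (hxR i) _ (hxR j) _ (by simp [ht', hxh, hij]) (by simp [ht', hxh, hij.symm])
    have h2 : Λ (wedge (x i) (x j)) (h i) = -a j := by
      rw [wedge_swap, map_neg, LinearMap.neg_apply, ha' j i hij.symm]
    rw [ht', map_sub, map_sub, map_smul, map_smul, h2, ha' i j hij, smul_eq_mul, smul_eq_mul] at h1
    rw [wedge_apply, hxk, hxk]
    linear_combination h1
  refine ⟨k, fun u hu => ?_⟩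
  rw [eq_sum_wedge_of_mem_radicalForms hxR hxh hdec hu, map_sum, LinearMap.sum_apply]
  refine Finset.sum_congr rfl fun p hp => ?_
  rw [map_smul, hw _ _ (Finset.mem_filter.1 hp).2.ne, LinearMap.smul_apply]

/-- Affine maps from forms to linear forms whose values on the forms of rank `2 * s` kill the
radical. -/
theorem exists_contraction_or_exceptional [FiniteDimensional K H] {R : Submodule K H} {s : ℕ}
    (hs : 1 ≤ s) (hR : finrank K R + (2 * s + 1) = finrank K H) (c : Dual K H)
    (Λ : LinearMap.BilinForm K H →ₗ[K] Dual K H)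
    (hP : ∀ u ∈ radicalForms R, HasHyperbolic u ⊤ s → ∀ t, u t = 0 → c t + Λ u t = 0) :
    (c = 0 ∧ ∃ h : H, ∀ u ∈ radicalForms R, Λ u = u h) ∨
      (s = 1 ∧ (∀ k : K, k = 0 ∨ k = 1) ∧ c ≠ 0) := by
  by_cases hexc : s = 1 ∧ (∀ k : K, k = 0 ∨ k = 1) ∧ c ≠ 0
  · exact Or.inr hexc
  left
  have hΛ : ∀ α ∈ R.dualAnnihilator, ∀ β ∈ R.dualAnnihilator, ∀ t, α t = 0 → β t = 0 →
      Λ (wedge α β) t = 0 := by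
    intro α hα β hβ t hαt hβt
    rcases Nat.lt_or_ge 1 s with hs2 | hs2
    · exact apply_wedge_eq_zero_of_two_le hs2 hR c Λ hP hα hβ hαt hβt
    obtain rfl : s = 1 := by omega
    by_cases hli : LinearIndependent K ![α, β]
    swap
    · rw [wedge_eq_zero_of_not_linearIndependent hli, map_zero, LinearMap.zero_apply]
    have h1 := add_mul_apply_wedge_eq_zero hP hα hβ hli hαt hβt one_ne_zero
    by_cases hc : c = 0
    · rw [hc] at h1
      simpa using h1
    · have hk : ∃ k : K, k ≠ 0 ∧ k ≠ 1 := by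
        by_contra hno
        push Not at hno
        exact hexc ⟨rfl, fun k => or_iff_not_imp_left.2 (hno k), hc⟩
      obtain ⟨k, hk0, hk1⟩ := hk
      have h2 := add_mul_apply_wedge_eq_zero hP hα hβ hli hαt hβt hk0
      have h3 : (k - 1) * Λ (wedge α β) t = 0 := by linear_combination h2 - h1
      exact (mul_eq_zero.1 h3).resolve_left (sub_ne_zero.2 hk1)
  exact ⟨constant_eq_zero_of_apply_wedge_eq_zero hR c Λ hP hΛ,
    exists_contraction (by omega) hR Λ hΛ⟩

end Biorthogonal

/-! ### The exceptional affine map, and ranks on a hyperplane -/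

section HyperplaneReduction

/-- Affine maps on the forms on a three-dimensional space over the field with two elements whose
values kill the radical. -/
theorem exists_basis_of_exceptional {K H : Type*} [Field K] [AddCommGroup H] [Module K H]
    [FiniteDimensional K H] (hH : finrank K H = 3) (hK : ∀ k : K, k = 0 ∨ k = 1) {c : Dual K H}
    (hc : c ≠ 0) (Λ : LinearMap.BilinForm K H →ₗ[K] Dual K H)
    (hP : ∀ u ∈ radicalForms (⊥ : Submodule K H), HasHyperbolic u ⊤ 1 → ∀ t, u t = 0 →
      c t + Λ u t = 0) :
    ∃ (h : Basis (Fin 3) K H) (k : H), ∀ u : LinearMap.BilinForm K H, u.IsAlt →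
      c (h 0) + Λ u (h 0) - u k (h 0) = 1 + u (h 1) (h 2) ∧
      c (h 1) + Λ u (h 1) - u k (h 1) = 0 ∧ c (h 2) + Λ u (h 2) - u k (h 2) = 0 := by
  have htwo : (1 : K) + 1 = 0 := by
    rcases hK (1 + 1) with h | h
    · exact h
    · exact absurd (add_eq_left.1 h) one_ne_zero
  have hself : ∀ a : K, a + a = 0 := fun a => by linear_combination a * htwo
  obtain ⟨y, -, hy⟩ := exists_mem_notMem_of_finrank_lt (A := (⊤ : Submodule K (Dual K H)))
    (B := Submodule.span K {c}) (by
      rw [finrank_span_singleton hc, finrank_top, Subspace.dual_finrank_eq, hH]; norm_num)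
  have hli : LinearIndependent K ![c, y] := by
    rw [LinearIndependent.pair_iff' hc]
    intro a ha
    exact hy (Submodule.mem_span_singleton.2 ⟨a, ha⟩)
  obtain ⟨e, l, -, -, -, -, hel, -⟩ := exists_basis_fin_of_linearIndependent_pair
    (n := 3) (by rw [Subspace.dual_finrank_eq, hH]) hli
  obtain ⟨h, hh⟩ := exists_basis_coord_eq (e.reindex (Equiv.swap l 0))
  have hc0 : h.coord 0 = c := by rw [hh, ← hel]; simp
  have hR : ∀ α : Dual K H, α ∈ (⊥ : Submodule K H).dualAnnihilator := fun α => by simp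
  have hxh : ∀ i j, h.coord i (h j) = if i = j then 1 else 0 := fun i j => by
    simp [Finsupp.single_apply, eq_comm]
  have hbasic : ∀ (α β : Dual K H) (a b : H), α a = 1 → β a = 0 → β b = 1 → ∀ t, α t = 0 → β t = 0 →
      c t + Λ (wedge α β) t = 0 := by
    intro α β a b h1 h2 h3 t h4 h5
    have hli' : LinearIndependent K ![α, β] := by
      rw [LinearIndependent.pair_iff]
      intro p q hpq
      have ha := congrArg (fun f : Dual K H => f a) hpq
      have hb := congrArg (fun f : Dual K H => f b) hpq
      simp only [LinearMap.add_apply, LinearMap.smul_apply, smul_eq_mul, h1, h2, h3, mul_one,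
        mul_zero, add_zero, LinearMap.zero_apply] at ha hb
      subst ha
      simpa using hb
    have := add_mul_apply_wedge_eq_zero hP (hR α) (hR β) hli' h4 h5 one_ne_zero
    rwa [one_mul] at this
  set x₀ := h.coord 0 with hx₀
  set x₁ := h.coord 1 with hx₁
  set x₂ := h.coord 2 with hx₂
  have c0 : c (h 0) = 1 := by rw [← hc0, hxh]; simp
  have c1 : c (h 1) = 0 := by rw [← hc0, hxh]; simp
  have c2 : c (h 2) = 0 := by rw [← hc0, hxh]; simp
  have x00 : x₀ (h 0) = 1 := by rw [hx₀, hxh]; simp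
  have x01 : x₀ (h 1) = 0 := by rw [hx₀, hxh]; simp
  have x02 : x₀ (h 2) = 0 := by rw [hx₀, hxh]; simp
  have x10 : x₁ (h 0) = 0 := by rw [hx₁, hxh]; simp
  have x11 : x₁ (h 1) = 1 := by rw [hx₁, hxh]; simp
  have x12 : x₁ (h 2) = 0 := by rw [hx₁, hxh]; simp
  have x20 : x₂ (h 0) = 0 := by rw [hx₂, hxh]; simp
  have x21 : x₂ (h 1) = 0 := by rw [hx₂, hxh]; simp
  have x22 : x₂ (h 2) = 1 := by rw [hx₂, hxh]; simp
  have e012 : Λ (wedge x₀ x₁) (h 2) = 0 := by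
    have := hbasic x₀ x₁ (h 0) (h 1) x00 x10 x11 (h 2) x02 x12
    rwa [c2, zero_add] at this
  have e021 : Λ (wedge x₀ x₂) (h 1) = 0 := by
    have := hbasic x₀ x₂ (h 0) (h 2) x00 x20 x22 (h 1) x01 x21
    rwa [c1, zero_add] at this
  have e120 : Λ (wedge x₁ x₂) (h 0) = 1 := by
    have := hbasic x₁ x₂ (h 1) (h 2) x11 x21 x22 (h 0) x10 x20
    rw [c0] at this
    linear_combination this - htwo
  -- Six entries of `Λ` are still unknown. Testing on `α ∧ (β + γ)` identifies them two by two, so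
  -- that only three parameters are left.
  have f0 : Λ (wedge x₀ x₂) (h 2) = Λ (wedge x₀ x₁) (h 1) := by
    have := hbasic x₀ (x₁ + x₂) (h 0) (h 1) x00 (by simp [x10, x20]) (by simp [x11, x21])
      (h 1 + h 2) (by simp [x01, x02]) (by simp [x11, x12, x21, x22, htwo])
    simp only [map_add, LinearMap.add_apply, c1, c2, e012, e021] at this
    linear_combination this - hself (Λ (wedge x₀ x₁) (h 1))
  have f1 : Λ (wedge x₁ x₂) (h 2) = Λ (wedge x₀ x₁) (h 0) := by
    have := hbasic x₁ (x₀ + x₂) (h 1) (h 0) x11 (by simp [x01, x21]) (by simp [x00, x20])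
      (h 0 + h 2) (by simp [x10, x12]) (by simp [x00, x02, x20, x22, htwo])
    rw [map_add (wedge x₁), wedge_swap x₁ x₀] at this
    simp only [map_add, LinearMap.add_apply, map_neg, LinearMap.neg_apply, c0, c2, e012, e120]
      at this
    linear_combination this - htwo
  have f2 : Λ (wedge x₁ x₂) (h 1) = Λ (wedge x₀ x₂) (h 0) := by
    have := hbasic x₂ (x₀ + x₁) (h 2) (h 0) x22 (by simp [x02, x12]) (by simp [x00, x10])
      (h 0 + h 1) (by simp [x20, x21]) (by simp [x00, x01, x10, x11, htwo])
    rw [map_add (wedge x₂), wedge_swap x₂ x₀, wedge_swap x₂ x₁] at this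
    simp only [map_add, LinearMap.add_apply, map_neg, LinearMap.neg_apply, c0, c1, e021, e120]
      at this
    linear_combination -this - hself (Λ (wedge x₀ x₂) (h 0))
  -- These three parameters are the coordinates of the contracting vector, as signs are invisible in
  -- characteristic two. Subtracting the contraction leaves the constant `1` and the entry `u (h 1)
  -- (h 2)`, both on `h 0`.
  refine ⟨h, Λ (wedge x₀ x₁) (h 1) • h 0 + Λ (wedge x₀ x₁) (h 0) • h 1 +
    Λ (wedge x₀ x₂) (h 0) • h 2, fun u hu => ?_⟩
  have hdec : ∀ t, t - ∑ i, h.coord i t • h i ∈ (⊥ : Submodule K H) := fun t => by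
    simp [h.sum_repr t]
  have hsum := eq_sum_wedge_of_mem_radicalForms (fun i => hR (h.coord i)) hxh hdec
    (u := u) ⟨hu, fun r hr b => by rw [(Submodule.mem_bot K).1 hr]; simp⟩
  have hfilter : (Finset.univ.filter (fun p : Fin 3 × Fin 3 => p.1 < p.2)) =
      {(0, 1), (0, 2), (1, 2)} := by decide
  rw [hfilter, Finset.sum_insert (by decide), Finset.sum_insert (by decide),
    Finset.sum_singleton] at hsum
  have hΛu : ∀ t, Λ u t = u (h 0) (h 1) * Λ (wedge x₀ x₁) t + (u (h 0) (h 2) * Λ (wedge x₀ x₂) t +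
      u (h 1) (h 2) * Λ (wedge x₁ x₂) t) := fun t => by
    conv_lhs => rw [hsum]
    simp
    rfl
  have u10 : u (h 1) (h 0) = u (h 0) (h 1) := by
    rw [hu.swap]; linear_combination -hself (u (h 0) (h 1))
  have u20 : u (h 2) (h 0) = u (h 0) (h 2) := by
    rw [hu.swap]; linear_combination -hself (u (h 0) (h 2))
  have u21 : u (h 2) (h 1) = u (h 1) (h 2) := by
    rw [hu.swap]; linear_combination -hself (u (h 1) (h 2))
  refine ⟨?_, ?_, ?_⟩
  · rw [hΛu, c0, e120]
    simp only [map_add, map_smul, LinearMap.add_apply, LinearMap.smul_apply, smul_eq_mul, hu (h 0),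
      u10, u20]
    ring
  · rw [hΛu, c1, e021, f2]
    simp only [map_add, map_smul, LinearMap.add_apply, LinearMap.smul_apply, smul_eq_mul, hu (h 1),
      u21]
    ring
  · rw [hΛu, c2, e012, f0, f1]
    simp only [map_add, map_smul, LinearMap.add_apply, LinearMap.smul_apply, smul_eq_mul, hu (h 2)]
    ring

variable {K D : Type*} [Field K] [AddCommGroup D] [Module K D]

/-- A form whose restriction to a hyperplane has rank `2 * s` and a radical vector on which some
other linear form is non-trivial has larger rank. -/
theorem hasHyperbolic_succ_of_restrictForm {B : LinearMap.BilinForm K D} (hB : B.IsAlt)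
    {H : Submodule K D} {s : ℕ} (h : HasHyperbolic (restrictForm H B) ⊤ s) {t : H}
    (ht : restrictForm H B t = 0) {e : D} (he : B e t ≠ 0) : HasHyperbolic B ⊤ (s + 1) := by
  obtain ⟨u, v, hu, hv, huu, hvv, huv⟩ := h.of_restrictForm
  -- The vector `e` is made orthogonal to the family; `t` already is, being orthogonal to all of
  -- `H`. For the same reason the correction keeps the value of `B e t`, and the two vectors form a
  -- new pair.
  obtain ⟨m, hm, hum, hvm⟩ := exists_add_orthogonal hB hu hv huu hvv huv e
  have ht' : ∀ a ∈ H, B t a = 0 := fun a ha =>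
    congrArg (fun f : Dual K H => f ⟨a, ha⟩) ht
  have ht'' : ∀ a ∈ H, B a t = 0 := fun a ha => by rw [hB.swap, ht' a ha, neg_zero]
  refine HasHyperbolic.succ_of_orthogonal (p := e + m) (q := t) hB (fun _ => Submodule.mem_top)
    (fun _ => Submodule.mem_top) huu hvv huv Submodule.mem_top Submodule.mem_top hum hvm
    (fun i => ht'' _ (hu i)) (fun i => ht'' _ (hv i)) ?_
  rw [map_add, LinearMap.add_apply, ht'' m hm, add_zero]
  exact he

theorem exists_smul_add_eq {x : Dual K D} {e : D} (he : x e = 1) (a : D) :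
    ∃ b : LinearMap.ker x, a = x a • e + b :=
  ⟨⟨a - x a • e, by simp [he]⟩, by simp⟩

/-- The isotropic value on the hyperplane is strictly below the one on the whole space, hence below
`2 * N`; only the value `(2 * s + 1) * (2 * s)` is left. For `s = 1` it equals `6`, which forces `n
= 4`. -/
theorem two_mul_finrank_radicalCase_numeric {n s N : ℕ} (hn : 2 * s + 2 ≤ n) (hs : 1 ≤ s)
    (hN : 2 * N = twiceBound n s) (h : 2 * N ≤ twiceBound (n - 1) s) :
    2 * N = twiceBound (n - 1) s ∧ 2 * N = (2 * s + 1) * (2 * s) ∧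
      2 * N ≠ s * (2 * (n - 1) - s - 1) ∧ (s = 1 → n = 4) := by
  obtain ⟨m, rfl⟩ := Nat.exists_eq_add_of_le hn
  have e1 : 2 * (2 * s + 2 + m) - s - 1 = 3 * s + 3 + 2 * m := by omega
  have e2 : 2 * (2 * s + 2 + m - 1) - s - 1 = 3 * s + 1 + 2 * m := by omega
  unfold twiceBound at *
  rw [e1] at hN
  rw [e2] at h ⊢
  have h1 : s * (3 * s + 3 + 2 * m) ≤ 2 * N := hN ▸ le_max_right _ _
  have h2 : s * (3 * s + 1 + 2 * m) < s * (3 * s + 3 + 2 * m) :=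
    Nat.mul_lt_mul_of_pos_left (by omega) (by omega)
  have h3 : (2 * s + 1) * (2 * s) ≤ 2 * N := hN ▸ le_max_left _ _
  have h4 : 2 * N ≤ (2 * s + 1) * (2 * s) := by
    rcases le_max_iff.1 h with h4 | h4
    · exact h4
    · omega
  refine ⟨le_antisymm h (max_le h3 (by omega)), le_antisymm h4 h3, by omega, ?_⟩
  rintro rfl
  omega

end HyperplaneReduction

/-! ### Classification when some slice is a line -/

section HyperplaneClassification

theorem finrank_sup_span_singleton_of_notMem {K D : Type*} [Field K] [AddCommGroup D] [Module K D]
    [FiniteDimensional K D] {R : Submodule K D} {a : D} (ha : a ∉ R) :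
    finrank K (R ⊔ Submodule.span K {a} : Submodule K D) = finrank K R + 1 := by
  have h1 := Submodule.finrank_sup_add_finrank_inf_eq R (Submodule.span K {a})
  have h2 : R ⊓ Submodule.span K {a} = ⊥ := by
    rw [← disjoint_iff]
    exact (Submodule.disjoint_span_singleton_of_notMem ha)
  have ha0 : a ≠ 0 := fun h => ha (h ▸ R.zero_mem)
  rw [h2, finrank_bot, finrank_span_singleton ha0] at h1
  omega

theorem apply_last_mem_exceptionalU {K D : Type*} [Field K] [AddCommGroup D] [Module K D]
    (hself : ∀ a : K, a + a = 0) {B : LinearMap.BilinForm K D} (hB : B.IsAlt)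
    (e : Basis (Fin 4) K D) (h0 : B (e 3) (e 0) = 1 + B (e 1) (e 2)) (h1 : B (e 3) (e 1) = 0)
    (h2 : B (e 3) (e 2) = 0) : LinearMap.BilinForm.toMatrix e B ∈ exceptionalU K := by
  have hsym : ∀ a b, B a b = B b a := fun a b => by
    rw [hB.swap]; linear_combination -hself (B b a)
  have h10 := hsym (e 1) (e 0)
  have h20 := hsym (e 2) (e 0)
  have h21 := hsym (e 2) (e 1)
  have h03 := hsym (e 0) (e 3)
  have h13 := hsym (e 1) (e 3)
  have h23 := hsym (e 2) (e 3)
  rw [h0, add_comm] at h03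
  rw [h1] at h13
  rw [h2] at h23
  rw [add_comm] at h0
  refine ⟨B (e 0) (e 1), B (e 0) (e 2), B (e 1) (e 2), ?_⟩
  ext i j
  rw [LinearMap.BilinForm.toMatrix_apply]
  fin_cases i <;> fin_cases j <;> simp [hB (e 0), hB (e 1), hB (e 2), hB (e 3), h0, h1, h2, h10, h20,
    h21, h03, h13, h23]

/-- No dimension is lost on `H = ker x`, so the restriction is extremal for `(n - 1, s)`, and
numerically only its radical case is possible. It remains to determine how the row of a form at a
vector `e` outside `H` depends on the restriction of that form. -/
theorem case_of_finrank_slice_eq_one.{u, v} {K : Type u} {D : Type v} [Field K]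
    [AddCommGroup D] [Module K D] [FiniteDimensional K D] {n s : ℕ} (hs : 1 ≤ s)
    (hn : 2 * s + 2 ≤ n) (hD : finrank K D = n) (ih : Classified.{u, v} K (n - 1) s)
    {B₀ : LinearMap.BilinForm K D} (hB₀ : B₀.IsAlt)
    {V : Submodule K (LinearMap.BilinForm K D)} (hV : ∀ v ∈ V, v.IsAlt)
    (h : ∀ v ∈ V, ¬ HasHyperbolic (B₀ + v) ⊤ (s + 1)) (hdim : 2 * finrank K V = twiceBound n s)
    {x : Dual K D} (hx : x ≠ 0) (hslice : finrank K (slice V x) = 1) :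
    RadicalCase s B₀ V ∨ ExceptionalCase s B₀ V := by
  obtain ⟨e, he⟩ := exists_apply_eq_one hx
  set H := LinearMap.ker x with hH
  have hHn : finrank K H = n - 1 := by
    have := finrank_ker_of_ne_zero hx
    rw [← hH, hD] at this
    omega
  have hfin := finrank_map_restrictForm_ker V hV hx
  rw [hslice, ← hH, Nat.add_right_cancel_iff] at hfin
  have hVH := isAlt_of_mem_map_restrictForm hV H
  have hno := not_hasHyperbolic_restrictForm (B₀ := B₀) (V := V) H (k := s + 1)
    (fun v hv hyp => h v hv (hyp.mono le_top))
  have hr : 2 * finrank K (V.map (restrictForm H)) ≤ twiceBound (n - 1) s :=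
    two_mul_finrank_le (by omega) (finBasisOfFinrankEq K H hHn) (restrictForm H B₀)
      (hB₀.restrictForm H) _ hVH hno
  rw [hfin] at hr
  obtain ⟨hN, hN', hNne, hn4⟩ := two_mul_finrank_radicalCase_numeric hn hs hdim hr
  obtain ⟨R, hR, hRB⟩ : ∃ R : Submodule K H, finrank K R + (2 * s + 1) = finrank K H ∧
      ∀ v ∈ V.map (restrictForm H), ∀ a ∈ R, ∀ b, (restrictForm H B₀ + v) a b = 0 := by
    rcases ih H hHn (restrictForm H B₀) (V.map (restrictForm H)) (hB₀.restrictForm H) hVH hno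
      (by rw [hfin]; exact hN) with hc | hc | hc
    · have h1 := hc.1
      rw [hfin, hHn] at h1
      exact absurd h1 hNne
    · exact hc.2
    · have h1 := hc.2.1
      have h2 := hn4 hc.1
      omega
  have hRB₀ : restrictForm H B₀ ∈ radicalForms R := ⟨hB₀.restrictForm H, fun r hr b => by
    simpa using hRB 0 (Submodule.zero_mem _) r hr b⟩
  -- Inclusion and equal dimensions: every form with radical containing `R` is a restriction.
  have hVR : V.map (restrictForm H) = radicalForms R := by
    refine Submodule.eq_of_le_of_finrank_le (fun v hv => ⟨hVH v hv, fun r hr b => ?_⟩) ?_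
    · have := hRB v hv r hr b
      rwa [LinearMap.add_apply, LinearMap.add_apply, hRB₀.2 r hr b, zero_add] at this
    · have h1 := two_mul_finrank_radicalForms_le hR
      have h2 : (2 * s + 1) * (2 * s + 1) - (2 * s + 1) = (2 * s + 1) * (2 * s) := by
        rw [Nat.sub_eq_iff_eq_add (by nlinarith)]; ring
      rw [hfin]
      omega
  -- The restricted translate is thus a linear space, and some form of `B₀ + V` is zero on `H`; its
  -- row at `e` is the constant `c`.
  obtain ⟨v₀, hv₀, hv₀B⟩ : ∃ v₀ ∈ V, restrictForm H (B₀ + v₀) = 0 := by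
    have : -restrictForm H B₀ ∈ V.map (restrictForm H) := by
      rw [hVR]; exact Submodule.neg_mem _ hRB₀
    obtain ⟨v₀, hv₀, h0⟩ := this
    exact ⟨v₀, hv₀, by rw [map_add, h0, add_neg_cancel]⟩
  have hinj : ∀ v ∈ V, restrictForm H v = 0 → v = 0 := by
    intro v hv hv0
    have h1 := finrank_slice V hV hx
    rw [hslice] at h1
    have h2 : (V ⊓ LinearMap.ker (restrictForm H)) = ⊥ :=
      Submodule.finrank_eq_zero.1 (by rw [← hH] at h1; omega)
    have h3 : v ∈ V ⊓ LinearMap.ker (restrictForm H) := ⟨hv, hv0⟩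
    rwa [h2, Submodule.mem_bot] at h3
  -- Recovers a form of `V` from its restriction. The values of `g` on other forms on `H` are
  -- arbitrary, but `Λ` is only used on restrictions.
  obtain ⟨g, hg⟩ := LinearMap.exists_leftInverse_of_injective ((restrictForm H).domRestrict V) (by
    rw [LinearMap.ker_eq_bot']
    intro v hv
    exact Subtype.ext (hinj v v.2 hv))
  have hgv : ∀ v ∈ V, (g (restrictForm H v) : LinearMap.BilinForm K D) = v := fun v hv =>
    congrArg Subtype.val (congrArg (fun F : V →ₗ[K] V => F ⟨v, hv⟩) hg)
  set Λ : LinearMap.BilinForm K H →ₗ[K] Dual K H :=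
    { toFun := fun u => ((g u : LinearMap.BilinForm K D) e).comp H.subtype
      map_add' := fun u v => by ext; simp
      map_smul' := fun a u => by ext; simp } with hΛ
  set c : Dual K H := ((B₀ + v₀) e).comp H.subtype with hc
  have hval : ∀ v ∈ V, ∀ t : H, (B₀ + v) e t = c t + Λ (restrictForm H (B₀ + v)) t := by
    intro v hv t
    have h1 : restrictForm H (B₀ + v) = restrictForm H (v - v₀) := by
      rw [← sub_eq_zero, ← map_sub, ← hv₀B]
      congr 1
      abel
    have h2 : (g (restrictForm H (v - v₀)) : LinearMap.BilinForm K D) = v - v₀ :=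
      hgv _ (Submodule.sub_mem _ hv hv₀)
    rw [h1]
    simp only [hc, hΛ, LinearMap.coe_mk, AddHom.coe_mk, LinearMap.comp_apply, h2,
      Submodule.subtype_apply, LinearMap.add_apply, LinearMap.sub_apply]
    ring
  have hRad : ∀ v ∈ V, restrictForm H (B₀ + v) ∈ radicalForms R := fun v hv => by
    rw [map_add]
    exact Submodule.add_mem _ hRB₀ (hVR ▸ ⟨v, hv, rfl⟩)
  have hlift : ∀ u ∈ radicalForms R, ∃ v ∈ V, restrictForm H (B₀ + v) = u := by
    intro u hu
    rw [← hVR] at hu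
    obtain ⟨v, hv, rfl⟩ := hu
    refine ⟨v₀ + v, Submodule.add_mem _ hv₀ hv, ?_⟩
    rw [← add_assoc, map_add, hv₀B, zero_add]
  have hP : ∀ u ∈ radicalForms R, HasHyperbolic u ⊤ s → ∀ t, u t = 0 → c t + Λ u t = 0 := by
    intro u hu hyp t ht
    obtain ⟨v, hv, rfl⟩ := hlift u hu
    rw [← hval v hv]
    by_contra hne
    exact h v hv (hasHyperbolic_succ_of_restrictForm (hB₀.add (hV v hv)) hyp ht hne)
  rcases exists_contraction_or_exceptional hs hR c Λ hP with ⟨hc0, k, hk⟩ | ⟨rfl, hK, hc0⟩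
  · left
    -- The rows at `e` and at `k` agree on `H`, so `e - k` is a common radical vector, outside `H`;
    -- with `R` it gives the required codimension.
    refine ⟨hN', R.map H.subtype ⊔ Submodule.span K {e - (k : D)}, ?_, ?_⟩
    · rw [finrank_sup_span_singleton_of_notMem,
        LinearEquiv.finrank_eq (Submodule.equivMapOfInjective _ H.injective_subtype R).symm]
      · omega
      · rintro ⟨r, -, hr⟩
        have h1 : x (e - k) = 0 := by rw [← hr]; exact r.2
        have h2 : x k = 0 := k.2
        rw [map_sub, he, h2, sub_zero] at h1
        exact one_ne_zero h1
    · intro v hv a ha b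
      have hB := hB₀.add (hV v hv)
      have hu := hRad v hv
      have hBe : ∀ t : H, (B₀ + v) e t = (B₀ + v) k t := fun t => by
        rw [hval v hv, hc0, hk _ hu]
        simp
      have hle : R.map H.subtype ⊔ Submodule.span K {e - (k : D)} ≤ LinearMap.ker (B₀ + v) := by
        refine sup_le ?_ ?_
        · rintro _ ⟨r, hr, rfl⟩
          have hrt : ∀ t : H, (B₀ + v) r t = 0 := fun t => hu.2 r hr t
          rw [LinearMap.mem_ker]
          ext b
          obtain ⟨t, ht⟩ := exists_smul_add_eq he b
          rw [ht]
          generalize x b = r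
          rw [Submodule.subtype_apply, map_add, map_smul, hrt, hB.swap, hBe, hB.swap (k : D), hrt]
          simp
        · rw [Submodule.span_singleton_le_iff_mem, LinearMap.mem_ker]
          ext b
          obtain ⟨t, ht⟩ := exists_smul_add_eq he b
          rw [ht]
          generalize x b = r
          rw [map_add, map_smul, map_sub, LinearMap.sub_apply, LinearMap.sub_apply, hBe, hB e,
            hB.swap k e, hBe, hB (k : D)]
          simp
      rw [LinearMap.mem_ker.1 (hle ha), LinearMap.zero_apply]
  · right
    have hn' : n = 4 := hn4 rfl
    have hH3 : finrank K H = 3 := by omega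
    have hRbot : R = ⊥ := Submodule.finrank_eq_zero.1 (by omega)
    subst hRbot
    obtain ⟨b, k, hbk⟩ := exists_basis_of_exceptional hH3 hK hc0 Λ hP
    have hself : ∀ a : K, a + a = 0 := by
      have htwo : (1 : K) + 1 = 0 := by
        rcases hK (1 + 1) with h' | h'
        · exact h'
        · exact absurd (add_eq_left.1 h') one_ne_zero
      exact fun a => by linear_combination a * htwo
    have hxk : x (e - k) = 1 := by
      have h2 : x k = 0 := k.2
      rw [map_sub, he, h2, sub_zero]
    have hli : ∀ (a : K), ∀ y ∈ H, a • (e - (k : D)) + y = 0 → a = 0 := by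
      intro a y hy h0
      have h1 := congrArg x h0
      have hy' : x y = 0 := hy
      simpa [hy', hxk] using h1
    have hsp : ∀ z : D, ∃ a : K, z + a • (e - (k : D)) ∈ H := by
      intro z
      refine ⟨-x z, ?_⟩
      change x (z + -x z • (e - (k : D))) = 0
      rw [map_add, map_smul, hxk]
      simp
    -- Replacing `e` by `e - k` removes the contraction, so the last row is `(1 + u (b 1) (b 2), 0,
    -- 0)` on the basis `b` of `H`: the shape of `exceptionalU`.
    set E : Basis (Fin 4) K D := Basis.mkFinSnoc b (e - (k : D)) hli hsp with hE
    have hEc : ∀ i : Fin 3, E i.castSucc = b i := fun i => by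
      rw [hE, Basis.coe_mkFinSnoc, Fin.snoc_castSucc]
      rfl
    have hE0 : E 0 = b 0 := hEc 0
    have hE1 : E 1 = b 1 := hEc 1
    have hE2 : E 2 = b 2 := hEc 2
    have hE3 : E 3 = e - (k : D) := by
      change E (Fin.last 3) = _
      rw [hE, Basis.coe_mkFinSnoc, Fin.snoc_last]
    refine ⟨rfl, by omega, ?_, by omega, E, fun v hv => ?_⟩
    · rw [Nat.card_eq_two_iff]
      refine ⟨0, 1, zero_ne_one, Set.eq_univ_of_forall fun a => ?_⟩
      simpa using hK a
    · obtain ⟨h0, h1, h2⟩ := hbk _ ((hB₀.add (hV v hv)).restrictForm H)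
      simp only [← hval v hv, restrictForm_apply] at h0 h1 h2
      refine apply_last_mem_exceptionalU hself (hB₀.add (hV v hv)) E ?_ ?_ ?_ <;>
        simp only [hE0, hE1, hE2, hE3, map_sub, LinearMap.sub_apply]
      exacts [h0, h1, h2]

end HyperplaneClassification

/-! ### The two last vertices of the graph, and spaces whose slices are all moderate -/

section LeadingFlag

variable {K D : Type*} [Field K] [AddCommGroup D] [Module K D]

theorem wedge_coord_apply {ι : Type*} [DecidableEq ι] (d : Basis ι K D) (l m p q : ι) :
    wedge (d.coord l) (d.coord m) (d p) (d q) =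
      (if p = l ∧ q = m then 1 else 0) - (if p = m ∧ q = l then 1 else 0) := by
  simp only [wedge_apply, Basis.coord_apply, Basis.repr_self, Finsupp.single_apply, ite_and]
  split_ifs <;> simp

/-- The two last vertices of the graph of leading positions are adjacent if and only if the exterior
product of the two corresponding coordinate forms belongs to the space. -/
theorem leadGraph_adj_last_iff {n : ℕ} (d : Basis (Fin n) K D)
    (V : Submodule K (LinearMap.BilinForm K D)) (hV : ∀ v ∈ V, v.IsAlt) {l m : Fin n}
    (hl : ∀ i, i ≤ l) (hm : ∀ i, i ≠ l → i ≤ m) (hml : m ≠ l) :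
    (leadGraph d V hV).Adj m l ↔ d.coord m ∈ slice V (d.coord l) := by
  classical
  constructor
  · rintro ⟨-, v, hv, hne, hlt⟩
    -- The position `(m, l)` is the last of all, so a form led there has no other nonzero entry up
    -- to symmetry.
    have h0 : v - v (d l) (d m) • wedge (d.coord l) (d.coord m) = 0 := by
      refine ext_of_isAlt_of_lt d ((hV v hv).sub ((isAlt_wedge _ _).smul _)) fun p q hpq => ?_
      have hpl : p ≠ l := fun h => by rw [h] at hpq; exact absurd (hl q) (not_le.2 hpq)
      rw [LinearMap.sub_apply, LinearMap.sub_apply, LinearMap.smul_apply, LinearMap.smul_apply,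
        wedge_coord_apply, smul_eq_mul]
      by_cases hpm : p = m ∧ q = l
      · rw [hpm.1, hpm.2, (hV v hv).swap]
        simp [hml]
      · have hz : v (d p) (d q) = 0 := by
          refine hlt p q hpq.ne ?_
          by_cases hql : q = l
          · have hpm' : p < m := lt_of_le_of_ne (hm p hpl) fun h => hpm ⟨h, hql⟩
            have : 2 ^ (p : ℕ) < 2 ^ (m : ℕ) := Nat.pow_lt_pow_right (by norm_num) hpm'
            rw [hql]
            omega
          · have h1 := two_pow_add_two_pow_lt (p := p) (q := q) (b := l)
              (fun h => hpq.ne (Fin.ext h)) (lt_of_le_of_ne (hl p) fun h => hpl (Fin.ext h))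
              (lt_of_le_of_ne (hl q) fun h => hql (Fin.ext h))
            have h2 : 0 < 2 ^ (m : ℕ) := by positivity
            omega
        simp [hz, hpm, hpl]
    rw [mem_slice]
    have hne' : v (d l) (d m) ≠ 0 := fun h => hne (by rw [(hV v hv).swap, h, neg_zero])
    rw [sub_eq_zero] at h0
    rw [← V.smul_mem_iff hne', ← h0]
    exact hv
  · intro h
    refine ⟨hml, _, h, ?_, fun p q hpq hlt => ?_⟩
    · rw [wedge_coord_apply]
      simp [hml]
    · rw [wedge_coord_apply, if_neg, if_neg, sub_zero]
      · rintro ⟨rfl, rfl⟩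
        exact lt_irrefl _ hlt
      · rintro ⟨rfl, rfl⟩
        rw [add_comm] at hlt
        exact lt_irrefl _ hlt

theorem exists_leadGraph_adj_of_ne_zero {n : ℕ} (d : Basis (Fin n) K D)
    (V : Submodule K (LinearMap.BilinForm K D)) (hV : ∀ v ∈ V, v.IsAlt)
    {v : LinearMap.BilinForm K D} (hv : v ∈ V) (h0 : v ≠ 0) :
    ∃ p q, v (d p) (d q) ≠ 0 ∧ (leadGraph d V hV).Adj p q := by
  classical
  have hne : (Finset.univ.filter
      (fun p : Fin n × Fin n => p.1 < p.2 ∧ v (d p.1) (d p.2) ≠ 0)).Nonempty := by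
    by_contra hno
    rw [Finset.not_nonempty_iff_eq_empty, Finset.filter_eq_empty_iff] at hno
    refine h0 (ext_of_isAlt_of_lt d (hV v hv) fun p q hpq => ?_)
    by_contra hpq'
    exact hno (Finset.mem_univ (p, q)) ⟨hpq, hpq'⟩
  obtain ⟨⟨p, q⟩, hpq, hmin⟩ := Finset.exists_min_image _
    (fun p : Fin n × Fin n => 2 ^ (p.1 : ℕ) + 2 ^ (p.2 : ℕ)) hne
  obtain ⟨-, hlt, hvpq⟩ := Finset.mem_filter.1 hpq
  refine ⟨p, q, hvpq, hlt.ne, v, hv, hvpq, fun p' q' hne' hw => ?_⟩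
  by_contra hnz
  rcases lt_or_gt_of_ne hne' with h | h
  · exact absurd (hmin (p', q') (Finset.mem_filter.2 ⟨Finset.mem_univ _, h, hnz⟩)) (not_le.2 hw)
  · refine absurd (hmin (q', p') (Finset.mem_filter.2 ⟨Finset.mem_univ _, h, fun hz => hnz ?_⟩))
      (not_le.2 (by rwa [add_comm] at hw))
    rw [(hV v hv).swap, hz, neg_zero]

theorem linearIndependent_pair_of_notMem {x y : D} (hx : x ≠ 0)
    (hy : y ∉ Submodule.span K {x}) : LinearIndependent K ![x, y] := by
  rw [LinearIndependent.pair_iff' hx]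
  intro a ha
  exact hy (Submodule.mem_span_singleton.2 ⟨a, ha⟩)

theorem exists_basis_of_coord_pair [FiniteDimensional K D] {n : ℕ} (hD : finrank K D = n) {x y : Dual K D}
    (h : LinearIndependent K ![x, y]) : ∃ (d : Basis (Fin n) K D) (l m : Fin n), (∀ i, i ≤ l) ∧
      (∀ i, i ≠ l → i ≤ m) ∧ m ≠ l ∧ d.coord l = x ∧ d.coord m = y := by
  obtain ⟨e, l, m, hl, hm, hml, hx, hy⟩ := exists_basis_fin_of_linearIndependent_pair
    (by rw [Subspace.dual_finrank_eq, hD]) h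
  obtain ⟨d, hd⟩ := exists_basis_coord_eq e
  exact ⟨d, l, m, hl, hm, hml, by rw [hd, hx], by rw [hd, hy]⟩

section Extremal

variable {n s : ℕ} (hn : 2 * s + 2 ≤ n) (hD : finrank K D = n)
  {B₀ : LinearMap.BilinForm K D} (hB₀ : B₀.IsAlt) {V : Submodule K (LinearMap.BilinForm K D)}
  (hV : ∀ v ∈ V, v.IsAlt) (h : ∀ v ∈ V, ¬ HasHyperbolic (B₀ + v) ⊤ (s + 1))
  (hdim : 2 * finrank K V = twiceBound n s)
  (hlow : ∀ x : Dual K D, x ≠ 0 → 2 ≤ finrank K (slice V x))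
  (hupp : ∀ x : Dual K D, x ≠ 0 → finrank K (slice V x) ≤ 2 * s + 1)

include hn hB₀ h hdim in
theorem leadGraph_dichotomy (d : Basis (Fin n) K D) :
    (∃ C : Finset (Fin n), C.card = 2 * s + 1 ∧
      ∀ v w, v ≠ w → ((leadGraph d V hV).Adj v w ↔ v ∈ C ∧ w ∈ C)) ∨
    (∃ U : Finset (Fin n), U.card = s ∧ 2 * finrank K V = s * (2 * n - s - 1) ∧
      ∀ v w, v ≠ w → ((leadGraph d V hV).Adj v w ↔ v ∈ U ∨ w ∈ U)) := by
  classical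
  have hcard : 2 * finrank K V =
      (Finset.univ.filter fun p : Fin n × Fin n => (leadGraph d V hV).Adj p.1 p.2).card := by
    rw [finrank_eq_card_leadGraph d V hV, ← card_filter_lt_of_symm]
  have h1 := ((leadGraph d V hV).erdos_gallai s (by simpa using hn)
    (leadGraph_no_matching d B₀ hB₀ V hV (s + 1) h)).2
  rw [Fintype.card_fin] at h1
  rcases h1 (by rw [← twiceBound, ← hdim, hcard]) with hC | ⟨U, hU, hr, hadj⟩
  · exact Or.inl hC
  · exact Or.inr ⟨U, hU, hcard.trans hr, hadj⟩

include hn hB₀ h hdim hlow hupp in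
-- The bounds on slices locate the last vertex `l`: outside the clique it would have degree `0`, and
-- inside `U` it would have degree `n - 1`, which exceeds `2 * s`.
theorem leadGraph_dichotomy_of_finrank_slice [FiniteDimensional K D] (d : Basis (Fin n) K D) {l : Fin n}
    (hl : ∀ i, i ≤ l) :
    (finrank K (slice V (d.coord l)) = 2 * s + 1 ∧ ∃ C : Finset (Fin n), l ∈ C ∧
      ∀ v w, v ≠ w → ((leadGraph d V hV).Adj v w ↔ v ∈ C ∧ w ∈ C)) ∨
    (finrank K (slice V (d.coord l)) = s + 1 ∧ 2 * finrank K V = s * (2 * n - s - 1) ∧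
      ∃ U : Finset (Fin n), U.card = s ∧ l ∉ U ∧
      ∀ v w, v ≠ w → ((leadGraph d V hV).Adj v w ↔ v ∈ U ∨ w ∈ U)) := by
  classical
  have hx : d.coord l ≠ 0 := fun h => by
    have := congrArg (fun f : Dual K D => f (d l)) h
    simp at this
  have hdeg := finrank_slice_eq_degree d V hV l hl
  have h2 := hlow _ hx
  have h3 := hupp _ hx
  rcases leadGraph_dichotomy hn hB₀ hV h hdim d with ⟨C, hC, hadj⟩ | ⟨U, hU, hr, hadj⟩
  · left
    have hlC : l ∈ C := by
      by_contra hlC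
      rw [Finset.filter_false_of_mem, Finset.card_empty] at hdeg
      · omega
      · intro p _ hp
        exact hlC ((hadj p l hp.ne).1 hp).2
    refine ⟨?_, C, hlC, hadj⟩
    rw [hdeg, show (Finset.univ.filter fun p => (leadGraph d V hV).Adj p l) = C.erase l from ?_,
      Finset.card_erase_of_mem hlC, hC]
    · omega
    · ext p
      rw [Finset.mem_filter, Finset.mem_erase]
      constructor
      · rintro ⟨-, hp⟩
        exact ⟨hp.ne, ((hadj p l hp.ne).1 hp).1⟩
      · rintro ⟨hpl, hp⟩
        exact ⟨Finset.mem_univ _, (hadj p l hpl).2 ⟨hp, hlC⟩⟩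
  · right
    have hlU : l ∉ U := by
      intro hlU
      rw [show (Finset.univ.filter fun p => (leadGraph d V hV).Adj p l) =
        Finset.univ.erase l from ?_, Finset.card_erase_of_mem (Finset.mem_univ _),
        Finset.card_univ, Fintype.card_fin] at hdeg
      · omega
      · ext p
        rw [Finset.mem_filter, Finset.mem_erase]
        constructor
        · rintro ⟨-, hp⟩
          exact ⟨hp.ne, Finset.mem_univ _⟩
        · rintro ⟨hpl, -⟩
          exact ⟨Finset.mem_univ _, (hadj p l hpl).2 (Or.inr hlU)⟩
    refine ⟨?_, hr, U, hU, hlU, hadj⟩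
    rw [hdeg, show (Finset.univ.filter fun p => (leadGraph d V hV).Adj p l) = U from ?_, hU]
    ext p
    rw [Finset.mem_filter]
    constructor
    · rintro ⟨-, hp⟩
      exact ((hadj p l hp.ne).1 hp).resolve_right hlU
    · intro hp
      have hpl : p ≠ l := fun h => hlU (h ▸ hp)
      exact ⟨Finset.mem_univ _, (hadj p l hpl).2 (Or.inl hp)⟩

include hn hD hB₀ hV h hdim hlow hupp in
-- In the clique case take the last two coordinates `x` and `y` with `y` outside the slice of `x`,
-- so that the vertex `m` of `y` is outside the clique. A nonzero `y ∧ z` in `V` has a nonzero entry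
-- at some edge of the clique; but the entries of `y ∧ z` away from the index `m` all vanish.
theorem finrank_slice_eq_succ [FiniteDimensional K D] {x : Dual K D} (hx : x ≠ 0) :
    finrank K (slice V x) = s + 1 := by
  obtain ⟨y, -, hy⟩ := exists_mem_notMem_of_finrank_lt (A := (⊤ : Submodule K (Dual K D)))
    (B := slice V x) (by
      have := hupp x hx
      rw [finrank_top, Subspace.dual_finrank_eq]
      omega)
  have hyx : y ∉ Submodule.span K {x} := fun hmem => hy
    ((Submodule.span_singleton_le_iff_mem _ _).2 (self_mem_slice V x) hmem)
  obtain ⟨d, l, m, hl, hm, hml, rfl, rfl⟩ :=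
    exists_basis_of_coord_pair hD (linearIndependent_pair_of_notMem hx hyx)
  rcases leadGraph_dichotomy_of_finrank_slice hn hB₀ hV h hdim hlow hupp d hl with
    ⟨-, C, hlC, hadj⟩ | ⟨hr, -⟩
  swap
  · exact hr
  exfalso
  have hmC : m ∉ C := fun hmC => hy
    ((leadGraph_adj_last_iff d V hV hl hm hml).1 ((hadj m l hml).2 ⟨hmC, hlC⟩))
  have hy0 : d.coord m ≠ 0 := fun h0 => hyx (h0 ▸ Submodule.zero_mem _)
  obtain ⟨z, hz, hzy⟩ := exists_mem_notMem_of_finrank_lt (A := slice V (d.coord m))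
    (B := Submodule.span K {d.coord m}) (by
      rw [finrank_span_singleton hy0]
      exact hlow _ hy0)
  rw [← ker_wedge hy0] at hzy
  obtain ⟨p, q, hpq, hpq'⟩ := exists_leadGraph_adj_of_ne_zero d V hV hz hzy
  obtain ⟨hp, hq⟩ := (hadj p q hpq'.ne).1 hpq'
  refine hpq ?_
  have hpm : p ≠ m := fun h => hmC (h ▸ hp)
  have hqm : q ≠ m := fun h => hmC (h ▸ hq)
  simp [wedge_apply, hpm, hqm]

end Extremal

end LeadingFlag

/-! ### Restriction to the intersection of two hyperplanes -/

section Uniform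

theorem uniform_numeric {n s r N e : ℕ} (hs : 1 ≤ s) (hn : 2 * s + 2 ≤ n)
    (hN : 2 * N = twiceBound n s) (hN' : 2 * N = s * (2 * n - s - 1))
    (hr : 2 * r ≤ twiceBound (n - 2) (s - 1)) (hNr : r + e = N) (he : e ≤ n - 2 + s) :
    2 * r = twiceBound (n - 2) (s - 1) ∧ 5 * s + 3 ≤ 2 * n ∧
      (2 * r = (2 * (s - 1) + 1) * (2 * (s - 1)) → s = 1) := by
  obtain ⟨s, rfl⟩ := Nat.exists_eq_add_of_le' hs
  obtain ⟨m, rfl⟩ := Nat.exists_eq_add_of_le hn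
  simp only [Nat.add_sub_cancel] at *
  have e1 : 2 * (2 * (s + 1) + 2 + m) - (s + 1) - 1 = 3 * s + 6 + 2 * m := by omega
  have e2 : 2 * (2 * (s + 1) + 2 + m - 2) - s - 1 = 3 * s + 3 + 2 * m := by omega
  have e3 : 2 * (s + 1) + 2 + m - 2 = 2 * s + 2 + m := by omega
  unfold twiceBound at *
  rw [e1] at hN hN'
  rw [e2] at hr ⊢
  rw [e3] at he
  have h1 : (2 * (s + 1) + 1) * (2 * (s + 1)) ≤ 2 * N := hN ▸ le_max_left _ _
  have h2' : s + 1 ≤ 2 * m + 1 + 1 := by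
    rw [hN'] at h1
    nlinarith
  have h3 : s * (3 * s + 3 + 2 * m) ≤ 2 * r := by nlinarith
  have h4 : (2 * s + 1) * (2 * s) ≤ s * (3 * s + 3 + 2 * m) := by nlinarith
  rw [max_eq_right h4] at hr ⊢
  refine ⟨le_antisymm hr h3, by nlinarith, fun h5 => ?_⟩
  by_contra h0
  obtain ⟨t, rfl⟩ := Nat.exists_eq_add_of_le' (Nat.one_le_iff_ne_zero.2 (show s ≠ 0 by omega))
  nlinarith

theorem finrank_ker_inf_ker {K D : Type*} [Field K] [AddCommGroup D] [Module K D]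
    [FiniteDimensional K D] {x y : Dual K D} (h : LinearIndependent K ![x, y]) :
    finrank K (LinearMap.ker x ⊓ LinearMap.ker y : Submodule K D) + 2 = finrank K D := by
  have hx : x ≠ 0 := h.ne_zero 0
  have h1 := finrank_ker_of_ne_zero hx
  have h2 := finrank_map_add_finrank_inf_ker y (LinearMap.ker x)
  have h3 : (LinearMap.ker x).map y = ⊤ := by
    obtain ⟨ψ, hψ⟩ := exists_biorthogonal h
    rw [eq_top_iff]
    intro c _
    refine ⟨c • ψ 1, ?_, ?_⟩
    · have := hψ 0 1
      simp at this
      simp [this]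
    · have := hψ 1 1
      simp at this
      simp [this]
  rw [h3, finrank_top, finrank_self] at h2
  omega

/-- For `x ∧ y` in `V`, the rank on `Q = ker x ⊓ ker y` is at most `2 * (s - 1)`. The loss of
dimension is small enough for the restriction to be extremal for `(n - 2, s - 1)`, and its isotropic
subspace, of codimension `s - 1` in `Q`, has codimension `s + 1` in `D`. -/
theorem exists_isotropic_of_uniform.{u, v} {K : Type u} {D : Type v} [Field K]
    [AddCommGroup D] [Module K D] [FiniteDimensional K D] {n s : ℕ} (hs : 1 ≤ s)
    (hn : 2 * s + 2 ≤ n) (hD : finrank K D = n) (ih : Classified.{u, v} K (n - 2) (s - 1))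
    {B₀ : LinearMap.BilinForm K D} (hB₀ : B₀.IsAlt)
    {V : Submodule K (LinearMap.BilinForm K D)} (hV : ∀ v ∈ V, v.IsAlt)
    (h : ∀ v ∈ V, ¬ HasHyperbolic (B₀ + v) ⊤ (s + 1)) (hdim : 2 * finrank K V = twiceBound n s)
    (hlow : ∀ x : Dual K D, x ≠ 0 → 2 ≤ finrank K (slice V x))
    (hupp : ∀ x : Dual K D, x ≠ 0 → finrank K (slice V x) ≤ 2 * s + 1) :
    5 * s + 3 ≤ 2 * n ∧ ∃ L : Submodule K D, finrank K L + (s + 1) = n ∧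
      ∀ v ∈ V, ∀ a ∈ L, ∀ b ∈ L, (B₀ + v) a b = 0 := by
  classical
  obtain ⟨x, -, hx⟩ := exists_mem_notMem_of_finrank_lt (A := (⊤ : Submodule K (Dual K D)))
    (B := ⊥) (by
      rw [finrank_top, Subspace.dual_finrank_eq, finrank_bot]
      omega)
  rw [Submodule.mem_bot] at hx
  obtain ⟨y, hyV, hyx⟩ := exists_mem_notMem_of_finrank_lt (A := slice V x)
    (B := Submodule.span K {x}) (by
      rw [finrank_span_singleton hx]
      exact hlow _ hx)
  have hli := linearIndependent_pair_of_notMem hx hyx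
  set Q := LinearMap.ker x ⊓ LinearMap.ker y with hQ
  have hQn : finrank K Q + 2 = n := by rw [hQ, finrank_ker_inf_ker hli, hD]
  have hno : ∀ v ∈ V, ¬ HasHyperbolic (B₀ + v) Q s := fun v hv hyp => by
    obtain ⟨v', hv', hyp'⟩ := exists_hasHyperbolic_succ_of_wedge_mem hB₀ hV hyV
      (fun h0 => hyx (by rwa [← ker_wedge hx])) hv hyp
    exact h v' hv' hyp'
  have hno' := not_hasHyperbolic_restrictForm Q hno
  have hVQ := isAlt_of_mem_map_restrictForm hV Q
  have hr : 2 * finrank K (V.map (restrictForm Q)) ≤ twiceBound (n - 2) (s - 1) :=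
    two_mul_finrank_le (by omega) (finBasisOfFinrankEq K Q (by omega)) (restrictForm Q B₀)
      (hB₀.restrictForm Q) _ hVQ (by rwa [Nat.sub_add_cancel hs])
  have hsum := finrank_map_add_finrank_inf_ker (restrictForm Q) V
  have hN : 2 * finrank K V = s * (2 * n - s - 1) ∧
      finrank K (V ⊓ LinearMap.ker (restrictForm Q) :
        Submodule K (LinearMap.BilinForm K D)) ≤ n - 2 + s := by
    obtain ⟨d, l, m, hl, hm, hml, hdx, hdy⟩ := exists_basis_of_coord_pair hD hli
    have hxs := finrank_slice_eq_succ hn hD hB₀ hV h hdim hlow hupp hx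
    rcases leadGraph_dichotomy_of_finrank_slice hn hB₀ hV h hdim hlow hupp d hl with
      ⟨hr, -⟩ | ⟨-, hr, U, hU, hlU, hadj⟩
    · rw [hdx] at hr
      omega
    refine ⟨hr, ?_⟩
    have hmU : m ∈ U := ((hadj m l hml).1 ((leadGraph_adj_last_iff d V hV hl hm hml).2
      (by rwa [hdx, hdy]))).resolve_right hlU
    rw [finrank_eq_card_leadGraph d (V ⊓ LinearMap.ker (restrictForm Q)) (fun v hv => hV v hv.1)]
    -- Forms vanishing on `Q` are led at positions that involve `m` or `l`. Those involving `l` have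
    -- their other end in `U`, since `l ∉ U`; this gives the count `(n - 2) + s`.
    have hsub : (Finset.univ.filter (fun p : Fin n × Fin n => p.1 < p.2 ∧
        (leadGraph d (V ⊓ LinearMap.ker (restrictForm Q)) (fun v hv => hV v hv.1)).Adj p.1 p.2)) ⊆
        (((Finset.univ.erase l).erase m).image fun p => (p, m)) ∪ U.image fun p => (p, l) := by
      rintro ⟨p, q⟩ hpq
      obtain ⟨-, hlt, hadj'⟩ := Finset.mem_filter.1 hpq
      have hadjV := (hadj p q hlt.ne).1 (leadGraph_mono d hV inf_le_left hadj')
      have hpl : p ≠ l := fun h => by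
        dsimp only at hlt
        rw [h] at hlt
        exact absurd (hl q) (not_le.2 hlt)
      rw [Finset.mem_union, Finset.mem_image, Finset.mem_image]
      by_cases hql : q = l
      · subst hql
        exact Or.inr ⟨p, hadjV.resolve_right hlU, rfl⟩
      have hpm : p ≠ m := fun h => by
        dsimp only at hlt
        rw [h] at hlt
        exact absurd (hm q hql) (not_le.2 hlt)
      have hqm : q = m := by
        by_contra hqm
        obtain ⟨-, v, ⟨-, hv⟩, hne, -⟩ := hadj'
        have hmem : ∀ i, i ≠ l → i ≠ m → d i ∈ Q := fun i h1 h2 => by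
          refine ⟨?_, ?_⟩
          · rw [← hdx]; exact apply_basis_mem_ker_coord d h1
          · rw [← hdy]; exact apply_basis_mem_ker_coord d h2
        exact hne ((restrictForm_eq_zero_iff Q v).1 hv _ (hmem p hpl hpm) _ (hmem q hql hqm))
      subst hqm
      exact Or.inl ⟨p, by simp [hpm, hpl], rfl⟩
    refine (Finset.card_le_card hsub).trans ((Finset.card_union_le _ _).trans
      (Nat.add_le_add (Finset.card_image_le.trans ?_) (Finset.card_image_le.trans hU.le)))
    rw [Finset.card_erase_of_mem (by simp [hml]), Finset.card_erase_of_mem (Finset.mem_univ _),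
      Finset.card_univ, Fintype.card_fin]
    omega
  obtain ⟨hr', h5, hs1⟩ := uniform_numeric hs hn hdim hN.1 hr hsum hN.2
  refine ⟨h5, ?_⟩
  by_cases hs2 : s = 1
  · subst hs2
    refine ⟨Q, by omega, fun v hv a ha b hb => ?_⟩
    have h0 : restrictForm Q (B₀ + v) = 0 := by
      by_contra hne
      exact hno v hv (hasHyperbolic_one ((hB₀.add (hV v hv)).restrictForm Q) hne).of_restrictForm
    exact (restrictForm_eq_zero_iff Q _).1 h0 a ha b hb
  · rcases ih Q (by omega) (restrictForm Q B₀) (V.map (restrictForm Q)) (hB₀.restrictForm Q) hVQ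
      (by rwa [Nat.sub_add_cancel hs]) hr' with hc | hc | hc
    · obtain ⟨-, L, hL, hL0⟩ := hc
      refine ⟨L.map Q.subtype, ?_, ?_⟩
      · rw [LinearEquiv.finrank_eq (Submodule.equivMapOfInjective _ Q.injective_subtype L).symm]
        omega
      · rintro v hv _ ⟨a, ha, rfl⟩ _ ⟨b, hb, rfl⟩
        exact hL0 _ ⟨v, hv, rfl⟩ a ha b hb
    · exact absurd (hs1 hc.1) hs2
    -- The exceptional case would give `s = 2` and `n = 6`, which `h5` excludes.
    · have h1 := hc.1
      have h2 := hc.2.1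
      omega

end Uniform

/-! ### Transversals of slices and the final contradiction -/

section Transversal

theorem exists_notMem_notMem {K E : Type*} [Field K] [AddCommGroup E] [Module K E]
    [FiniteDimensional K E] {A B : Submodule K E} (hA : finrank K A < finrank K E)
    (hB : finrank K B < finrank K E) : ∃ z, z ∉ A ∧ z ∉ B := by
  rw [← finrank_top K E] at hA hB
  obtain ⟨a, -, ha⟩ := exists_mem_notMem_of_finrank_lt hA
  obtain ⟨b, -, hb⟩ := exists_mem_notMem_of_finrank_lt hB
  by_cases haB : a ∈ B
  · by_cases hbA : b ∈ A
    · exact ⟨a + b, fun h => ha ((A.add_mem_iff_left hbA).1 h),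
        fun h => hb ((B.add_mem_iff_right haB).1 h)⟩
    · exact ⟨b, hbA, hb⟩
  · exact ⟨a, ha, haB⟩

/-- A greedy choice: each space is larger than the span of the vectors chosen before. -/
theorem exists_linearIndependent_transversal {K E : Type*} [Field K] [AddCommGroup E] [Module K E]
    [FiniteDimensional K E] (k : ℕ) (W : Fin (k + 1) → Submodule K E)
    (hW : ∀ i, k + 1 ≤ finrank K (W i)) {y : E} (hy : y ∈ W 0) (hy0 : y ≠ 0) :
    ∃ f : Fin (k + 1) → E, LinearIndependent K f ∧ f 0 = y ∧ ∀ i, f i ∈ W i := by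
  induction k with
  | zero =>
    have : Subsingleton (Fin (0 + 1)) := inferInstanceAs (Subsingleton (Fin 1))
    refine ⟨fun _ => y, ?_, rfl, fun i => by rwa [Subsingleton.elim i 0]⟩
    exact LinearIndependent.of_subsingleton 0 hy0
  | succ k ih =>
    obtain ⟨f, hf, hf0, hfW⟩ := ih (fun i => W i.castSucc)
      (fun i => (Nat.le_succ _).trans (hW _)) hy
    obtain ⟨z, hz, hzf⟩ := exists_mem_notMem_of_finrank_lt (A := W (Fin.last _))
      (B := Submodule.span K (Set.range f)) (by
        rw [finrank_span_eq_card hf, Fintype.card_fin]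
        exact hW _)
    refine ⟨Fin.snoc f z, hf.finSnoc hzf, ?_, fun i => ?_⟩
    · rw [← Fin.castSucc_zero, Fin.snoc_castSucc, hf0]
    · induction i using Fin.lastCases with
      | last => rwa [Fin.snoc_last]
      | cast i => rw [Fin.snoc_castSucc]; exact hfW i

/-- On the dual family `ψ`, the `i`-th product is nonzero only at the two orderings of the pair
`(inl i, inr i)`. The leading conditions are then immediate for the ordering that puts the left
indices below the right ones. -/
theorem exists_hasHyperbolic_of_wedge_mem {K D : Type*} [Field K] [AddCommGroup D] [Module K D]
    [FiniteDimensional K D] {B₀ : LinearMap.BilinForm K D} (hB₀ : B₀.IsAlt)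
    {V : Submodule K (LinearMap.BilinForm K D)} (hV : ∀ v ∈ V, v.IsAlt) {k : ℕ}
    {f : Fin k ⊕ Fin k → Dual K D} (hf : LinearIndependent K f)
    (hfV : ∀ i, wedge (f (Sum.inr i)) (f (Sum.inl i)) ∈ V) :
    ∃ v ∈ V, HasHyperbolic (B₀ + v) ⊤ k := by
  obtain ⟨ψ, hψ⟩ := exists_biorthogonal hf
  have hval : ∀ i p q, wedge (f (Sum.inr i)) (f (Sum.inl i)) (ψ p) (ψ q) =
      (if Sum.inr i = p then 1 else 0) * (if Sum.inl i = q then 1 else 0) -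
      (if Sum.inl i = p then 1 else 0) * (if Sum.inr i = q then 1 else 0) := fun i p q => by
    rw [wedge_apply, hψ, hψ, hψ, hψ]
  set w : Fin k ⊕ Fin k → ℕ := fun p => 2 ^ (finSumFinEquiv p : ℕ) with hw
  have hwlt : ∀ p q, w p < w q ↔ finSumFinEquiv p < finSumFinEquiv q := fun p q =>
    (Nat.pow_lt_pow_iff_right (by norm_num)).trans Fin.lt_def.symm
  have hinj : Function.Injective w := fun p q hpq => finSumFinEquiv.injective
    (Fin.ext (Nat.pow_right_injective le_rfl hpq))
  obtain ⟨v, hv, hyp⟩ := exists_hasHyperbolic_of_matching w hinj (fun p q b hpq hp hq => by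
    rw [hwlt] at hp hq
    exact two_pow_add_two_pow_lt
      (fun h => hpq (finSumFinEquiv.injective (Fin.ext h))) hp hq)
    B₀ hB₀ V hV k (fun i => Sum.inl i) (fun i => Sum.inr i) (by
      rw [Sum.elim_inl_inr]
      exact Function.injective_id)
    (fun i => by
      rw [hwlt, finSumFinEquiv_apply_left, finSumFinEquiv_apply_right, Fin.lt_def,
        Fin.val_castAdd, Fin.val_natAdd]
      omega)
    (fun i => wedge (f (Sum.inr i)) (f (Sum.inl i))) hfV ψ (fun i => by
      rw [hval]
      simp)
    (fun i p _ q _ hpq hlt => by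
      have hite : ∀ {P Q : Prop} [Decidable P] [Decidable Q], ¬ (P ∧ Q) →
          (if P then (1 : K) else 0) * (if Q then 1 else 0) = 0 := by
        intro P Q _ _ hPQ
        by_cases hP : P
        · rw [if_neg fun hQ => hPQ ⟨hP, hQ⟩, mul_zero]
        · rw [if_neg hP, zero_mul]
      rw [hval]
      by_cases h1 : Sum.inr i = p ∧ Sum.inl i = q
      · rw [← h1.1, ← h1.2, add_comm] at hlt
        exact absurd hlt (lt_irrefl _)
      by_cases h2 : Sum.inl i = p ∧ Sum.inr i = q
      · rw [← h2.1, ← h2.2] at hlt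
        exact absurd hlt (lt_irrefl _)
      rw [hite h1, hite h2, sub_zero])
  exact ⟨v, hv, hyp.mono le_top⟩

/-- With `a ∈ L` and `x a = 1`, vanishing of `x ∧ y` on `L` says that `y - y a • x` annihilates `L`.
-/
theorem finrank_slice_le_of_isotropic {K D : Type*} [Field K] [AddCommGroup D] [Module K D]
    [FiniteDimensional K D] {V : Submodule K (LinearMap.BilinForm K D)} {L : Submodule K D}
    (hL : ∀ v ∈ V, ∀ a ∈ L, ∀ b ∈ L, v a b = 0) {x : Dual K D} (hx : x ∉ L.dualAnnihilator) :
    finrank K (slice V x) ≤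
      finrank K (slice V x ⊓ L.dualAnnihilator : Submodule K (Dual K D)) + 1 := by
  obtain ⟨a, ha, hxa⟩ : ∃ a ∈ L, x a = 1 := by
    rw [Submodule.mem_dualAnnihilator] at hx
    push Not at hx
    obtain ⟨a, ha, hne⟩ := hx
    exact ⟨(x a)⁻¹ • a, L.smul_mem _ ha, by simp [hne]⟩
  have hx0 : x ∉ slice V x ⊓ L.dualAnnihilator := fun h => hx h.2
  rw [← finrank_sup_span_singleton_of_notMem hx0]
  refine Submodule.finrank_mono fun y hy => ?_
  rw [← sub_add_cancel y (y a • x)]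
  refine Submodule.add_mem_sup ⟨Submodule.sub_mem _ hy (Submodule.smul_mem _ _
    (self_mem_slice V x)), ?_⟩ (Submodule.smul_mem _ _ (Submodule.mem_span_singleton_self x))
  rw [SetLike.mem_coe, Submodule.mem_dualAnnihilator]
  intro b hb
  have := hL _ hy a ha b hb
  rw [wedge_apply, hxa, one_mul] at this
  simpa using this

/-- The dimension of the slices of a space of forms that vanish on a subspace of codimension `s + 1`
cannot be uniformly equal to `s + 1`. -/
theorem exists_hasHyperbolic_of_isotropic {K D : Type*} [Field K] [AddCommGroup D] [Module K D]
    [FiniteDimensional K D] {n s : ℕ} (hs : 1 ≤ s) (hn : 2 * s + 2 ≤ n) (h5 : 5 * s + 3 ≤ 2 * n)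
    (hD : finrank K D = n) {B₀ : LinearMap.BilinForm K D} (hB₀ : B₀.IsAlt)
    {V : Submodule K (LinearMap.BilinForm K D)} (hV : ∀ v ∈ V, v.IsAlt)
    (hslice : ∀ x : Dual K D, x ≠ 0 → finrank K (slice V x) = s + 1) {L : Submodule K D}
    (hLn : finrank K L + (s + 1) = n) (hL : ∀ v ∈ V, ∀ a ∈ L, ∀ b ∈ L, v a b = 0) :
    ∃ v ∈ V, HasHyperbolic (B₀ + v) ⊤ (s + 1) := by
  classical
  set G := L.dualAnnihilator with hG
  have hGn : finrank K G = s + 1 := by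
    have := Subspace.finrank_add_finrank_dualAnnihilator_eq L
    rw [← hG] at this
    omega
  have hdual : finrank K (Dual K D) = n := by rw [Subspace.dual_finrank_eq, hD]
  have hY : ∀ x ∉ G, s ≤ finrank K (slice V x ⊓ G : Submodule K (Dual K D)) := fun x hx => by
    have h1 := finrank_slice_le_of_isotropic hL hx
    rw [hslice x (fun h => hx (h ▸ G.zero_mem))] at h1
    exact Nat.le_of_succ_le_succ h1
  obtain ⟨x, -, hx⟩ := exists_mem_notMem_of_finrank_lt (A := (⊤ : Submodule K (Dual K D)))
    (B := G) (by rw [finrank_top]; omega)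
  obtain ⟨y, hy, hy0⟩ := exists_mem_notMem_of_finrank_lt
    (A := slice V x ⊓ G) (B := ⊥) (by
      rw [finrank_bot]
      exact hs.trans (hY x hx))
  rw [Submodule.mem_bot] at hy0
  -- `y` lies in the slice of `x` but not in that of `z`. This asymmetry secures the last vector of
  -- the transversal, where the dimension `s` of the available space is one short for a greedy
  -- choice.
  obtain ⟨z, hzy, hzG⟩ := exists_notMem_notMem (A := slice V y) (B := G ⊔ Submodule.span K {x})
    (by rw [hslice y hy0]; omega) (by rw [finrank_sup_span_singleton_of_notMem hx]; omega)
  obtain ⟨k, rfl⟩ := Nat.exists_eq_add_of_le' hs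
  have hpair : LinearIndependent K ![G.mkQ x, G.mkQ z] := by
    refine linearIndependent_pair_of_notMem ?_ ?_
    · rwa [Submodule.mkQ_apply, Ne, Submodule.Quotient.mk_eq_zero]
    · rw [Submodule.mem_span_singleton]
      rintro ⟨c, hc⟩
      rw [← map_smul, ← sub_eq_zero, ← map_sub, Submodule.mkQ_apply,
        Submodule.Quotient.mk_eq_zero] at hc
      refine hzG ?_
      rw [← sub_sub_self (c • x) z]
      exact Submodule.sub_mem _
        (Submodule.mem_sup_right (Submodule.smul_mem _ _ (Submodule.mem_span_singleton_self x)))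
        (Submodule.mem_sup_left hc)
  obtain ⟨F, hF, hF0, hFl, -⟩ := exists_linearIndependent_family_of_pair (ι := Fin (k + 2))
    (W := ⊤) Submodule.mem_top Submodule.mem_top hpair (i := 0) (j := Fin.last (k + 1))
    (by simp [Fin.ext_iff]) (by
      have := G.finrank_quotient_add_finrank
      rw [finrank_top, Fintype.card_fin]
      omega)
  have hX : ∀ i, ∃ X, G.mkQ X = F i ∧ (i = 0 → X = x) ∧ (i = Fin.last (k + 1) → X = z) := by
    intro i
    by_cases h0 : i = 0
    · exact ⟨x, by rw [h0, hF0], fun _ => rfl, fun h => by simp [h0, Fin.ext_iff] at h⟩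
    by_cases hl : i = Fin.last (k + 1)
    · exact ⟨z, by rw [hl, hFl], fun h => absurd h h0, fun _ => rfl⟩
    · obtain ⟨X, hX⟩ := G.mkQ_surjective (F i)
      exact ⟨X, hX, fun h => absurd h h0, fun h => absurd h hl⟩
  choose X hXF hX0 hXl using hX
  have hXG : ∀ i, X i ∉ G := fun i hi => hF.ne_zero i (by
    rw [← hXF, Submodule.mkQ_apply, Submodule.Quotient.mk_eq_zero]
    exact hi)
  obtain ⟨f, hf, hf0, hfW⟩ := exists_linearIndependent_transversal k
    (fun i => slice V (X i.castSucc) ⊓ G) (fun i => hY _ (hXG _)) (y := y)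
    (by rw [Fin.castSucc_zero, hX0 0 rfl]; exact hy) hy0
  -- Otherwise, by dimension, the part of the slice of `z` in `G` would be the span of `f`, which
  -- contains `y`.
  obtain ⟨t, ht, htf⟩ : ∃ t ∈ slice V z ⊓ G, t ∉ Submodule.span K (Set.range f) := by
    by_contra hno
    push Not at hno
    have h1 : slice V z ⊓ G = Submodule.span K (Set.range f) := by
      refine Submodule.eq_of_le_of_finrank_le hno ?_
      rw [finrank_span_eq_card hf, Fintype.card_fin]
      exact hY z fun h => hzG (Submodule.mem_sup_left h)
    have h2 : y ∈ slice V z ⊓ G := by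
      rw [h1]
      exact Submodule.subset_span ⟨0, hf0⟩
    exact hzy (mem_slice_comm.1 h2.1)
  have hg := hf.finSnoc htf
  set g : Fin (k + 2) → Dual K D := Fin.snoc f t with hgdef
  have hgW : ∀ i, g i ∈ slice V (X i) ⊓ G := by
    intro i
    induction i using Fin.lastCases with
    | last => rw [hgdef, Fin.snoc_last, hXl _ rfl]; exact ht
    | cast i => rw [hgdef, Fin.snoc_castSucc]; exact hfW i
  have hgG : LinearIndependent K (fun i => (⟨g i, (hgW i).2⟩ : G)) :=
    LinearIndependent.of_comp G.subtype hg
  have hli := hgG.sumElim_of_quotient X (by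
    rw [show Submodule.Quotient.mk (p := G) ∘ X = F from funext hXF]
    exact hF)
  exact exists_hasHyperbolic_of_wedge_mem hB₀ hV hli fun i => (hgW i).1

end Transversal

/-! ### The induction -/

section Classification

theorem classified_zero.{u, v} {K : Type u} [Field K] (n : ℕ) : Classified.{u, v} K n 0 := by
  intro D _ _ _ hD B₀ V hB₀ hV h hdim
  refine Or.inl ⟨by rw [hdim]; simp [twiceBound], ⊤, by simp, fun v hv a _ b _ => ?_⟩
  by_contra hne
  exact h v hv (hasHyperbolic_one (hB₀.add (hV v hv)) fun h0 => hne (by rw [h0]; rfl))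

/-- Strong induction on `n`, calling `(n - 1, s - 1)`, `(n - 1, s)` and `(n - 2, s - 1)` according
to the dimensions of the slices; the last call leads to a contradiction. For `n = 2 * s + 1` the
zero subspace serves as common radical. -/
theorem classified.{u, v} {K : Type u} [Field K] (n : ℕ) :
    ∀ s, 2 * s < n → Classified.{u, v} K n s := by
  induction n using Nat.strong_induction_on with
  | _ n ih =>
    intro s hs
    rcases Nat.eq_zero_or_pos s with rfl | hs1
    · exact classified_zero n
    intro D _ _ _ hD B₀ V hB₀ hV h hdim
    rcases Nat.lt_or_ge n (2 * s + 2) with hn | hn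
    · refine Or.inr (Or.inl ⟨?_, ⊥, by rw [finrank_bot]; omega, fun v _ a ha b => ?_⟩)
      · rw [hdim, twiceBound, max_eq_left]
        obtain rfl : n = 2 * s + 1 := by omega
        have h1 : 2 * (2 * s + 1) - s - 1 = 3 * s + 1 := by omega
        rw [h1]
        nlinarith
      · rw [(Submodule.mem_bot K).1 ha, map_zero, LinearMap.zero_apply]
    by_cases hupp : ∃ x : Dual K D, x ≠ 0 ∧ 2 * s + 1 < finrank K (slice V x)
    · obtain ⟨x, hx, hslice⟩ := hupp
      exact Or.inl (isotropicCase_of_lt_finrank_slice hs1 hn hD (ih _ (by omega) _ (by omega)) hB₀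
        hV h hdim hx hslice)
    by_cases hlow : ∃ x : Dual K D, x ≠ 0 ∧ finrank K (slice V x) = 1
    · obtain ⟨x, hx, hslice⟩ := hlow
      exact Or.inr (case_of_finrank_slice_eq_one hs1 hn hD (ih _ (by omega) _ (by omega)) hB₀
        hV h hdim hx hslice)
    push Not at hupp hlow
    exfalso
    have hlow' : ∀ x : Dual K D, x ≠ 0 → 2 ≤ finrank K (slice V x) := fun x hx => by
      have h1 := finrank_slice V hV hx
      have h2 := hlow x hx
      omega
    obtain ⟨h5, L, hLn, hL⟩ := exists_isotropic_of_uniform hs1 hn hD (ih _ (by omega) _ (by omega))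
      hB₀ hV h hdim hlow' hupp
    obtain ⟨v, hv, hyp⟩ := exists_hasHyperbolic_of_isotropic hs1 hn h5 hD hB₀ hV
      (fun x hx => finrank_slice_eq_succ hn hD hB₀ hV h hdim hlow' hupp hx) hLn
      (fun v hv a ha b hb => by
        have h1 := hL v hv a ha b hb
        have h2 := hL 0 V.zero_mem a ha b hb
        rw [LinearMap.add_apply, LinearMap.add_apply] at h1 h2
        simpa [h2] using h1.trans h2.symm)
    exact h v hv hyp

end Classification

/-! ### From bilinear forms back to matrices and congruence -/

section Matrices

variable {K : Type*} [Field K] {n : ℕ}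

theorem isAlt_toBilin' {M : Matrix (Fin n) (Fin n) K} (hM : M ∈ alternatingMatrices n K) :
    (Matrix.toBilin' M).IsAlt := by
  have hswap : ∀ x y, Matrix.toBilin' M x y = -Matrix.toBilin' M y x := by
    intro x y
    have h1 : Matrix.toBilin' M = -(Matrix.toBilin' M).flip := by
      refine (Pi.basisFun K (Fin n)).ext fun i => (Pi.basisFun K (Fin n)).ext fun j => ?_
      have h2 := congrFun (congrFun hM.1 j) i
      simp only [Pi.basisFun_apply, LinearMap.neg_apply, LinearMap.BilinForm.flip_apply,
        Matrix.toBilin'_single]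
      exact h2
    exact congrArg (fun B : LinearMap.BilinForm K (Fin n → K) => B x y) h1
  intro x
  have hx : x ∈ Submodule.span K (Set.range (Pi.basisFun K (Fin n))) := by
    rw [Basis.span_eq]
    exact Submodule.mem_top
  induction hx using Submodule.span_induction with
  | mem x hx =>
    obtain ⟨i, rfl⟩ := hx
    rw [Pi.basisFun_apply, Matrix.toBilin'_single]
    exact hM.2 i
  | zero => simp
  | add x y _ _ hx hy =>
    simp only [map_add, LinearMap.add_apply, hx, hy]
    rw [hswap x y]
    ring
  | smul c x _ hx => simp [hx]

/-- The matrix `N` with the vectors of the family as rows makes `N * M` onto: up to sign, each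
vector of a pair is sent to the unit vector of its partner. -/
theorem two_mul_le_rank {M : Matrix (Fin n) (Fin n) K} (hM : M ∈ alternatingMatrices n K) {k : ℕ}
    (h : HasHyperbolic (Matrix.toBilin' M) ⊤ k) : 2 * k ≤ M.rank := by
  obtain ⟨u, v, -, -, huu, hvv, huv⟩ := h
  set N : Matrix (Fin k ⊕ Fin k) (Fin n) K := Matrix.of (Sum.elim u v) with hN
  have hval : ∀ i y, ((N * M).mulVec y) i = Matrix.toBilin' M (Sum.elim u v i) y := fun i y => by
    rw [← Matrix.mulVec_mulVec, Matrix.toBilin'_apply']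
    rfl
  have hrange : LinearMap.range (N * M).mulVecLin = ⊤ := by
    rw [eq_top_iff, ← (Pi.basisFun K (Fin k ⊕ Fin k)).span_eq, Submodule.span_le]
    rintro _ ⟨i | i, rfl⟩
    · refine ⟨v i, ?_⟩
      ext j
      rw [Matrix.mulVecLin_apply, hval, Pi.basisFun_apply]
      rcases j with j | j
      · simp [huv, Pi.single_apply]
      · simp [hvv]
    · refine ⟨-u i, ?_⟩
      ext j
      rw [Matrix.mulVecLin_apply, hval, Pi.basisFun_apply, map_neg]
      rcases j with j | j
      · simp [huu]
      · rw [Sum.elim_inr, (isAlt_toBilin' hM).swap, huv]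
        simp [Pi.single_apply, eq_comm]
  have h1 : (N * M).rank = 2 * k := by
    rw [Matrix.rank, hrange, finrank_top, finrank_fintype_fun_eq_card]
    simp [two_mul]
  rw [← h1]
  exact Matrix.rank_mul_le_right N M

theorem two_mul_finrank_alternatingMatrices_le (m : ℕ) :
    2 * finrank K (alternatingMatrices m K) ≤ m * m - m := by
  rw [← LinearEquiv.finrank_map_eq (Matrix.toBilin' (R₁ := K) (n := Fin m))]
  refine two_mul_finrank_le_of_isAlt (Pi.basisFun K (Fin m)) _ ?_
  rintro _ ⟨M, hM, rfl⟩
  exact isAlt_toBilin' hM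

/-- An affine space of matrices that is moved by a change of basis into a set of differences in a
space of no larger dimension is congruent to this set. -/
theorem setsCongruent_of_toMatrix_mem {S : AffineSubspace K (Matrix (Fin n) (Fin n) K)}
    (hne : (S : Set (Matrix (Fin n) (Fin n) K)).Nonempty) (b : Basis (Fin n) K (Fin n → K))
    {T : Set (Matrix (Fin n) (Fin n) K)} (W : Submodule K (Matrix (Fin n) (Fin n) K))
    (hW : finrank K W ≤ finrank K S.direction) (hT : ∀ X ∈ T, ∀ Y ∈ T, X - Y ∈ W)
    (hS : ∀ M ∈ S, LinearMap.BilinForm.toMatrix b (Matrix.toBilin' M) ∈ T) :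
    SetsCongruent (S : Set (Matrix (Fin n) (Fin n) K)) T := by
  set Φ : Matrix (Fin n) (Fin n) K ≃ₗ[K] Matrix (Fin n) (Fin n) K :=
    Matrix.toBilin'.trans (LinearMap.BilinForm.toMatrix b) with hΦ
  set Q := (Pi.basisFun K (Fin n)).toMatrix b with hQ
  have hΦQ : ∀ M, Φ M = Q.transpose * M * Q := fun M => by
    rw [hΦ, LinearEquiv.trans_apply, hQ,
      ← LinearMap.BilinForm.toMatrix_mul_basis_toMatrix (Pi.basisFun K (Fin n)),
      LinearMap.BilinForm.toMatrix_basisFun, LinearMap.BilinForm.toMatrix'_toBilin']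
  set Q' := b.toMatrix (Pi.basisFun K (Fin n)) with hQ'
  have hQQ : Q * Q' = 1 := Basis.toMatrix_mul_toMatrix_flip _ _
  have hQQ' : Q' * Q = 1 := Basis.toMatrix_mul_toMatrix_flip _ _
  have hinv : ∀ M, Q'.transpose * (Φ M) * Q' = M := fun M => by
    rw [hΦQ, ← Matrix.mul_assoc, ← Matrix.mul_assoc, ← Matrix.transpose_mul, hQQ,
      Matrix.transpose_one, Matrix.one_mul, Matrix.mul_assoc, hQQ, Matrix.mul_one]
  obtain ⟨M₀, hM₀⟩ := hne
  -- Differences of elements of the image lie in `W`, whose dimension is not larger; hence the image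
  -- of the direction is all of `W`, and the image of `S` is all of `T`.
  have hdir : S.direction.map Φ.toLinearMap = W := by
    refine Submodule.eq_of_le_of_finrank_le ?_ ?_
    · rintro _ ⟨N, hN, rfl⟩
      have h1 := hT _ (hS _ (AffineSubspace.vadd_mem_of_mem_direction hN hM₀)) _ (hS _ hM₀)
      rw [vadd_eq_add, map_add, map_add, add_sub_cancel_right] at h1
      exact h1
    · rw [LinearEquiv.finrank_map_eq]
      exact hW
  refine ⟨Q'.transpose, ?_, ?_⟩
  · rw [Matrix.isUnit_transpose]
    exact IsUnit.of_mul_eq_one Q hQQ'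
  · ext M
    rw [Set.mem_image]
    constructor
    · intro hM
      exact ⟨Φ M, hS M hM, by rw [Matrix.transpose_transpose, hinv]⟩
    · rintro ⟨X, hX, rfl⟩
      obtain ⟨N, hN, hNX⟩ : X - Φ M₀ ∈ S.direction.map Φ.toLinearMap := by
        rw [hdir]
        exact hT X hX _ (hS M₀ hM₀)
      have hX' : X = Φ (N + M₀) := by
        rw [map_add]
        exact (sub_eq_iff_eq_add.1 hNX.symm)
      rw [Matrix.transpose_transpose, hX', hinv]
      exact AffineSubspace.vadd_mem_of_mem_direction hN hM₀

theorem exists_adapted_basis {D : Type*} [AddCommGroup D] [Module K D] [FiniteDimensional K D]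
    (hD : finrank K D = n) {L : Submodule K D} {k : ℕ} (hk : k ≤ n) (hL : finrank K L + k = n) :
    ∃ b : Basis (Fin n) K D, ∀ j, b (blockEquiv hk (Sum.inr j)) ∈ L := by
  obtain ⟨C, hC⟩ := L.exists_isCompl
  have hCk : finrank K C = k := by
    have := Submodule.finrank_add_eq_of_isCompl hC
    omega
  refine ⟨(((finBasisOfFinrankEq K C hCk).prod
    (finBasisOfFinrankEq K L (show finrank K L = n - k by omega))).map
    (Submodule.prodEquivOfIsCompl C L hC.symm)).reindex (blockEquiv hk), fun j => ?_⟩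
  simp

theorem toMatrix_eq_blockMatrix {D : Type*} [AddCommGroup D] [Module K D] {k : ℕ} (hk : k ≤ n)
    (b : Basis (Fin n) K D) {B : LinearMap.BilinForm K D} (hB : B.IsAlt)
    (h : ∀ i j, B (b (blockEquiv hk (Sum.inr i))) (b (blockEquiv hk (Sum.inr j))) = 0) :
    ∃ A ∈ alternatingMatrices k K, LinearMap.BilinForm.toMatrix b B = blockMatrix hk A
      (Matrix.of fun i j => B (b (blockEquiv hk (Sum.inl i))) (b (blockEquiv hk (Sum.inr j))))
      (-(Matrix.of fun i j => B (b (blockEquiv hk (Sum.inl i)))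
        (b (blockEquiv hk (Sum.inr j)))).transpose) 0 := by
  refine ⟨Matrix.of fun i j => B (b (blockEquiv hk (Sum.inl i))) (b (blockEquiv hk (Sum.inl j))),
    ⟨?_, fun i => hB _⟩, ?_⟩
  · ext i j
    exact hB.swap _ _
  · ext i j
    obtain ⟨i, rfl⟩ := (blockEquiv hk).surjective i
    obtain ⟨j, rfl⟩ := (blockEquiv hk).surjective j
    rw [LinearMap.BilinForm.toMatrix_apply, blockMatrix, Matrix.reindex_apply,
      Matrix.submatrix_apply, Equiv.symm_apply_apply, Equiv.symm_apply_apply]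
    rcases i with i | i <;> rcases j with j | j
    · rfl
    · rfl
    · rw [hB.swap]; rfl
    · rw [h]; rfl

/-- The matrix with the blocks `A`, `B`, `-Bᵀ` and `0`, as a linear function of `A` and `B`. -/
def alternatingBlocks {k : ℕ} (hk : k ≤ n) :
    alternatingMatrices k K × Matrix (Fin k) (Fin (n - k)) K →ₗ[K] Matrix (Fin n) (Fin n) K where
  toFun p := blockMatrix hk p.1 p.2 (-p.2.transpose) 0
  map_add' p q := by
    ext i j
    obtain ⟨i, rfl⟩ := (blockEquiv hk).surjective i
    obtain ⟨j, rfl⟩ := (blockEquiv hk).surjective j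
    rcases i with i | i <;> rcases j with j | j <;> simp [blockMatrix, add_comm]
  map_smul' c p := by
    ext i j
    obtain ⟨i, rfl⟩ := (blockEquiv hk).surjective i
    obtain ⟨j, rfl⟩ := (blockEquiv hk).surjective j
    rcases i with i | i <;> rcases j with j | j <;> simp [blockMatrix]

/-- In a basis that ends with a basis of `L`, the lower right block vanishes, and `hdim` says that
`S` is as large as the space of all such matrices. -/
theorem setsCongruent_spaceWA {s : ℕ} (hs : s ≤ n)
    {S : AffineSubspace K (Matrix (Fin n) (Fin n) K)}
    (hne : (S : Set (Matrix (Fin n) (Fin n) K)).Nonempty)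
    (halt : (S : Set (Matrix (Fin n) (Fin n) K)) ⊆ alternatingMatrices n K)
    (hdim : s * s - s + 2 * (s * (n - s)) ≤ 2 * finrank K S.direction)
    {L : Submodule K (Fin n → K)} (hL : finrank K L + s = n)
    (hSL : ∀ M ∈ S, ∀ a ∈ L, ∀ b ∈ L, Matrix.toBilin' M a b = 0) :
    SetsCongruent (S : Set (Matrix (Fin n) (Fin n) K)) (spaceWA n s hs K) := by
  obtain ⟨b, hb⟩ := exists_adapted_basis (by simp) hs hL
  refine setsCongruent_of_toMatrix_mem hne b (LinearMap.range (alternatingBlocks hs)) ?_ ?_ ?_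
  · have h1 := LinearMap.finrank_range_le (alternatingBlocks (K := K) hs)
    have h2 := two_mul_finrank_alternatingMatrices_le (K := K) s
    rw [finrank_prod, finrank_matrix, Fintype.card_fin, Fintype.card_fin, finrank_self,
      mul_one] at h1
    omega
  · rintro _ ⟨A, hA, B, rfl⟩ _ ⟨A', hA', B', rfl⟩
    exact Submodule.sub_mem _ ⟨(⟨A, hA⟩, B), rfl⟩ ⟨(⟨A', hA'⟩, B'), rfl⟩
  · intro M hM
    obtain ⟨A, hA, h⟩ := toMatrix_eq_blockMatrix hs b (isAlt_toBilin' (halt hM))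
      (fun i j => hSL M hM _ (hb i) _ (hb j))
    exact ⟨A, hA, _, h⟩

theorem setsCongruent_zeroPadding {k : ℕ} (hk : k ≤ n)
    {S : AffineSubspace K (Matrix (Fin n) (Fin n) K)}
    (hne : (S : Set (Matrix (Fin n) (Fin n) K)).Nonempty)
    (halt : (S : Set (Matrix (Fin n) (Fin n) K)) ⊆ alternatingMatrices n K)
    (hdim : k * k - k ≤ 2 * finrank K S.direction)
    {R : Submodule K (Fin n → K)} (hR : finrank K R + k = n)
    (hSR : ∀ M ∈ S, ∀ a ∈ R, ∀ b, Matrix.toBilin' M a b = 0) :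
    SetsCongruent (S : Set (Matrix (Fin n) (Fin n) K))
      (zeroPadding hk (alternatingMatrices k K : Set _)) := by
  obtain ⟨b, hb⟩ := exists_adapted_basis (by simp) hk hR
  refine setsCongruent_of_toMatrix_mem hne b
    (LinearMap.range ((alternatingBlocks hk).comp (LinearMap.inl K _ _))) ?_ ?_ ?_
  · have h1 := LinearMap.finrank_range_le ((alternatingBlocks (K := K) hk).comp
      (LinearMap.inl K (alternatingMatrices k K) (Matrix (Fin k) (Fin (n - k)) K)))
    have h2 := two_mul_finrank_alternatingMatrices_le (K := K) k
    omega
  · rintro _ ⟨A, hA, rfl⟩ _ ⟨A', hA', rfl⟩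
    exact Submodule.sub_mem _ ⟨⟨A, hA⟩, by simp [alternatingBlocks]⟩
      ⟨⟨A', hA'⟩, by simp [alternatingBlocks]⟩
  · intro M hM
    have hB := isAlt_toBilin' (halt hM)
    obtain ⟨A, hA, h⟩ := toMatrix_eq_blockMatrix hk b hB (fun i j => hSR M hM _ (hb i) _)
    refine ⟨A, hA, ?_⟩
    have h0 : (Matrix.of fun i j => Matrix.toBilin' M (b (blockEquiv hk (Sum.inl i)))
        (b (blockEquiv hk (Sum.inr j)))) = 0 := by
      ext i j
      rw [Matrix.of_apply, hB.swap, hSR M hM _ (hb j), neg_zero]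
      rfl
    rw [h, h0, Matrix.transpose_zero, neg_zero]

/-- The linear part of the exceptional affine space. -/
def exceptionalDirection (K : Type*) [Field K] :
    (Fin 3 → K) →ₗ[K] Matrix (Fin 4) (Fin 4) K where
  toFun x := !![0, x 0, x 1, x 2;
                x 0, 0, x 2, 0;
                x 1, x 2, 0, 0;
                x 2, 0, 0, 0]
  map_add' x y := by
    ext i j
    fin_cases i <;> fin_cases j <;> simp
  map_smul' c x := by
    ext i j
    fin_cases i <;> fin_cases j <;> simp

theorem sub_mem_range_exceptionalDirection {X Y : Matrix (Fin 4) (Fin 4) K}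
    (hX : X ∈ exceptionalU K) (hY : Y ∈ exceptionalU K) :
    X - Y ∈ LinearMap.range (exceptionalDirection K) := by
  obtain ⟨a, b, c, rfl⟩ := hX
  obtain ⟨a', b', c', rfl⟩ := hY
  refine ⟨![a - a', b - b', c - c'], ?_⟩
  ext i j
  fin_cases i <;> fin_cases j <;> simp [exceptionalDirection]

theorem setsCongruent_exceptionalU {S : AffineSubspace K (Matrix (Fin 4) (Fin 4) K)}
    (hne : (S : Set (Matrix (Fin 4) (Fin 4) K)).Nonempty) (hdim : 3 ≤ finrank K S.direction)
    (e : Basis (Fin 4) K (Fin 4 → K))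
    (hS : ∀ M ∈ S, LinearMap.BilinForm.toMatrix e (Matrix.toBilin' M) ∈ exceptionalU K) :
    SetsCongruent (S : Set (Matrix (Fin 4) (Fin 4) K)) (exceptionalU K) := by
  refine setsCongruent_of_toMatrix_mem hne e (LinearMap.range (exceptionalDirection K)) ?_
    (fun X hX Y hY => sub_mem_range_exceptionalDirection hX hY) hS
  refine (LinearMap.finrank_range_le _).trans (le_trans ?_ hdim)
  simp

theorem two_mul_choose_two (m : ℕ) : 2 * m.choose 2 = m * m - m := by
  rw [Nat.choose_two_right, Nat.two_mul_div_two_of_even (Nat.even_mul_pred_self m), Nat.mul_sub,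
    mul_one]

theorem mul_sub_sub_eq {n s : ℕ} (hs : 2 * s < n) :
    s * (2 * n - s - 1) = s * s - s + 2 * (s * (n - s)) := by
  obtain ⟨t, rfl⟩ := Nat.exists_eq_add_of_le (show 2 * s + 1 ≤ n from hs)
  have h1 : 2 * (2 * s + 1 + t) - s - 1 = 3 * s + 1 + 2 * t := by omega
  have h2 : 2 * s + 1 + t - s = s + 1 + t := by omega
  have h3 : s ≤ s * s := Nat.le_mul_self s
  rw [h1, h2, ← Nat.sub_add_comm h3]
  refine Nat.eq_sub_of_add_eq ?_
  ring

theorem twiceBound_eq {n s : ℕ} (hs : 2 * s < n) :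
    twiceBound n s = 2 * max ((2 * s + 1).choose 2) (s.choose 2 + s * (n - s)) := by
  have h1 : (2 * s + 1) * (2 * s) = (2 * s + 1) * (2 * s + 1) - (2 * s + 1) := by
    refine Nat.eq_sub_of_add_eq ?_
    ring
  rw [twiceBound, ← Nat.mul_max_mul_left, Nat.mul_add, two_mul_choose_two, two_mul_choose_two,
    mul_sub_sub_eq hs, h1]

end Matrices

end AffineSpacesOfAlternatingForms

theorem mainTheorem1 {K : Type*} [Field K] (n s : ℕ) (hs : 2 * s < n)
    (S : AffineSubspace K (Matrix (Fin n) (Fin n) K))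
    (hne : (S : Set (Matrix (Fin n) (Fin n) K)).Nonempty)
    (halt : (S : Set (Matrix (Fin n) (Fin n) K)) ⊆ alternatingMatrices n K)
    (hrk : upperRank (S : Set (Matrix (Fin n) (Fin n) K)) ≤ 2 * s) :
    Module.finrank K S.direction ≤
        max ((2 * s + 1).choose 2) (s.choose 2 + s * (n - s)) ∧
      (Module.finrank K S.direction =
          max ((2 * s + 1).choose 2) (s.choose 2 + s * (n - s)) →
        SetsCongruent (S : Set (Matrix (Fin n) (Fin n) K)) (spaceWA n s (by omega) K) ∨
        SetsCongruent (S : Set (Matrix (Fin n) (Fin n) K))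
          (zeroPadding (k := 2 * s + 1) (n := n) (by omega)
            (alternatingMatrices (2 * s + 1) K : Set _)) ∨
        (s = 1 ∧ Nat.card K = 2 ∧ ∃ h : n = 4,
          SetsCongruent
            (Matrix.reindex (finCongr h) (finCongr h) '' (S : Set (Matrix (Fin n) (Fin n) K)))
            (exceptionalU K))) := by
  obtain ⟨M₀, hM₀⟩ := hne
  have hadd : ∀ N ∈ S.direction, M₀ + N ∈ S := fun N hN => by
    rw [add_comm]
    exact AffineSubspace.vadd_mem_of_mem_direction hN hM₀
  set V := S.direction.map
    (Matrix.toBilin' : Matrix (Fin n) (Fin n) K ≃ₗ[K] _).toLinearMap with hVdef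
  have hVfin : Module.finrank K V = Module.finrank K S.direction := LinearEquiv.finrank_map_eq _ _
  have hB₀ : (Matrix.toBilin' M₀).IsAlt := isAlt_toBilin' (halt hM₀)
  have hV : ∀ v ∈ V, v.IsAlt := by
    rintro _ ⟨N, hN, rfl⟩
    refine isAlt_toBilin' ?_
    rw [← add_sub_cancel_left M₀ N]
    exact Submodule.sub_mem _ (halt (hadd N hN)) (halt hM₀)
  -- `s + 1` hyperbolic pairs would give a matrix of rank at least `2 * s + 2` in `S`.
  have hno : ∀ v ∈ V, ¬ HasHyperbolic (Matrix.toBilin' M₀ + v) ⊤ (s + 1) := by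
    rintro _ ⟨N, hN, rfl⟩ hyp
    have h1 : Matrix.toBilin' M₀ + Matrix.toBilin' N = Matrix.toBilin' (M₀ + N) :=
      (map_add _ _ _).symm
    rw [LinearEquiv.coe_coe, h1] at hyp
    have h2 := two_mul_le_rank (halt (hadd N hN)) hyp
    have h3 := (isGreatest_upperRank _ ⟨M₀, hM₀⟩).2 ⟨_, hadd N hN, rfl⟩
    omega
  have hSV : ∀ M ∈ S, ∃ v ∈ V, Matrix.toBilin' M = Matrix.toBilin' M₀ + v := fun M hM =>
    ⟨_, ⟨M - M₀, AffineSubspace.vsub_mem_direction hM hM₀, rfl⟩, by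
      rw [LinearEquiv.coe_coe, ← map_add, add_sub_cancel]⟩
  have hbound := two_mul_finrank_le hs (Pi.basisFun K (Fin n)) _ hB₀ V hV hno
  rw [twiceBound_eq hs, hVfin] at hbound
  refine ⟨by omega, fun heq => ?_⟩
  rcases classified n s hs (Fin n → K) (by simp) _ V hB₀ hV hno
    (by rw [hVfin, heq, twiceBound_eq hs]) with ⟨hdim, L, hL, hL0⟩ | ⟨hdim, R, hR, hR0⟩ |
    ⟨rfl, hn, hK, hdim, e, he⟩
  · refine Or.inl (setsCongruent_spaceWA _ ⟨M₀, hM₀⟩ halt ?_ (by simpa using hL) ?_)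
    · rw [← hVfin, hdim, Module.finrank_fin_fun, mul_sub_sub_eq hs]
    · intro M hM
      obtain ⟨v, hv, h⟩ := hSV M hM
      rw [h]
      exact hL0 v hv
  · refine Or.inr (Or.inl (setsCongruent_zeroPadding _ ⟨M₀, hM₀⟩ halt ?_ (by simpa using hR) ?_))
    · rw [← hVfin, hdim, Nat.sub_le_iff_le_add]
      exact le_of_eq (by ring)
    · intro M hM
      obtain ⟨v, hv, h⟩ := hSV M hM
      rw [h]
      exact hR0 v hv
  · rw [Module.finrank_fin_fun] at hn
    subst hn
    refine Or.inr (Or.inr ⟨rfl, hK, rfl, ?_⟩)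
    have himage : Matrix.reindex (finCongr rfl) (finCongr rfl) ''
        (S : Set (Matrix (Fin 4) (Fin 4) K)) = S :=
      (Set.image_congr fun M _ => rfl).trans (Set.image_id _)
    rw [himage]
    refine setsCongruent_exceptionalU ⟨M₀, hM₀⟩ (by omega) e fun M hM => ?_
    obtain ⟨v, hv, h⟩ := hSV M hM
    rw [h]
    exact he v hv
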